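/- Let $\Omega\subset\mathbb{R}^2$ be a bounded Lipschitz domain whose boundary $\Gamma=\partial\Omega$ is piecewise smooth, and let $\mathcal{E}_h$ be a finite partition of $\Gamma$ into non-overlapping open arcs $E$ with set of vertices $\mathcal{N}_h$: for each $E$ there is an injective, smooth, positively oriented path $\gamma_E:[0,1]\to\overline{E}$, onto $\overline E$, with $\gamma_E'\neq 0$ on $[0,1]$; the closed arcs cover $\Gamma$, and an open arc meets no other closed arc. Let $t$ be the unit tangent of $\Gamma$ in positive orientation, $n$ the exterior unit normal, $(t\,|\,n)$ the matrix with columns $t$ and $n$, $\partial_t$ the arc-length derivative, and $\langle\cdot,\cdot\rangle_E$ the $L_2(E)$ inner product with respect to arc length. For $m\ge 0$ let $P_m(E)=\{q\circ\gamma_E^{-1}: q \text{ a polynomial of degree}\le m\}$, let $P_m(E)=\{0\}$ for $m<0$, and let $P_m(\mathcal{E}_h)=\{v\in L_2(\Gamma): v|_E\in P_m(E)\ \forall E\in\mathcal{E}_h\}$. For $p\in\mathbb{N}_0$ set \[ Y_h=\{(v_0,v_n)\in P_{p+2+\delta_{p0}}(\mathcal{E}_h)\times P_{p+1}(\mathcal{E}_h):\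 v_0\in C^0(\Gamma),\ (\partial_t v_0,v_n)(t\,|\,n)\in C^0(\Gamma)^2\}, \] where $\delta_{p0}$ is the Kronecker symbol. Let $H(\mathrm{div}\,\mathrm{Div},\Omega;\mathbf S)$ be the space of symmetric tensors $Q\in L_2(\Omega)^{2\times2}$ with $\mathrm{div}\,\mathrm{Div}\,Q\in L_2(\Omega)$, with the graph norm $(\|Q\|_\Omega^2+\|\mathrm{div}\,\mathrm{Div}\,Q\|_\Omega^2)^{1/2}$; for $v\in H^2(\Omega)$ let $\mathrm{tr}\,v\in H(\mathrm{div}\,\mathrm{Div},\Omega;\mathbf S)^*$ be the functional $Q\mapsto(\mathrm{div}\,\mathrm{Div}\,Q,v)_\Omega-(Q,\nabla\nabla v)_\Omega$; and let $H^{3/2,1/2}(\Gamma)=\mathrm{tr}(H^2(\Omega))$, where $\mathrm{tr}\,v$ is identified with its pair of components $(v|_\Gamma,\partial_n v|_\Gamma)$. Then, for every $p\in\mathbb{N}_0$: (i) $Y_h$ is a subspace of $H^{3/2,1/2}(\Gamma)$; that is, there is an injective linear map $J:Y_h\to H^{3/2,1/2}(\Gamma)$ such that for each $(v_0,v_n)\in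 Y_h$ there is $v\in H^2(\Omega)$ with $J(v_0,v_n)=\mathrm{tr}\,v$, $v|_\Gamma=v_0$ and $\partial_n v|_\Gamma=v_n$ in the sense of Sobolev traces. (ii) $\dim Y_h=(2p+2+\delta_{p0})\,\#\mathcal{E}_h$. (iii) $Y_h$ is unisolvent for the degrees of freedom \[ v_0(z),\quad (\partial_t v_0,v_n)(t\,|\,n)(z)\qquad (z\in\mathcal{N}_h), \] \[ \langle v_n,\mu\rangle_E\quad(\mu\in P_{p-1}(E),\ E\in\mathcal{E}_h),\qquad \langle v_0,\mu\rangle_E\quad(\mu\in P_{p-2}(E),\ E\in\mathcal{E}_h); \] that is, the linear map that sends $(v_0,v_n)\in Y_h$ to the family of these values (nodal values in $\mathbb{R}$ and $\mathbb{R}^2$, and, for each $E$, linear functionals on $P_{p-1}(E)$ and $P_{p-2}(E)$) is a bijection onto the space of all such data. -/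

import Mathlib

open MeasureTheory Set Filter Topology
open scoped ContDiff ENNReal Polynomial

/-- The Euclidean plane. -/
abbrev Plane : Type := EuclideanSpace ℝ (Fin 2)

/-- `L₂(Ω)` (real valued, Lebesgue measure). -/
abbrev L2 (Ω : Set Plane) : Type := Lp ℝ 2 (volume.restrict Ω)

/-- Classical partial derivative `∂ᵢ φ`. -/
noncomputable def pd (i : Fin 2) (φ : Plane → ℝ) (x : Plane) : ℝ :=
  fderiv ℝ φ x (EuclideanSpace.single i 1)

/-- Test functions on `Ω`: smooth with compact support in `Ω`. -/
structure IsTest (Ω : Set Plane) (φ : Plane → ℝ) : Prop where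
  smooth : ContDiff ℝ ∞ φ
  compact : HasCompactSupport φ
  support : tsupport φ ⊆ Ω

/-- `Ω` is a Lipschitz set: near each boundary point it is, after a rotation or reflection of
the coordinates, the region below the graph of a Lipschitz function. -/
def IsLipschitzSet (Ω : Set Plane) : Prop :=
  ∀ x ∈ frontier Ω, ∃ (R : Plane ≃ₗᵢ[ℝ] Plane) (r : ℝ) (K : NNReal) (f : ℝ → ℝ),
    0 < r ∧ LipschitzWith K f ∧ ∀ y ∈ Metric.ball x r, y ∈ Ω ↔ (R y) 1 < f ((R y) 0)

/-- `g` is the weak derivative `∂ᵢ f` in `Ω`. -/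
def IsWeakDeriv (Ω : Set Plane) (i : Fin 2) (f g : L2 Ω) : Prop :=
  ∀ φ, IsTest Ω φ → ∫ x in Ω, f x * pd i φ x = -∫ x in Ω, g x * φ x

/-- `d` is the weak (distributional) `div Div Q` in `Ω`, `Div` being the row-wise divergence. -/
def IsWeakDivDiv (Ω : Set Plane) (Q : Fin 2 × Fin 2 → L2 Ω) (d : L2 Ω) : Prop :=
  ∀ φ, IsTest Ω φ → ∑ ij, ∫ x in Ω, Q ij x * pd ij.1 (pd ij.2 φ) x = ∫ x in Ω, d x * φ x

lemma IsTest.pd {Ω : Set Plane} {φ : Plane → ℝ} (h : IsTest Ω φ) (i : Fin 2) :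
    IsTest Ω (pd i φ) := by
  refine ⟨?_, ?_, ?_⟩
  · exact (h.smooth.fderiv_right (m := ∞) (by simp)).clm_apply contDiff_const
  · exact h.compact.fderiv_apply ℝ _
  · exact (tsupport_fderiv_apply_subset ℝ _).trans h.support

lemma IsTest.integrable_mul {Ω : Set Plane} {φ : Plane → ℝ} (h : IsTest Ω φ) (f : L2 Ω) :
    Integrable (fun x => f x * φ x) (volume.restrict Ω) :=
  (Lp.memLp f).integrable_mul (q := 2)
    ((h.smooth.continuous.memLp_of_hasCompactSupport h.compact).restrict Ω)

lemma integral_add_mul_test {Ω : Set Plane} {φ : Plane → ℝ} (h : IsTest Ω φ) (f g : L2 Ω) :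
    ∫ x in Ω, (f + g) x * φ x = (∫ x in Ω, f x * φ x) + ∫ x in Ω, g x * φ x := by
  rw [← integral_add (h.integrable_mul f) (h.integrable_mul g)]
  refine integral_congr_ae ?_
  filter_upwards [Lp.coeFn_add f g] with x hx
  rw [hx, Pi.add_apply, add_mul]

lemma integral_smul_mul_test {Ω : Set Plane} {φ : Plane → ℝ} (c : ℝ) (f : L2 Ω) :
    ∫ x in Ω, (c • f) x * φ x = c * ∫ x in Ω, f x * φ x := by
  rw [← integral_const_mul]
  refine integral_congr_ae ?_
  filter_upwards [Lp.coeFn_smul c f] with x hx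
  rw [hx, Pi.smul_apply, smul_eq_mul, mul_assoc]

lemma integral_zero_mul_test {Ω : Set Plane} {φ : Plane → ℝ} :
    ∫ x in Ω, (0 : L2 Ω) x * φ x = 0 := by
  have := integral_smul_mul_test (φ := φ) 0 (0 : L2 Ω)
  simpa using this

/-- The Sobolev space `H²(Ω)`. An element is a function `v ∈ L₂(Ω)` together with its
(uniquely determined) weak gradient `∇v ∈ L₂(Ω)²` and weak Hessian `∇∇v ∈ L₂(Ω)^{2×2}`. -/
noncomputable def H2 (Ω : Set Plane) :
    Submodule ℝ (L2 Ω × (Fin 2 → L2 Ω) × (Fin 2 × Fin 2 → L2 Ω)) where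
  carrier := {v | (∀ i, IsWeakDeriv Ω i v.1 (v.2.1 i)) ∧
    ∀ i j, IsWeakDeriv Ω j (v.2.1 i) (v.2.2 (i, j))}
  add_mem' := by
    rintro a b ⟨ha, ha'⟩ ⟨hb, hb'⟩
    refine ⟨fun i φ hφ => ?_, fun i j φ hφ => ?_⟩
    · simp only [Prod.fst_add, Prod.snd_add, Pi.add_apply]
      rw [integral_add_mul_test (hφ.pd i), integral_add_mul_test hφ, ha i φ hφ, hb i φ hφ]; ring
    · simp only [Prod.fst_add, Prod.snd_add, Pi.add_apply]
      rw [integral_add_mul_test (hφ.pd j), integral_add_mul_test hφ, ha' i j φ hφ, hb' i j φ hφ]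
      ring
  zero_mem' := by
    refine ⟨fun i φ hφ => ?_, fun i j φ hφ => ?_⟩ <;>
    simp only [Prod.fst_zero, Prod.snd_zero, Pi.zero_apply, integral_zero_mul_test, neg_zero]
  smul_mem' := by
    rintro c a ⟨ha, ha'⟩
    refine ⟨fun i φ hφ => ?_, fun i j φ hφ => ?_⟩
    · simp only [Prod.smul_fst, Prod.smul_snd, Pi.smul_apply]
      rw [integral_smul_mul_test, integral_smul_mul_test, ha i φ hφ]; ring
    · simp only [Prod.smul_fst, Prod.smul_snd, Pi.smul_apply]
      rw [integral_smul_mul_test, integral_smul_mul_test, ha' i j φ hφ]; ring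

/-- The Hilbert space `L₂(Ω)^{2×2} × L₂(Ω)`. -/
abbrev TensorPair (Ω : Set Plane) : Type :=
  WithLp 2 (PiLp 2 (fun _ : Fin 2 × Fin 2 => L2 Ω) × L2 Ω)

/-- The space `H(div Div, Ω; 𝐒)` of symmetric `L₂` tensors `Q` with `div Div Q ∈ L₂(Ω)`. An element
is `Q` together with its (uniquely determined) weak `div Div Q`; the norm inherited from
`TensorPair` is `(‖Q‖² + ‖div Div Q‖²)^{1/2}`. -/
noncomputable def HdivDiv (Ω : Set Plane) : Submodule ℝ (TensorPair Ω) where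
  carrier := {q | (∀ i j, q.fst (i, j) = q.fst (j, i)) ∧ IsWeakDivDiv Ω q.fst q.snd}
  add_mem' := by
    rintro a b ⟨ha, ha'⟩ ⟨hb, hb'⟩
    refine ⟨fun i j => ?_, fun φ hφ => ?_⟩
    · simp only [WithLp.add_fst, PiLp.add_apply, ha i j, hb i j]
    · simp only [WithLp.add_fst, WithLp.add_snd, PiLp.add_apply]
      rw [integral_add_mul_test hφ, ← ha' φ hφ, ← hb' φ hφ, ← Finset.sum_add_distrib]
      exact Finset.sum_congr rfl fun ij _ => integral_add_mul_test ((hφ.pd _).pd _) _ _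
  zero_mem' := by
    refine ⟨fun i j => ?_, fun φ hφ => ?_⟩
    · simp
    · simp only [WithLp.zero_fst, WithLp.zero_snd, PiLp.zero_apply, integral_zero_mul_test,
        Finset.sum_const_zero]
  smul_mem' := by
    rintro c a ⟨ha, ha'⟩
    refine ⟨fun i j => ?_, fun φ hφ => ?_⟩
    · simp only [WithLp.smul_fst, PiLp.smul_apply, ha i j]
    · simp only [WithLp.smul_fst, WithLp.smul_snd, PiLp.smul_apply]
      rw [integral_smul_mul_test, ← ha' φ hφ, Finset.mul_sum]
      exact Finset.sum_congr rfl fun ij _ => integral_smul_mul_test _ _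

/-- The trace operator `tr^{Ggrad} : H²(Ω) → H(div Div, Ω; 𝐒)*`,
`⟨tr v, Q⟩ = (div Div Q, v)_Ω - (Q, ∇∇v)_Ω`; see `trGg_apply` for the formula as integrals. -/
noncomputable def trGg (Ω : Set Plane) : H2 Ω →ₗ[ℝ] (HdivDiv Ω →L[ℝ] ℝ) where
  toFun v := (innerSL ℝ (WithLp.toLp 2 (WithLp.toLp 2 (-v.1.2.2), v.1.1) : TensorPair Ω)).comp
    (HdivDiv Ω).subtypeL
  map_add' v w := by
    ext q
    simp [WithLp.prod_inner_apply, PiLp.inner_apply, inner_add_left, inner_neg_left]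
    ring
  map_smul' c v := by
    ext q
    simp [WithLp.prod_inner_apply, PiLp.inner_apply, inner_smul_left, inner_neg_left,
      ← Finset.mul_sum]
    ring

lemma trGg_apply (Ω : Set Plane) (v : H2 Ω) (q : HdivDiv Ω) :
    trGg Ω v q = (∫ x in Ω, q.1.snd x * v.1.1 x)
      - ∑ ij, ∫ x in Ω, q.1.fst ij x * v.1.2.2 ij x := by
  simp [trGg, WithLp.prod_inner_apply, PiLp.inner_apply, inner_neg_left, L2.inner_def]
  ring

/-- The trace space `H^{3/2,1/2}(Γ) = tr^{Ggrad}(H²(Ω))`. -/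
noncomputable def H32 (Ω : Set Plane) : Submodule ℝ (HdivDiv Ω →L[ℝ] ℝ) :=
  LinearMap.range (trGg Ω)

/-- The clockwise rotation by a right angle; it maps the unit tangent `t` of a positively oriented
boundary curve to the exterior unit normal `n`. -/
noncomputable def rotCW (t : Plane) : Plane := !₂[t 1, -t 0]

/-- A mesh of the boundary `Γ = ∂Ω` with edges indexed by `ι`: the edge with index `e` is the open
arc `γ e '' (0,1)`. The closed edges cover `Γ`, an open edge meets no other closed edge, and each
`γ e : [0,1] → Γ` is a smooth, regular, injective, positively oriented path. -/
structure BoundaryMesh (Ω : Set Plane) (ι : Type*) where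
  γ : ι → ℝ → Plane
  smooth : ∀ e, ContDiffOn ℝ ∞ (γ e) (Icc 0 1)
  regular : ∀ e, ∀ s ∈ Icc (0 : ℝ) 1, derivWithin (γ e) (Icc 0 1) s ≠ 0
  inj : ∀ e, InjOn (γ e) (Icc 0 1)
  cover : ⋃ e, γ e '' Icc 0 1 = frontier Ω
  disj : ∀ e e', e ≠ e' → Disjoint (γ e '' Ioo 0 1) (γ e' '' Icc 0 1)
  oriented : ∀ e, ∀ s ∈ Ioo (0 : ℝ) 1, ∀ᶠ ε in 𝓝[>] (0 : ℝ),
    γ e s - ε • rotCW (derivWithin (γ e) (Icc 0 1) s) ∈ Ω ∧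
    γ e s + ε • rotCW (derivWithin (γ e) (Icc 0 1) s) ∉ Ω

namespace BoundaryMesh

variable {Ω : Set Plane} {ι : Type*} (M : BoundaryMesh Ω ι)

/-- The velocity `γ_E'`. -/
noncomputable def vel (e : ι) (s : ℝ) : Plane := derivWithin (M.γ e) (Icc 0 1) s

/-- The unit tangent `t` at the point `γ_E(s)`. -/
noncomputable def tangent (e : ι) (s : ℝ) : Plane := ‖M.vel e s‖⁻¹ • M.vel e s

/-- The exterior unit normal `n` at the point `γ_E(s)`. -/
noncomputable def normal (e : ι) (s : ℝ) : Plane := rotCW (M.tangent e s)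

/-- The matrix `(t | n)` with columns `t` and `n` at the point `γ_E(s)`. -/
noncomputable def frame (e : ι) (s : ℝ) : Matrix (Fin 2) (Fin 2) ℝ :=
  !![M.tangent e s 0, M.normal e s 0; M.tangent e s 1, M.normal e s 1]

/-- The tangential (arc length) derivative `∂_t f` at the point `γ_E(s)`. -/
noncomputable def dt (e : ι) (f : Plane → ℝ) (s : ℝ) : ℝ :=
  derivWithin (fun s => f (M.γ e s)) (Icc 0 1) s / ‖M.vel e s‖

/-- The arc length measure of the edge `E` in the parameter domain: `|γ_E'(s)| ds` on `[0,1]`. -/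
noncomputable def arc (e : ι) : Measure ℝ :=
  (volume.restrict (Icc 0 1)).withDensity fun s => ‖M.vel e s‖ₑ

/-- The arc length measure on `Γ`. -/
noncomputable def surf : Measure Plane := Measure.sum fun e => (M.arc e).map (M.γ e)

/-- `L₂(Γ)`. -/
abbrev L2Γ : Type := Lp ℝ 2 M.surf

/-- The set `𝒩_h` of vertices of the mesh. -/
def nodes : Set Plane := {z | ∃ e, z = M.γ e 0 ∨ z = M.γ e 1}

lemma aemeasurable_γ (e : ι) : AEMeasurable (M.γ e) (M.arc e) :=
  ((M.smooth e).continuousOn.aemeasurable measurableSet_Icc).mono_ac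
    (withDensity_absolutelyContinuous _ _)

lemma ae_edge {P : Plane → Prop} (h : ∀ᵐ x ∂M.surf, P x) (e : ι) :
    ∀ᵐ s ∂M.arc e, P (M.γ e s) :=
  ae_of_ae_map (M.aemeasurable_γ e) ((Measure.le_sum _ e).absolutelyContinuous.ae_le h)

lemma ae_volume_of_ae_arc {P : ℝ → Prop} {e : ι} (h : ∀ᵐ s ∂M.arc e, P s) :
    ∀ᵐ s ∂volume.restrict (Icc (0 : ℝ) 1), P s := by
  have hm : AEMeasurable (fun s => ‖M.vel e s‖ₑ) (volume.restrict (Icc (0 : ℝ) 1)) := by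
    refine AEMeasurable.enorm ?_
    exact ((M.smooth e).continuousOn_derivWithin (uniqueDiffOn_Icc one_pos)
      (by simp)).aemeasurable measurableSet_Icc
  rw [arc, ae_withDensity_iff' hm] at h
  filter_upwards [h, ae_restrict_mem measurableSet_Icc] with s hs hs'
  exact hs (by simpa [vel] using M.regular e s hs')

/-- `v ∈ P_k(ℰ_h)`: on each edge, `v ∘ γ_E` is a polynomial of degree at most `k`. -/
def IsPiecewisePoly (k : ℕ) (v : M.L2Γ) : Prop :=
  ∀ e, ∃ q : ℝ[X], q.natDegree ≤ k ∧ ∀ᵐ s ∂M.arc e, v (M.γ e s) = q.eval s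

/-- `φ ∈ C⁰(Γ)` and `g ∈ C⁰(Γ)²` are the continuous representatives of `v₀` and of the row vector
`(∂_t v₀, v_n)(t | n)`, respectively, where `v = (v₀, v_n)`. -/
structure IsContRep (v : M.L2Γ × M.L2Γ) (φ : Plane → ℝ) (g : Plane → Fin 2 → ℝ) : Prop where
  cont_fst : ContinuousOn φ (frontier Ω)
  ae_fst : v.1 =ᵐ[M.surf] φ
  cont_snd : ContinuousOn g (frontier Ω)
  ae_snd : ∀ e, ∀ᵐ s ∂M.arc e,
    Matrix.vecMul ![M.dt e φ s, v.2 (M.γ e s)] (M.frame e s) = g (M.γ e s)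

lemma γ_mem (e : ι) {s : ℝ} (hs : s ∈ Icc (0 : ℝ) 1) : M.γ e s ∈ frontier Ω := by
  rw [← M.cover]; exact mem_iUnion.2 ⟨e, s, hs, rfl⟩

lemma continuousOn_comp {φ : Plane → ℝ} (h : ContinuousOn φ (frontier Ω)) (e : ι) :
    ContinuousOn (fun s => φ (M.γ e s)) (Icc 0 1) :=
  h.comp (M.smooth e).continuousOn fun _ hs => M.γ_mem e hs

lemma IsContRep.differentiableOn {M : BoundaryMesh Ω ι} {k : ℕ} {v : M.L2Γ × M.L2Γ}
    {φ : Plane → ℝ} {g : Plane → Fin 2 → ℝ} (h : M.IsContRep v φ g)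
    (hv : M.IsPiecewisePoly k v.1) (e : ι) :
    DifferentiableOn ℝ (fun s => φ (M.γ e s)) (Icc 0 1) := by
  obtain ⟨q, -, hq⟩ := hv e
  have h1 : (fun s => φ (M.γ e s)) =ᵐ[volume.restrict (Icc (0 : ℝ) 1)] fun s => q.eval s := by
    filter_upwards [M.ae_volume_of_ae_arc hq, M.ae_volume_of_ae_arc (M.ae_edge h.ae_fst e)]
      with s hs hs'
    rw [← hs', hs]
  have h2 := Measure.eqOn_Icc_of_ae_eq volume zero_ne_one h1 (M.continuousOn_comp h.cont_fst e)
    q.continuous.continuousOn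
  exact q.differentiable.differentiableOn.congr h2

lemma dt_add {φ ψ : Plane → ℝ} {e : ι} {s : ℝ} (hs : s ∈ Icc (0 : ℝ) 1)
    (h1 : DifferentiableOn ℝ (fun s => φ (M.γ e s)) (Icc 0 1))
    (h2 : DifferentiableOn ℝ (fun s => ψ (M.γ e s)) (Icc 0 1)) :
    M.dt e (φ + ψ) s = M.dt e φ s + M.dt e ψ s := by
  simp only [dt, Pi.add_apply]
  rw [← add_div, ← derivWithin_fun_add (h1 s hs) (h2 s hs)]

lemma dt_smul {φ : Plane → ℝ} {e : ι} {s : ℝ} (c : ℝ) (hs : s ∈ Icc (0 : ℝ) 1)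
    (h1 : DifferentiableOn ℝ (fun s => φ (M.γ e s)) (Icc 0 1)) :
    M.dt e (c • φ) s = c * M.dt e φ s := by
  simp only [dt, Pi.smul_apply, smul_eq_mul]
  rw [derivWithin_const_mul _ (h1 s hs), mul_div_assoc]

lemma ae_arc_mem (e : ι) : ∀ᵐ s ∂M.arc e, s ∈ Icc (0 : ℝ) 1 :=
  (withDensity_absolutelyContinuous _ _).ae_le (ae_restrict_mem measurableSet_Icc)

lemma IsPiecewisePoly.add {M : BoundaryMesh Ω ι} {k : ℕ} {v w : M.L2Γ}
    (hv : M.IsPiecewisePoly k v) (hw : M.IsPiecewisePoly k w) : M.IsPiecewisePoly k (v + w) := by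
  intro e
  obtain ⟨q, hq, hq'⟩ := hv e
  obtain ⟨r, hr, hr'⟩ := hw e
  refine ⟨q + r, Polynomial.natDegree_add_le_of_degree_le hq hr, ?_⟩
  filter_upwards [hq', hr', M.ae_edge (Lp.coeFn_add v w) e] with s h1 h2 h3
  rw [h3, Pi.add_apply, h1, h2, Polynomial.eval_add]

lemma IsPiecewisePoly.smul {M : BoundaryMesh Ω ι} {k : ℕ} {v : M.L2Γ} (c : ℝ)
    (hv : M.IsPiecewisePoly k v) : M.IsPiecewisePoly k (c • v) := by
  intro e
  obtain ⟨q, hq, hq'⟩ := hv e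
  refine ⟨c • q, (Polynomial.natDegree_smul_le c q).trans hq, ?_⟩
  filter_upwards [hq', M.ae_edge (Lp.coeFn_smul c v) e] with s h1 h3
  rw [h3, Pi.smul_apply, h1, Polynomial.eval_smul]

/-- The space `Y_h` of pairs `(v₀, v_n) ∈ P_{p+2+δ_{p0}}(ℰ_h) × P_{p+1}(ℰ_h)` with
`v₀ ∈ C⁰(Γ)` and `(∂_t v₀, v_n)(t | n) ∈ C⁰(Γ)²`. -/
noncomputable def Yh (p : ℕ) : Submodule ℝ (M.L2Γ × M.L2Γ) where
  carrier := {v | M.IsPiecewisePoly (p + 2 + if p = 0 then 1 else 0) v.1 ∧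
    M.IsPiecewisePoly (p + 1) v.2 ∧ ∃ φ g, M.IsContRep v φ g}
  add_mem' := by
    rintro v w ⟨hv1, hv2, φ, g, h⟩ ⟨hw1, hw2, ψ, k, h'⟩
    refine ⟨hv1.add hw1, hv2.add hw2, φ + ψ, g + k, h.cont_fst.add h'.cont_fst, ?_,
      h.cont_snd.add h'.cont_snd, fun e => ?_⟩
    · filter_upwards [Lp.coeFn_add v.1 w.1, h.ae_fst, h'.ae_fst] with x h1 h2 h3
      rw [Prod.fst_add, h1, Pi.add_apply, Pi.add_apply, h2, h3]
    · filter_upwards [M.ae_edge (Lp.coeFn_add v.2 w.2) e, h.ae_snd e, h'.ae_snd e,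
        M.ae_arc_mem e] with s h1 h2 h3 hs
      rw [Prod.snd_add, h1, Pi.add_apply, Pi.add_apply, ← h2, ← h3, ← Matrix.add_vecMul,
        M.dt_add hs (h.differentiableOn hv1 e) (h'.differentiableOn hw1 e)]
      simp
  zero_mem' := by
    refine ⟨fun e => ⟨0, by simp, ?_⟩, fun e => ⟨0, by simp, ?_⟩, 0, 0, continuousOn_const, ?_,
      continuousOn_const, fun e => ?_⟩
    · filter_upwards [M.ae_edge (Lp.coeFn_zero ℝ 2 M.surf) e] with s hs
      simpa using hs
    · filter_upwards [M.ae_edge (Lp.coeFn_zero ℝ 2 M.surf) e] with s hs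
      simpa using hs
    · exact Lp.coeFn_zero ℝ 2 M.surf
    · filter_upwards [M.ae_edge (Lp.coeFn_zero ℝ 2 M.surf) e] with s hs
      have : M.dt e 0 s = 0 := by simp [dt]
      rw [Prod.snd_zero, hs, this]
      ext i
      fin_cases i <;> simp [Matrix.vecMul, dotProduct]
  smul_mem' := by
    rintro c v ⟨hv1, hv2, φ, g, h⟩
    refine ⟨hv1.smul c, hv2.smul c, c • φ, c • g, h.cont_fst.const_smul c, ?_,
      h.cont_snd.const_smul c, fun e => ?_⟩
    · filter_upwards [Lp.coeFn_smul c v.1, h.ae_fst] with x h1 h2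
      rw [Prod.smul_fst, h1, Pi.smul_apply, Pi.smul_apply, h2]
    · filter_upwards [M.ae_edge (Lp.coeFn_smul c v.2) e, h.ae_snd e, M.ae_arc_mem e]
        with s h1 h2 hs
      rw [Prod.smul_snd, h1, Pi.smul_apply, Pi.smul_apply, ← h2, ← Matrix.smul_vecMul,
        M.dt_smul c hs (h.differentiableOn hv1 e)]
      simp

/-- `(v₀, v_n) = (v|_Γ, ∂_n v|_Γ)` in the sense of Sobolev traces: there are functions
`φ_k ∈ C^∞(ℝ²)` with `φ_k → v` in `H²(Ω)`, `φ_k|_Γ → v₀` in `L₂(Γ)` and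
`n·∇φ_k|_Γ → v_n` in `L₂(Γ)` (edge by edge). -/
def HasTrace (v : H2 Ω) (w : M.L2Γ × M.L2Γ) : Prop :=
  ∃ φ : ℕ → Plane → ℝ, (∀ k, ContDiff ℝ ∞ (φ k)) ∧
    Tendsto (fun k => eLpNorm (fun x => φ k x - v.1.1 x) 2 (volume.restrict Ω)) atTop (𝓝 0) ∧
    (∀ i, Tendsto (fun k => eLpNorm (fun x => pd i (φ k) x - v.1.2.1 i x) 2
      (volume.restrict Ω)) atTop (𝓝 0)) ∧
    (∀ i j, Tendsto (fun k => eLpNorm (fun x => pd j (pd i (φ k)) x - v.1.2.2 (i, j) x) 2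
      (volume.restrict Ω)) atTop (𝓝 0)) ∧
    (∀ e, Tendsto (fun k => eLpNorm (fun s => φ k (M.γ e s) - w.1 (M.γ e s)) 2
      (M.arc e)) atTop (𝓝 0)) ∧
    (∀ e, Tendsto (fun k => eLpNorm (fun s =>
      fderiv ℝ (φ k) (M.γ e s) (M.normal e s) - w.2 (M.γ e s)) 2 (M.arc e)) atTop (𝓝 0))

/-- Values of the degrees of freedom for the degree `p`: at each node one number and one vector;
on each edge a linear functional on `P_{p-1}(E)` and one on `P_{p-2}(E)`, where
`P_m(E) = {μ ∘ γ_E⁻¹ ; deg μ ≤ m}` is identified with the polynomials of degree at most `m`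
(the zero space for negative `m`; `Polynomial.degreeLT ℝ n` is the space of degrees `< n`). -/
abbrev DofSpace (p : ℕ) : Type _ :=
  (M.nodes → ℝ) × (M.nodes → Fin 2 → ℝ) ×
    (ι → Module.Dual ℝ (Polynomial.degreeLT ℝ p)) ×
    (ι → Module.Dual ℝ (Polynomial.degreeLT ℝ (p - 1)))

end BoundaryMesh

/-!
The theorem has an analytic half, the embedding of `Y_h` into the trace space, and a combinatorial
half, the unisolvence and the dimension count.

**Embedding.** An element of `Y_h` is a jet `(φ, g)` on `Γ`: a continuous function together with a
continuous gradient field, both smooth along each closed edge, where the tangential part of `g` is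
the derivative of `φ`. On one edge such a jet satisfies Whitney's `C^{1,1}` conditions, since a
regular injective path is bi-Lipschitz. Two edges that meet in a node lie on opposite sides of it in
a Lipschitz chart, so there are no cusps and the conditions hold on all of `Γ`
(`BoundaryMesh.exists_whitneyPair_frontier`). By Whitney's extension theorem, proved here with an
explicit formula for the extension as a convex envelope (`exists_extension_of_whitneyPair`), the jet
is the restriction of a compactly supported `C^{1,1}` function `F`. Its mollifications converge to
it in `H²(Ω)` and, uniformly together with the gradients, on `Γ`; hence `F` has the Sobolev traces
`(v₀, v_n)` (`BoundaryMesh.hasTrace_of_isRep`).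

Since the extension is not unique, a linear choice of extensions is made by a linear right inverse,
and injectivity of the resulting map is the following fact about a `C^{1,1}` function `F`
(`IsRep.vanish_on_frontier`): if its trace functional vanishes, then `F` and its gradient vanish on
`Γ`. Testing with the tensors `q ν ⊗ ν`, where `ν` is the vertical direction of a chart and `q` a bump
function, and integrating by parts along vertical lines only, turns the vanishing trace into
`∫ (∂_ν q F - q ∂_ν F) = 0` over the graph; localization gives `F = 0` and `∂_ν F = 0` there, and the
remaining derivative vanishes because `F` vanishes along the graph.

**Degrees of freedom.** On a single edge, the values and the derivatives at the end points together
with the moments of degree `< n` determine a polynomial of degree `< n + 4`: if all of them vanish,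
then the polynomial is a multiple of the bubble `s² (1 - s)²`, and the quotient can be used as a test
function. Likewise for the normal component, with the values at the end points and the bubble
`s (1 - s)`. A nodal gradient is split into its tangential and normal components on each adjacent
edge, so that the degrees of freedom on `Y_h` decouple into those on the edges
(`BoundaryMesh.exists_dof_equiv`).

**Dimension.** In a chart around a node, the intermediate value theorem shows that exactly one half
of an edge leaves the node to either side. Hence there are as many nodes as edges
(`BoundaryMesh.card_nodes`), and the dimension of the space of data is
`3 #ℰ_h + p #ℰ_h + (p - 1)₊ #ℰ_h`.
-/


/-! ### Whitney extension of `C^{1,1}` jets -/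

section Whitney

variable {E : Type*} [NormedAddCommGroup E] [InnerProductSpace ℝ E]

/-- The jet `x ↦ (f x, G x)` satisfies Whitney's `C^{1,1}` conditions with constant `C` for the
pair of points `x`, `y`. -/
def WhitneyPair (f : E → ℝ) (G : E → E) (C : ℝ) (x y : E) : Prop :=
  ‖G y - G x‖ ≤ C * ‖y - x‖ ∧ |f y - f x - inner ℝ (G x) (y - x)| ≤ C * ‖y - x‖ ^ 2

/-- A supporting affine function is obtained by separating the point `(x, f x)` from the open strict
epigraph. -/
lemma ConvexOn.exists_subgradient [FiniteDimensional ℝ E] {f : E → ℝ}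
    (hf : ConvexOn ℝ univ f) (x : E) : ∃ p : E, ∀ y, f x + inner ℝ p (y - x) ≤ f y := by
  have hcont : Continuous f := hf.locallyLipschitz.continuous
  set S : Set (E × ℝ) := {q | q.1 ∈ univ ∧ f q.1 < q.2} with hS
  have hopen : IsOpen S := by
    simpa [hS] using isOpen_lt (hcont.comp continuous_fst) continuous_snd
  have hx : ((x, f x) : E × ℝ) ∉ S := by simp [hS]
  obtain ⟨L, hL⟩ := geometric_hahn_banach_open_point hf.convex_strict_epigraph hopen hx
  set c : ℝ := L (0, 1) with hc
  have hdec : ∀ y t, L (y, t) = L (y, 0) + t * c := by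
    intro y t
    have : ((y, t) : E × ℝ) = (y, 0) + t • ((0 : E), (1 : ℝ)) := by simp
    rw [this, map_add, map_smul, smul_eq_mul]
  have hlt : ∀ y t, f y < t → L (y, 0) + t * c < L (x, 0) + f x * c := by
    intro y t h
    rw [← hdec, ← hdec]
    exact hL (y, t) ⟨mem_univ _, h⟩
  have hc0 : c < 0 := by
    have := hlt x (f x + 1) (by linarith)
    linarith
  have hle : ∀ y, L (y, 0) + f y * c ≤ L (x, 0) + f x * c := by
    intro y
    have h1 : Tendsto (fun t : ℝ => L (y, 0) + t * c) (𝓝[>] (f y)) (𝓝 (L (y, 0) + f y * c)) :=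
      tendsto_nhdsWithin_of_tendsto_nhds (by fun_prop : Continuous _).continuousAt
    exact le_of_tendsto h1 (eventually_mem_nhdsWithin.mono fun t ht => (hlt y t ht).le)
  let ℓ : E →L[ℝ] ℝ := (-c)⁻¹ • L.comp (ContinuousLinearMap.inl ℝ E ℝ)
  refine ⟨(InnerProductSpace.toDual ℝ E).symm ℓ, fun y => ?_⟩
  rw [InnerProductSpace.toDual_symm_apply]
  have h2 : ℓ (y - x) = (-c)⁻¹ * (L (y, 0) - L (x, 0)) := by
    simp only [map_sub]
    simp [ℓ]
    ring
  have h3 := hle y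
  rw [h2]
  have hc' : 0 < -c := by linarith
  rw [← le_sub_iff_add_le', inv_mul_le_iff₀ hc']
  linarith

/-- A function squeezed between convexity and `2 M`-semiconcavity is `C^{1,1}`: its subgradient and
its supergradient at a point coincide, and the quadratic error of the first order expansion is
controlled. -/
lemma exists_gradient_of_convex_of_semiconcave [FiniteDimensional ℝ E] {f : E → ℝ} {M : ℝ}
    (h1 : ConvexOn ℝ univ f) (h2 : ConvexOn ℝ univ fun x => M * ‖x‖ ^ 2 - f x) :
    ∃ P : E → E, ∀ x y, 0 ≤ f y - f x - inner ℝ (P x) (y - x) ∧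
      f y - f x - inner ℝ (P x) (y - x) ≤ M * ‖y - x‖ ^ 2 := by
  choose P hP using h1.exists_subgradient
  choose Q hQ using h2.exists_subgradient
  have hup : ∀ x y, f y ≤ f x + inner ℝ ((2 * M) • x - Q x) (y - x) + M * ‖y - x‖ ^ 2 := by
    intro x y
    have := hQ x y
    have e : ‖y‖ ^ 2 = ‖x‖ ^ 2 + 2 * inner ℝ x (y - x) + ‖y - x‖ ^ 2 := by
      rw [← norm_add_sq_real]; simp
    rw [inner_sub_left, inner_smul_left]
    simp only [conj_trivial]
    rw [e] at this
    linarith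
  have heq : ∀ x, P x = (2 * M) • x - Q x := by
    intro x
    rw [← sub_eq_zero]
    set d := P x - ((2 * M) • x - Q x) with hd
    -- testing with `x + t d` for small `t` shows that the two gradients agree
    have key : ∀ t : ℝ, t * ‖d‖ ^ 2 ≤ M * t ^ 2 * ‖d‖ ^ 2 := by
      intro t
      have a := hP x (x + t • d)
      have b := hup x (x + t • d)
      have e : inner ℝ (P x) (t • d) - inner ℝ ((2 * M) • x - Q x) (t • d) = t * ‖d‖ ^ 2 := by
        rw [← inner_sub_left, ← hd, inner_smul_right, real_inner_self_eq_norm_sq]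
      simp only [add_sub_cancel_left, norm_smul, mul_pow, Real.norm_eq_abs, sq_abs] at a b
      linarith
    have k := key (1 / (2 * (|M| + 1)))
    set t := 1 / (2 * (|M| + 1)) with ht
    have hMp : 0 ≤ |M| := abs_nonneg M
    have ht0 : 0 < t := by positivity
    have htM : M * t ≤ 1 / 2 := by
      have : t * (2 * (|M| + 1)) = 1 := by rw [ht]; field_simp
      nlinarith [le_abs_self M]
    have : ‖d‖ ^ 2 ≤ 0 := by
      by_contra hcon
      push Not at hcon
      nlinarith [mul_pos ht0 hcon]
    have := pow_eq_zero_iff (two_ne_zero) |>.1 (le_antisymm this (by positivity))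
    exact norm_eq_zero.1 this
  refine ⟨P, fun x y => ⟨by linarith [hP x y], ?_⟩⟩
  have := hup x y
  rw [← heq] at this
  linarith

/-- The largest convex minorant of a lower envelope of paraboloids with second derivative `2 M`
is again `2 M`-semiconcave. -/
lemma exists_convex_between {m g : E → ℝ} {M : ℝ} (hm : ConvexOn ℝ univ m) (hmg : ∀ x, m x ≤ g x)
    (hg : ConcaveOn ℝ univ fun x => g x - M * ‖x‖ ^ 2) :
    ∃ f : E → ℝ, ConvexOn ℝ univ f ∧ (ConvexOn ℝ univ fun x => M * ‖x‖ ^ 2 - f x) ∧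
      (∀ x, m x ≤ f x) ∧ ∀ x, f x ≤ g x := by
  let A : Set (E → ℝ) := {c | ConvexOn ℝ univ c ∧ ∀ x, c x ≤ g x}
  have hmA : m ∈ A := ⟨hm, hmg⟩
  have : Nonempty A := ⟨⟨m, hmA⟩⟩
  let f : E → ℝ := fun x => ⨆ c : A, c.1 x
  have hbdd : ∀ x, BddAbove (range fun c : A => c.1 x) := by
    intro x
    refine ⟨g x, ?_⟩
    rintro _ ⟨c, rfl⟩
    exact c.2.2 x
  have hle : ∀ c ∈ A, ∀ x, c x ≤ f x := fun c hc x => le_ciSup (hbdd x) ⟨c, hc⟩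
  have hfg : ∀ x, f x ≤ g x := fun x => ciSup_le fun c => c.2.2 x
  have hf : ConvexOn ℝ univ f := by
    refine ⟨convex_univ, fun x _ y _ a b ha hb hab => ciSup_le fun c => ?_⟩
    refine (c.2.1.2 (mem_univ x) (mem_univ y) ha hb hab).trans ?_
    exact add_le_add (mul_le_mul_of_nonneg_left (hle c.1 c.2 x) ha)
      (mul_le_mul_of_nonneg_left (hle c.1 c.2 y) hb)
  refine ⟨f, hf, ⟨convex_univ, fun x _ y _ a b ha hb hab => ?_⟩, hle m hmA, hfg⟩
  set u := x - y with hu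
  -- `c` is a convex minorant of `g`, hence lies below `f`; at `a x + b y` this is the claim
  let c : E → ℝ := fun z => (a • f (z + b • u) + b • f (z + (-a) • u)) + -(M * (a * b) * ‖u‖ ^ 2)
  have hb' : b = 1 - a := by linarith
  have hc : c ∈ A := by
    refine ⟨?_, fun z => ?_⟩
    · refine ConvexOn.add_const ?_ _
      have t1 : ConvexOn ℝ univ fun z => f (z + b • u) := by
        simpa [Function.comp_def] using hf.translate_left (b • u)
      have t2 : ConvexOn ℝ univ fun z => f (z + (-a) • u) := by
        simpa [Function.comp_def] using hf.translate_left ((-a) • u)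
      exact (t1.smul ha).add (t2.smul hb)
    · have k := hg.2 (mem_univ (z + b • u)) (mem_univ (z + (-a) • u)) ha hb hab
      have e : a • (z + b • u) + b • (z + (-a) • u) = z := by
        rw [hb']; module
      rw [e] at k
      simp only [smul_eq_mul] at k
      have n1 := norm_add_sq_real z (b • u)
      have n2 := norm_add_sq_real z ((-a) • u)
      rw [inner_smul_right, norm_smul, mul_pow, Real.norm_eq_abs, sq_abs] at n1 n2
      have g1 := mul_le_mul_of_nonneg_left (hfg (z + b • u)) ha
      have g2 := mul_le_mul_of_nonneg_left (hfg (z + (-a) • u)) hb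
      rw [n1, n2] at k
      simp only [c, smul_eq_mul]
      have : a * (M * (‖z‖ ^ 2 + 2 * (b * inner ℝ z u) + b ^ 2 * ‖u‖ ^ 2)) +
          b * (M * (‖z‖ ^ 2 + 2 * (-a * inner ℝ z u) + (-a) ^ 2 * ‖u‖ ^ 2)) =
          M * ‖z‖ ^ 2 + M * (a * b) * ‖u‖ ^ 2 := by
        rw [hb']; ring
      linarith
  have k := hle c hc (a • x + b • y)
  have e1 : a • x + b • y + b • u = x := by rw [hu, hb']; module
  have e2 : a • x + b • y + (-a) • u = y := by rw [hu, hb']; module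
  simp only [c, e1, e2, smul_eq_mul] at k
  have n0 := norm_add_sq_real (a • x) (b • y)
  have nu := norm_sub_sq_real x y
  rw [inner_smul_right, inner_smul_left, norm_smul, norm_smul, mul_pow, mul_pow, Real.norm_eq_abs,
    Real.norm_eq_abs, sq_abs, sq_abs] at n0
  simp only [conj_trivial] at n0
  simp only [smul_eq_mul]
  rw [n0]
  rw [← hu] at nu
  rw [nu] at k
  have : M * (a ^ 2 * ‖x‖ ^ 2 + 2 * (b * (a * inner ℝ x y)) + b ^ 2 * ‖y‖ ^ 2) +
      M * (a * b) * (‖x‖ ^ 2 - 2 * inner ℝ x y + ‖y‖ ^ 2) =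
      a * (M * ‖x‖ ^ 2) + b * (M * ‖y‖ ^ 2) := by
    rw [hb']; ring
  linarith

/-- **Whitney extension theorem**, `C^{1,1}` case: a jet satisfying Whitney's conditions on `S` is
the restriction of a function on the whole space with a quadratic error in its first order
expansions. The extension is `conv(g) - M/2 |x|²`, where `g` is the infimum over `y ∈ S` of the
functions `x ↦ f y + ⟪G y, x - y⟫ + M/2 (|x - y|² + |x|²)`. -/
theorem exists_extension_of_whitneyPair [FiniteDimensional ℝ E] {S : Set E} (hS : S.Nonempty)
    {f : E → ℝ} {G : E → E} {C : ℝ} (h : ∀ x ∈ S, ∀ y ∈ S, WhitneyPair f G C x y) :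
    ∃ (F : E → ℝ) (P : E → E) (M : ℝ),
      (∀ x y, |F y - F x - inner ℝ (P x) (y - x)| ≤ M * ‖y - x‖ ^ 2) ∧
      (∀ x ∈ S, F x = f x ∧ P x = G x) := by
  have : Nonempty S := hS.to_subtype
  set M : ℝ := 8 * |C| with hM
  have hM0 : 0 ≤ M := by positivity
  -- the lower paraboloid at `z` stays below the upper paraboloid at `y`; this fixes the size of `M`
  have hlow : ∀ y ∈ S, ∀ z ∈ S, ∀ x, f z + inner ℝ (G z) (x - z) - M / 2 * ‖x - z‖ ^ 2 ≤
      f y + inner ℝ (G y) (x - y) + M / 2 * ‖x - y‖ ^ 2 := by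
    intro y hy z hz x
    obtain ⟨h1, h2⟩ := h z hz y hy
    have e : inner ℝ (G z) (x - z) = inner ℝ (G z) (x - y) + inner ℝ (G z) (y - z) := by
      rw [← inner_add_right]; congr 1; abel
    have e2 : inner ℝ (G y - G z) (x - y) = inner ℝ (G y) (x - y) - inner ℝ (G z) (x - y) :=
      inner_sub_left _ _ _
    have e3 : |inner ℝ (G y - G z) (x - y)| ≤ ‖G y - G z‖ * ‖x - y‖ := abs_real_inner_le_norm _ _
    have tri : ‖y - z‖ ≤ ‖x - z‖ + ‖x - y‖ := by
      have := norm_sub_le (x - z) (x - y)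
      rwa [show x - z - (x - y) = y - z by abel] at this
    have hC := le_abs_self C
    have hC0 := abs_nonneg C
    have b1 : C * ‖y - z‖ ^ 2 ≤ |C| * (2 * ‖x - z‖ ^ 2 + 2 * ‖x - y‖ ^ 2) := by
      have : ‖y - z‖ ^ 2 ≤ 2 * ‖x - z‖ ^ 2 + 2 * ‖x - y‖ ^ 2 := by
        nlinarith [sq_nonneg (‖x - z‖ - ‖x - y‖), norm_nonneg (y - z)]
      calc C * ‖y - z‖ ^ 2 ≤ |C| * ‖y - z‖ ^ 2 := by gcongr
        _ ≤ _ := by gcongr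
    have b2 : ‖G y - G z‖ * ‖x - y‖ ≤ |C| * (2 * ‖x - z‖ ^ 2 + 2 * ‖x - y‖ ^ 2) := by
      calc ‖G y - G z‖ * ‖x - y‖ ≤ (C * ‖y - z‖) * ‖x - y‖ := by gcongr
        _ ≤ (|C| * (‖x - z‖ + ‖x - y‖)) * ‖x - y‖ := by gcongr
        _ = |C| * ((‖x - z‖ + ‖x - y‖) * ‖x - y‖) := by ring
        _ ≤ _ := by
          gcongr
          nlinarith [sq_nonneg (‖x - z‖ - ‖x - y‖), sq_nonneg ‖x - z‖]
    have a1 := abs_le.1 h2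
    have a2 := abs_le.1 e3
    rw [hM]
    nlinarith
  -- the upper envelope of the lower paraboloids and the lower envelope of the upper paraboloids;
  -- both of them agree with `f` on `S`
  let m : E → ℝ := fun x => ⨆ z : S, (f z + inner ℝ (G z) (x - z) - M / 2 * ‖x - z‖ ^ 2)
  let g : E → ℝ := fun x => ⨅ y : S, (f y + inner ℝ (G y) (x - y) + M / 2 * ‖x - y‖ ^ 2)
  obtain ⟨y0, hy0⟩ := hS
  have hbm : ∀ x, BddAbove (range fun z : S =>
      f z + inner ℝ (G z) (x - z) - M / 2 * ‖x - z‖ ^ 2) := by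
    intro x
    refine ⟨f y0 + inner ℝ (G y0) (x - y0) + M / 2 * ‖x - y0‖ ^ 2, ?_⟩
    rintro _ ⟨z, rfl⟩
    exact hlow y0 hy0 z z.2 x
  have hbg : ∀ x, BddBelow (range fun y : S =>
      f y + inner ℝ (G y) (x - y) + M / 2 * ‖x - y‖ ^ 2) := by
    intro x
    refine ⟨f y0 + inner ℝ (G y0) (x - y0) - M / 2 * ‖x - y0‖ ^ 2, ?_⟩
    rintro _ ⟨z, rfl⟩
    exact hlow z z.2 y0 hy0 x
  have hlm : ∀ z ∈ S, ∀ x, f z + inner ℝ (G z) (x - z) - M / 2 * ‖x - z‖ ^ 2 ≤ m x :=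
    fun z hz x => le_ciSup (hbm x) ⟨z, hz⟩
  have hgl : ∀ y ∈ S, ∀ x, g x ≤ f y + inner ℝ (G y) (x - y) + M / 2 * ‖x - y‖ ^ 2 :=
    fun y hy x => ciInf_le (hbg x) ⟨y, hy⟩
  have hmg : ∀ x, m x ≤ g x := fun x =>
    ciSup_le fun z => le_ciInf fun y => hlow y y.2 z z.2 x
  have expand : ∀ x z : E, ‖x - z‖ ^ 2 = ‖x‖ ^ 2 - 2 * inner ℝ z x + ‖z‖ ^ 2 := by
    intro x z
    rw [norm_sub_sq_real, real_inner_comm]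
  have hcomb : ∀ (x y z : E) (a b : ℝ),
      inner ℝ z (a • x + b • y) = a * inner ℝ z x + b * inner ℝ z y := by
    intro x y z a b
    rw [inner_add_right, inner_smul_right, inner_smul_right]
  have hmconv : ConvexOn ℝ univ fun x => m x + M / 2 * ‖x‖ ^ 2 := by
    refine ⟨convex_univ, fun x _ y _ a b ha hb hab => ?_⟩
    have : m (a • x + b • y) ≤
        a * (m x + M / 2 * ‖x‖ ^ 2) + b * (m y + M / 2 * ‖y‖ ^ 2)
          - M / 2 * ‖a • x + b • y‖ ^ 2 := by
      refine ciSup_le fun z => ?_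
      have k1 := mul_le_mul_of_nonneg_left (hlm z z.2 x) ha
      have k2 := mul_le_mul_of_nonneg_left (hlm z z.2 y) hb
      rw [expand, inner_sub_right] at k1 k2 ⊢
      rw [hcomb, hcomb]
      have hb' : b = 1 - a := by linarith
      subst hb'
      nlinarith
    simp only [smul_eq_mul]
    linarith
  have hgconc : ConcaveOn ℝ univ fun x => (g x + M / 2 * ‖x‖ ^ 2) - M * ‖x‖ ^ 2 := by
    refine ⟨convex_univ, fun x _ y _ a b ha hb hab => ?_⟩
    have : a * (g x - M / 2 * ‖x‖ ^ 2) + b * (g y - M / 2 * ‖y‖ ^ 2)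
          + M / 2 * ‖a • x + b • y‖ ^ 2 ≤ g (a • x + b • y) := by
      refine le_ciInf fun z => ?_
      have k1 := mul_le_mul_of_nonneg_left (hgl z z.2 x) ha
      have k2 := mul_le_mul_of_nonneg_left (hgl z z.2 y) hb
      rw [expand, inner_sub_right] at k1 k2 ⊢
      rw [hcomb, hcomb]
      have hb' : b = 1 - a := by linarith
      subst hb'
      nlinarith
    simp only [smul_eq_mul]
    linarith
  obtain ⟨f₁, hc1, hc2, hmf, hfg⟩ := exists_convex_between hmconv
    (fun x => add_le_add_left (hmg x) _) hgconc
  obtain ⟨P₁, hP₁⟩ := exists_gradient_of_convex_of_semiconcave hc1 hc2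
  have hF : ∀ x y, |(f₁ y - M / 2 * ‖y‖ ^ 2) - (f₁ x - M / 2 * ‖x‖ ^ 2)
      - inner ℝ (P₁ x - M • x) (y - x)| ≤ M / 2 * ‖y - x‖ ^ 2 := by
    intro x y
    obtain ⟨k1, k2⟩ := hP₁ x y
    have e : ‖y‖ ^ 2 = ‖x‖ ^ 2 + 2 * inner ℝ x (y - x) + ‖y - x‖ ^ 2 := by
      rw [← norm_add_sq_real]; simp
    rw [inner_sub_left, inner_smul_left, e, abs_le]
    simp only [conj_trivial]
    constructor <;> nlinarith
  have hval : ∀ x ∈ S, f₁ x - M / 2 * ‖x‖ ^ 2 = f x := by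
    intro x hx
    have a1 := hlm x hx x
    have a2 := hgl x hx x
    have a3 := hmf x
    have a4 := hfg x
    simp only [sub_self, inner_zero_right, norm_zero] at a1 a2
    refine le_antisymm ?_ ?_ <;> nlinarith
  refine ⟨fun x => f₁ x - M / 2 * ‖x‖ ^ 2, fun x => P₁ x - M • x, M / 2, hF, fun x hx =>
    ⟨hval x hx, ?_⟩⟩
  -- both gradients approximate `F` to second order at `x`
  rw [← sub_eq_zero]
  set d := P₁ x - M • x - G x with hd
  have key : ∀ t : ℝ, t * ‖d‖ ^ 2 ≤ M * t ^ 2 * ‖d‖ ^ 2 := by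
    intro t
    have a := abs_le.1 (hF x (x + t • d))
    have b := hfg (x + t • d)
    have c := hgl x hx (x + t • d)
    rw [hval x hx] at a
    have e : inner ℝ (P₁ x - M • x) (t • d) - inner ℝ (G x) (t • d) = t * ‖d‖ ^ 2 := by
      rw [← inner_sub_left, ← hd, inner_smul_right, real_inner_self_eq_norm_sq]
    simp only [add_sub_cancel_left, norm_smul, mul_pow, Real.norm_eq_abs, sq_abs] at a c
    nlinarith
  have k := key (1 / (2 * (M + 1)))
  set t := 1 / (2 * (M + 1)) with ht
  have ht0 : 0 < t := by positivity
  have htM : M * t ≤ 1 / 2 := by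
    have : t * (2 * (M + 1)) = 1 := by rw [ht]; field_simp
    nlinarith
  have : ‖d‖ ^ 2 ≤ 0 := by
    by_contra hcon
    push Not at hcon
    nlinarith [mul_pos ht0 hcon]
  have := pow_eq_zero_iff (two_ne_zero) |>.1 (le_antisymm this (by positivity))
  exact norm_eq_zero.1 this

/-- A uniform quadratic error in the first order expansions forces the gradient to be Lipschitz. -/
lemma norm_sub_le_of_quadratic_expansion {F : E → ℝ} {P : E → E} {M : ℝ}
    (h : ∀ x y, |F y - F x - inner ℝ (P x) (y - x)| ≤ M * ‖y - x‖ ^ 2) (x y : E) :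
    ‖P y - P x‖ ≤ 6 * M * ‖y - x‖ := by
  rcases eq_or_ne y x with rfl | hxy
  · simp
  rcases eq_or_ne (P y) (P x) with hP | hP
  · rw [hP, sub_self, norm_zero]
    have : 0 ≤ M * ‖y - x‖ ^ 2 := (abs_nonneg _).trans (h x y)
    have hpos : 0 < ‖y - x‖ := norm_pos_iff.2 (sub_ne_zero.2 hxy)
    have : 0 ≤ M := by
      by_contra hM
      push Not at hM
      nlinarith [pow_pos hpos 2]
    positivity
  have hpos : 0 < ‖y - x‖ := norm_pos_iff.2 (sub_ne_zero.2 hxy)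
  have hdpos : 0 < ‖P y - P x‖ := norm_pos_iff.2 (sub_ne_zero.2 hP)
  set d := P y - P x with hd
  -- compare the expansions at `x` and at `y` in the point `y + w`, where `w` is the multiple of
  -- `P y - P x` with length `‖y - x‖`
  set w := (‖y - x‖ / ‖d‖) • d with hw
  have hwn : ‖w‖ = ‖y - x‖ := by
    rw [hw, norm_smul, Real.norm_eq_abs, abs_of_pos (div_pos hpos hdpos)]
    field_simp
  have a := abs_le.1 (h x (y + w))
  have b := abs_le.1 (h y (y + w))
  have c := abs_le.1 (h x y)
  have e1 : y + w - x = (y - x) + w := by abel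
  have e2 : inner ℝ (P y) w - inner ℝ (P x) w = ‖y - x‖ * ‖d‖ := by
    rw [← inner_sub_left, ← hd, hw, inner_smul_right, real_inner_self_eq_norm_sq]
    field_simp
  have n1 : ‖(y - x) + w‖ ^ 2 ≤ (2 * ‖y - x‖) ^ 2 := by
    gcongr
    have := norm_add_le (y - x) w
    linarith
  have hM : 0 ≤ M := by
    by_contra hM
    push Not at hM
    nlinarith [pow_pos hpos 2, (abs_nonneg _).trans (h x y)]
  rw [e1, inner_add_right] at a
  rw [add_sub_cancel_left, hwn] at b
  have : ‖y - x‖ * ‖d‖ ≤ ‖y - x‖ * (6 * M * ‖y - x‖) := by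
    nlinarith [mul_le_mul_of_nonneg_left n1 hM]
  exact le_of_mul_le_mul_left this hpos

end Whitney

/-! ### Functions of class `C^{1,1}` and their mollification -/

/-- The coordinate vectors of the plane. -/
noncomputable abbrev coordVec (i : Fin 2) : Plane := EuclideanSpace.single i 1

/-- `F` is a compactly supported function of class `C^{1,1}`. -/
structure IsC11 (F : Plane → ℝ) : Prop where
  contDiff : ContDiff ℝ 1 F
  compact : HasCompactSupport F
  lip : ∃ C : NNReal, ∀ i, LipschitzWith C (pd i F)

lemma pd_eq_lineDeriv {F : Plane → ℝ} {x : Plane} (h : DifferentiableAt ℝ F x) (i : Fin 2) :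
    pd i F x = lineDeriv ℝ F x (coordVec i) :=
  h.lineDeriv_eq_fderiv.symm

lemma fderiv_apply_eq_sum_pd (F : Plane → ℝ) (x v : Plane) :
    fderiv ℝ F x v = ∑ i, v i * pd i F x := by
  conv_lhs => rw [← (EuclideanSpace.basisFun (Fin 2) ℝ).sum_repr v]
  simp [pd]

namespace IsC11

variable {F G : Plane → ℝ}

lemma differentiable (hF : IsC11 F) : Differentiable ℝ F := hF.contDiff.differentiable one_ne_zero

lemma hasCompactSupport_pd (hF : IsC11 F) (i : Fin 2) : HasCompactSupport (pd i F) :=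
  hF.compact.fderiv_apply ℝ _

lemma exists_lipschitz (hF : IsC11 F) : ∃ C, LipschitzWith C F :=
  hF.contDiff.lipschitzWith_of_hasCompactSupport hF.compact one_ne_zero

lemma pd_add (hF : IsC11 F) (hG : IsC11 G) (i : Fin 2) :
    pd i (F + G) = pd i F + pd i G := by
  funext x
  simp [pd, fderiv_add (hF.differentiable x) (hG.differentiable x)]

lemma pd_smul (hF : IsC11 F) (c : ℝ) (i : Fin 2) : pd i (c • F) = c • pd i F := by
  funext x
  simp [pd, fderiv_const_smul (hF.differentiable x)]

lemma add (hF : IsC11 F) (hG : IsC11 G) : IsC11 (F + G) := by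
  obtain ⟨C, hC⟩ := hF.lip
  obtain ⟨D, hD⟩ := hG.lip
  refine ⟨hF.contDiff.add hG.contDiff, hF.compact.add hG.compact, C + D, fun i => ?_⟩
  rw [hF.pd_add hG]
  exact (hC i).add (hD i)

lemma smul (hF : IsC11 F) (c : ℝ) : IsC11 (c • F) := by
  obtain ⟨C, hC⟩ := hF.lip
  refine ⟨contDiff_const.smul hF.contDiff, hF.compact.smul_left (f := fun _ => c),
    ‖c‖₊ * C, fun i => ?_⟩
  rw [hF.pd_smul]
  exact (lipschitzWith_smul c).comp (hC i)

lemma zero : IsC11 (0 : Plane → ℝ) := by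
  refine ⟨contDiff_const, HasCompactSupport.zero, 0, fun i => ?_⟩
  have : pd i (0 : Plane → ℝ) = fun _ => 0 := by
    funext x
    simp [pd]
  rw [this]
  exact LipschitzWith.const 0

end IsC11

/-- A compactly supported function with a uniform quadratic error in its first order expansions is
of class `C^{1,1}`. -/
lemma isC11_of_quadratic_expansion {F : Plane → ℝ} {P : Plane → Plane} {M : ℝ}
    (h : ∀ x y, |F y - F x - inner ℝ (P x) (y - x)| ≤ M * ‖y - x‖ ^ 2)
    (hc : HasCompactSupport F) :
    IsC11 F ∧ ∀ x v, fderiv ℝ F x v = inner ℝ (P x) v := by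
  have hder : ∀ x, HasFDerivAt F (innerSL ℝ (P x)) x := by
    intro x
    rw [hasFDerivAt_iff_isLittleO_nhds_zero]
    have hO : (fun v => F (x + v) - F x - innerSL ℝ (P x) v) =O[𝓝 0] fun v : Plane => ‖v‖ ^ 2 := by
      refine Asymptotics.IsBigO.of_bound M (Eventually.of_forall fun v => ?_)
      have := h x (x + v)
      rw [add_sub_cancel_left] at this
      simpa using this
    refine hO.trans_isLittleO ?_
    have := (Asymptotics.isLittleO_pow_id (𝕜 := ℝ) one_lt_two).comp_tendsto
      (tendsto_norm_zero (E := Plane))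
    exact this.trans_isBigO (Asymptotics.isBigO_refl _ _).norm_left
  have hlip := norm_sub_le_of_quadratic_expansion h
  have hM : ∀ x y, ‖P x - P y‖ ≤ (6 * M).toNNReal * ‖x - y‖ := fun x y =>
    (hlip y x).trans (mul_le_mul_of_nonneg_right (Real.le_coe_toNNReal _) (norm_nonneg _))
  have hfd : fderiv ℝ F = fun x => innerSL ℝ (P x) := funext fun x => (hder x).fderiv
  have hPl : LipschitzWith (6 * M).toNNReal P := LipschitzWith.of_dist_le_mul fun x y => by
    rw [dist_eq_norm, dist_eq_norm]; exact hM x y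
  refine ⟨⟨?_, hc, (6 * M).toNNReal, fun i => ?_⟩, fun x v => by rw [hfd]; simp⟩
  · rw [contDiff_one_iff_fderiv, hfd]
    exact ⟨fun x => (hder x).differentiableAt, (innerSL ℝ).continuous.comp hPl.continuous⟩
  · have : pd i F = fun x => P x i := by
      funext x
      simp [pd, hfd, EuclideanSpace.inner_single_right]
    rw [this]
    refine LipschitzWith.of_dist_le_mul fun x y => ?_
    rw [dist_eq_norm, dist_eq_norm]
    exact (PiLp.norm_apply_le (P x - P y) i).trans (hM x y)

/-- Bump functions with supports shrinking to the origin. -/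
noncomputable def mollifier (k : ℕ) : ContDiffBump (0 : Plane) where
  rIn := 1 / ((k : ℝ) + 1)
  rOut := 2 / ((k : ℝ) + 1)
  rIn_pos := by positivity
  rIn_lt_rOut := by gcongr; norm_num

/-- The mollification of `g` at scale `k`. -/
noncomputable def mollify (k : ℕ) (g : Plane → ℝ) : Plane → ℝ :=
  MeasureTheory.convolution ((mollifier k).normed volume) g (ContinuousLinearMap.lsmul ℝ ℝ) volume

lemma tendsto_mollifier_rOut : Tendsto (fun k => (mollifier k).rOut) atTop (𝓝 0) := by
  have : (fun k => (mollifier k).rOut) = fun k : ℕ => 2 * (1 / ((k : ℝ) + 1)) := by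
    funext k
    simp [mollifier, div_eq_mul_inv]
  rw [this]
  simpa using tendsto_one_div_add_atTop_nhds_zero_nat.const_mul (2 : ℝ)

lemma contDiff_mollify (k : ℕ) {g : Plane → ℝ} (hg : LocallyIntegrable g volume) :
    ContDiff ℝ ∞ (mollify k g) :=
  HasCompactSupport.contDiff_convolution_left _ (mollifier k).hasCompactSupport_normed
    (mollifier k).contDiff_normed hg

lemma abs_mollify_sub_le (k : ℕ) {g : Plane → ℝ} {C : NNReal} (hg : LipschitzWith C g)
    (x : Plane) : |mollify k g x - g x| ≤ C * (mollifier k).rOut := by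
  rw [← Real.dist_eq]
  refine ContDiffBump.dist_normed_convolution_le hg.continuous.aestronglyMeasurable fun y hy => ?_
  refine (hg.dist_le_mul y x).trans ?_
  gcongr
  exact (Metric.mem_ball.1 hy).le

lemma abs_mollify_le (k : ℕ) {g : Plane → ℝ} {C : ℝ} (hm : AEStronglyMeasurable g volume)
    (hg : ∀ x, |g x| ≤ C) (x : Plane) : |mollify k g x| ≤ 3 * C := by
  have h : dist (mollify k g x) (g x) ≤ 2 * C := by
    refine ContDiffBump.dist_normed_convolution_le hm fun y _ => ?_
    rw [Real.dist_eq]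
    linarith [abs_sub (g y) (g x), hg x, hg y]
  rw [Real.dist_eq] at h
  have := abs_add_le (mollify k g x - g x) (g x)
  rw [sub_add_cancel] at this
  linarith [hg x]

lemma pd_mollify (k : ℕ) {g : Plane → ℝ} (hg : ContDiff ℝ 1 g) (hc : HasCompactSupport g)
    (i : Fin 2) : pd i (mollify k g) = mollify k (pd i g) := by
  funext x
  have hl : LocallyIntegrable ((mollifier k).normed (volume : Measure Plane)) volume :=
    (mollifier k).continuous_normed.locallyIntegrable
  rw [pd, mollify, (hc.hasFDerivAt_convolution_right (ContinuousLinearMap.lsmul ℝ ℝ) hl hg x).fderiv,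
    convolution_precompR_apply _ hl (hc.fderiv ℝ) (hg.continuous_fderiv one_ne_zero)]
  rfl

/-- Mollification turns the almost everywhere derivative of a Lipschitz function into a
classical one. -/
lemma pd_mollify_of_lipschitz (k : ℕ) {g : Plane → ℝ} {C : NNReal} (hg : LipschitzWith C g)
    (i : Fin 2) : pd i (mollify k g) = mollify k fun y => lineDeriv ℝ g y (coordVec i) := by
  funext x
  set ρ := (mollifier k).normed (volume : Measure Plane) with hρ
  have hρc : HasCompactSupport ρ := (mollifier k).hasCompactSupport_normed
  have hρd : ContDiff ℝ 1 ρ := (mollifier k).contDiff_normed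
  obtain ⟨D, hD⟩ := hρd.lipschitzWith_of_hasCompactSupport hρc one_ne_zero
  have hl : LocallyIntegrable g volume := hg.continuous.locallyIntegrable
  have h1 := hρc.hasFDerivAt_convolution_left (ContinuousLinearMap.lsmul ℝ ℝ) hρd hl x
  have hgx : LipschitzWith C fun t => g (x - t) := by
    have h : LipschitzWith 1 fun t : Plane => x - t :=
      LipschitzWith.of_dist_le_mul fun a b => by simp [dist_eq_norm, norm_sub_rev]
    simpa [Function.comp_def] using hg.comp h
  have h2 := hgx.integral_lineDeriv_mul_eq (μ := volume) hD hρc (-coordVec i)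
  have h3 : ∀ t, lineDeriv ℝ (fun t => g (x - t)) t (-coordVec i) =
      lineDeriv ℝ g (x - t) (coordVec i) := by
    intro t
    simp only [lineDeriv, smul_neg, sub_add, sub_neg_eq_add, ← sub_sub]
  rw [pd, mollify, h1.fderiv]
  have hex : ConvolutionExistsAt (fderiv ℝ ρ) g x
      ((ContinuousLinearMap.lsmul ℝ ℝ : ℝ →L[ℝ] ℝ →L[ℝ] ℝ).precompL Plane) volume :=
    (hρc.fderiv ℝ).convolutionExists_left _ (hρd.continuous_fderiv one_ne_zero) hl x
  rw [convolution_def, ContinuousLinearMap.integral_apply hex, mollify, convolution_def]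
  simp only [h3, neg_neg] at h2
  simp only [ContinuousLinearMap.lsmul_apply, smul_eq_mul]
  rw [← hρ]
  simp_rw [mul_comm (ρ _)]
  rw [h2]
  refine integral_congr_ae (Eventually.of_forall fun t => ?_)
  simp only [ContinuousLinearMap.precompL_apply, ContinuousLinearMap.lsmul_apply, smul_eq_mul]
  rw [(hρd.differentiable one_ne_zero t).lineDeriv_eq_fderiv]

lemma ae_tendsto_mollify {g : Plane → ℝ} (hg : LocallyIntegrable g volume) :
    ∀ᵐ x, Tendsto (fun k => mollify k g x) atTop (𝓝 (g x)) :=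
  ContDiffBump.ae_convolution_tendsto_right_of_locallyIntegrable (K := 2) tendsto_mollifier_rOut
    (Eventually.of_forall fun k => by simp [mollifier, div_eq_mul_inv]) hg

/-- A `C^{1,1}` function is approximated by smooth functions, uniformly together with the first
derivatives, and boundedly almost everywhere together with the second derivatives. -/
lemma IsC11.exists_smooth_approx {F : Plane → ℝ} (hF : IsC11 F) :
    ∃ (φ : ℕ → Plane → ℝ) (c : ℕ → ℝ) (B : ℝ), (∀ k, ContDiff ℝ ∞ (φ k)) ∧
      Tendsto c atTop (𝓝 0) ∧ (∀ k x, |φ k x - F x| ≤ c k) ∧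
      (∀ k i x, |pd i (φ k) x - pd i F x| ≤ c k) ∧
      (∀ k i j x, |pd j (pd i (φ k)) x - lineDeriv ℝ (pd i F) x (coordVec j)| ≤ B) ∧
      ∀ i j, ∀ᵐ x, Tendsto (fun k => pd j (pd i (φ k)) x) atTop
        (𝓝 (lineDeriv ℝ (pd i F) x (coordVec j))) := by
  obtain ⟨C, hC⟩ := hF.lip
  obtain ⟨D, hD⟩ := hF.exists_lipschitz
  have hpd : ∀ k i, pd i (mollify k F) = mollify k (pd i F) := fun k i =>
    pd_mollify k hF.contDiff hF.compact i
  have hpd2 : ∀ k i j, pd j (pd i (mollify k F)) =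
      mollify k fun y => lineDeriv ℝ (pd i F) y (coordVec j) := fun k i j => by
    rw [hpd, pd_mollify_of_lipschitz k (hC i)]
  have hb : ∀ i j x, |lineDeriv ℝ (pd i F) x (coordVec j)| ≤ C := fun i j x => by
    have := norm_lineDeriv_le_of_lipschitz ℝ (v := coordVec j) (x₀ := x) (hC i)
    simpa using this
  refine ⟨fun k => mollify k F, fun k => (C + D : ℝ) * (mollifier k).rOut, 3 * C + C,
    fun k => contDiff_mollify k hD.continuous.locallyIntegrable, ?_, fun k x => ?_,
    fun k i x => ?_, fun k i j x => ?_, fun i j => ?_⟩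
  · simpa using tendsto_mollifier_rOut.const_mul (C + D : ℝ)
  · refine (abs_mollify_sub_le k hD x).trans ?_
    have := (mollifier k).rOut_pos.le
    exact mul_le_mul_of_nonneg_right (by simp) this
  · rw [hpd]
    refine (abs_mollify_sub_le k (hC i) x).trans ?_
    have := (mollifier k).rOut_pos.le
    exact mul_le_mul_of_nonneg_right (by simp) this
  · rw [hpd2]
    refine (abs_sub _ _).trans (add_le_add ?_ (hb i j x))
    exact abs_mollify_le k (measurable_lineDeriv (hC i).continuous).aestronglyMeasurable (hb i j) x
  · simp only [hpd2]
    exact ae_tendsto_mollify ((hC i).locallyIntegrable_lineDeriv _)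

lemma tendsto_eLpNorm_of_ae_abs_le {α : Type*} [MeasurableSpace α] {μ : Measure α}
    [IsFiniteMeasure μ] {f : ℕ → α → ℝ} {c : ℕ → ℝ} (hc : Tendsto c atTop (𝓝 0))
    (h : ∀ k, ∀ᵐ x ∂μ, |f k x| ≤ c k) :
    Tendsto (fun k => eLpNorm (f k) 2 μ) atTop (𝓝 0) := by
  refine tendsto_of_tendsto_of_tendsto_of_le_of_le tendsto_const_nhds ?_ (fun _ => zero_le)
    fun k => eLpNorm_le_of_ae_bound (h k)
  have h2 : Tendsto (fun k => ENNReal.ofReal (c k)) atTop (𝓝 0) := by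
    simpa using ENNReal.tendsto_ofReal hc
  have h3 := ENNReal.Tendsto.const_mul (a := μ univ ^ (2 : ℝ≥0∞).toReal⁻¹) h2
    (Or.inr (ENNReal.rpow_ne_top_of_nonneg (by positivity) (measure_ne_top _ _)))
  simpa using h3

lemma tendsto_eLpNorm_of_ae_tendsto_of_bounded {α : Type*} [MeasurableSpace α] {μ : Measure α}
    [IsFiniteMeasure μ] {f : ℕ → α → ℝ} {B : ℝ} (hm : ∀ k, AEStronglyMeasurable (f k) μ)
    (hb : ∀ k, ∀ᵐ x ∂μ, |f k x| ≤ B)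
    (h : ∀ᵐ x ∂μ, Tendsto (fun k => f k x) atTop (𝓝 0)) :
    Tendsto (fun k => eLpNorm (f k) 2 μ) atTop (𝓝 0) := by
  have e : ∀ k, eLpNorm (f k) 2 μ = (∫⁻ x, ‖f k x‖ₑ ^ (2 : ℝ) ∂μ) ^ (1 / 2 : ℝ) := fun k => by
    rw [eLpNorm_eq_lintegral_rpow_enorm_toReal two_ne_zero ENNReal.ofNat_ne_top]
    simp
  simp only [e]
  have h1 : Tendsto (fun k => ∫⁻ x, ‖f k x‖ₑ ^ (2 : ℝ) ∂μ) atTop (𝓝 (∫⁻ _, 0 ∂μ)) := by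
    refine tendsto_lintegral_of_dominated_convergence' (fun _ => ENNReal.ofReal B ^ (2 : ℝ))
      (fun k => (hm k).enorm.pow_const _) (fun k => ?_) ?_ ?_
    · filter_upwards [hb k] with x hx
      gcongr
      rw [← ofReal_norm]
      exact ENNReal.ofReal_le_ofReal hx
    · rw [lintegral_const]
      exact ENNReal.mul_ne_top (ENNReal.rpow_ne_top_of_nonneg (by norm_num) ENNReal.ofReal_ne_top)
        (measure_ne_top _ _)
    · filter_upwards [h] with x hx
      have := (ENNReal.continuous_rpow_const (y := 2)).tendsto _ |>.comp (hx.enorm)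
      simpa [Function.comp_def] using this
  rw [lintegral_zero] at h1
  have := (ENNReal.continuous_rpow_const (y := (1 / 2 : ℝ))).tendsto _ |>.comp h1
  simpa [Function.comp_def] using this

/-! ### `C^{1,1}` functions as elements of `H²(Ω)` -/

/-- The element `v` of `H²(Ω)` is the restriction to `Ω` of the `C^{1,1}` function `F`. -/
structure IsRep {Ω : Set Plane} (v : H2 Ω) (F : Plane → ℝ) : Prop where
  isC11 : IsC11 F
  ae_val : v.1.1 =ᵐ[volume.restrict Ω] F
  ae_grad : ∀ i, v.1.2.1 i =ᵐ[volume.restrict Ω] pd i F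
  ae_hess : ∀ i j, v.1.2.2 (i, j) =ᵐ[volume.restrict Ω]
    fun x => lineDeriv ℝ (pd i F) x (coordVec j)

/-- Integration by parts: the weak derivative of a Lipschitz function is its almost everywhere
derivative. -/
lemma setIntegral_mul_pd_of_lipschitz {Ω : Set Plane} {g : Plane → ℝ} {C : NNReal}
    (hg : LipschitzWith C g) {φ : Plane → ℝ} (hφ : IsTest Ω φ) (i : Fin 2) :
    ∫ x in Ω, g x * pd i φ x = -∫ x in Ω, lineDeriv ℝ g x (coordVec i) * φ x := by
  have h0 : ∀ x ∉ Ω, φ x = 0 := fun x hx =>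
    image_eq_zero_of_notMem_tsupport fun h => hx (hφ.support h)
  have h1 : ∀ x ∉ Ω, pd i φ x = 0 := fun x hx =>
    image_eq_zero_of_notMem_tsupport fun h => hx ((hφ.pd i).support h)
  have hd : ContDiff ℝ 1 φ := hφ.smooth.of_le (by simp)
  obtain ⟨D, hD⟩ := hd.lipschitzWith_of_hasCompactSupport hφ.compact one_ne_zero
  rw [setIntegral_eq_integral_of_forall_compl_eq_zero fun x hx => by rw [h1 x hx, mul_zero],
    setIntegral_eq_integral_of_forall_compl_eq_zero fun x hx => by rw [h0 x hx, mul_zero],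
    hg.integral_lineDeriv_mul_eq hD hφ.compact, ← integral_neg]
  refine integral_congr_ae (Eventually.of_forall fun x => ?_)
  simp only [lineDeriv_neg]
  rw [pd_eq_lineDeriv (hd.differentiable one_ne_zero x)]
  ring

lemma isFiniteMeasure_restrict_of_isBounded {Ω : Set Plane} (h : Bornology.IsBounded Ω) :
    IsFiniteMeasure (volume.restrict Ω) :=
  ⟨by simpa using h.measure_lt_top⟩

/-- A `C^{1,1}` function restricts to an element of `H²(Ω)`; the weak Hessian is the almost
everywhere derivative of the Lipschitz continuous gradient. -/
lemma IsC11.exists_isRep {F : Plane → ℝ} (hF : IsC11 F) {Ω : Set Plane}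
    (hΩ : Bornology.IsBounded Ω) : ∃ v : H2 Ω, IsRep v F := by
  have := isFiniteMeasure_restrict_of_isBounded hΩ
  obtain ⟨C, hC⟩ := hF.lip
  obtain ⟨D, hD⟩ := hF.exists_lipschitz
  have m0 : MemLp F 2 (volume.restrict Ω) :=
    (hD.continuous.memLp_of_hasCompactSupport hF.compact).restrict Ω
  have m1 : ∀ i, MemLp (pd i F) 2 (volume.restrict Ω) := fun i =>
    ((hC i).continuous.memLp_of_hasCompactSupport (hF.hasCompactSupport_pd i)).restrict Ω
  have m2 : ∀ ij : Fin 2 × Fin 2, MemLp (fun x => lineDeriv ℝ (pd ij.1 F) x (coordVec ij.2)) 2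
      (volume.restrict Ω) := fun ij =>
    MemLp.of_bound (measurable_lineDeriv (hC ij.1).continuous).aestronglyMeasurable C
      (Eventually.of_forall fun x => by
        simpa using norm_lineDeriv_le_of_lipschitz ℝ (v := coordVec ij.2) (x₀ := x) (hC ij.1))
  refine ⟨⟨(m0.toLp F, fun i => (m1 i).toLp _, fun ij => (m2 ij).toLp _), ?_, ?_⟩,
    ⟨hF, m0.coeFn_toLp, fun i => (m1 i).coeFn_toLp, fun i j => (m2 (i, j)).coeFn_toLp⟩⟩
  · intro i φ hφ
    have e1 : ∫ x in Ω, m0.toLp F x * pd i φ x = ∫ x in Ω, F x * pd i φ x :=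
      integral_congr_ae (m0.coeFn_toLp.mono fun x hx => by simp only [hx])
    have e2 : ∫ x in Ω, (m1 i).toLp _ x * φ x = ∫ x in Ω, pd i F x * φ x :=
      integral_congr_ae ((m1 i).coeFn_toLp.mono fun x hx => by simp only [hx])
    rw [e1, e2, setIntegral_mul_pd_of_lipschitz hD hφ]
    simp only [pd_eq_lineDeriv (hF.differentiable _)]
  · intro i j φ hφ
    have e1 : ∫ x in Ω, (m1 i).toLp _ x * pd j φ x = ∫ x in Ω, pd i F x * pd j φ x :=
      integral_congr_ae ((m1 i).coeFn_toLp.mono fun x hx => by simp only [hx])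
    have e2 : ∫ x in Ω, (m2 (i, j)).toLp _ x * φ x =
        ∫ x in Ω, lineDeriv ℝ (pd i F) x (coordVec j) * φ x :=
      integral_congr_ae ((m2 (i, j)).coeFn_toLp.mono fun x hx => by simp only [hx])
    rw [e1, e2, setIntegral_mul_pd_of_lipschitz (hC i) hφ]

namespace IsRep

variable {Ω : Set Plane} {v w : H2 Ω} {F G : Plane → ℝ}

lemma add (hv : IsRep v F) (hw : IsRep w G) : IsRep (v + w) (F + G) := by
  refine ⟨hv.isC11.add hw.isC11, ?_, fun i => ?_, fun i j => ?_⟩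
  · exact (Lp.coeFn_add v.1.1 w.1.1).trans (hv.ae_val.add hw.ae_val)
  · rw [hv.isC11.pd_add hw.isC11]
    exact (Lp.coeFn_add (v.1.2.1 i) (w.1.2.1 i)).trans ((hv.ae_grad i).add (hw.ae_grad i))
  · obtain ⟨C, hC⟩ := hv.isC11.lip
    obtain ⟨D, hD⟩ := hw.isC11.lip
    rw [hv.isC11.pd_add hw.isC11]
    filter_upwards [Lp.coeFn_add (v.1.2.2 (i, j)) (w.1.2.2 (i, j)), hv.ae_hess i j, hw.ae_hess i j,
      ae_restrict_of_ae ((hC i).ae_lineDifferentiableAt (μ := volume) (coordVec j)),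
      ae_restrict_of_ae ((hD i).ae_lineDifferentiableAt (μ := volume) (coordVec j))]
      with x h1 h2 h3 h4 h5
    have h6 : lineDeriv ℝ (pd i F + pd i G) x (coordVec j) = _ :=
      (HasDerivAt.add h4.hasLineDerivAt h5.hasLineDerivAt).deriv
    exact h1.trans (by rw [Pi.add_apply, h2, h3, h6])

lemma smul (hv : IsRep v F) (c : ℝ) : IsRep (c • v) (c • F) := by
  refine ⟨hv.isC11.smul c, ?_, fun i => ?_, fun i j => ?_⟩
  · exact (Lp.coeFn_smul c v.1.1).trans (hv.ae_val.const_smul c)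
  · rw [hv.isC11.pd_smul]
    exact (Lp.coeFn_smul c (v.1.2.1 i)).trans ((hv.ae_grad i).const_smul c)
  · obtain ⟨C, hC⟩ := hv.isC11.lip
    rw [hv.isC11.pd_smul]
    filter_upwards [Lp.coeFn_smul c (v.1.2.2 (i, j)), hv.ae_hess i j,
      ae_restrict_of_ae ((hC i).ae_lineDifferentiableAt (μ := volume) (coordVec j))]
      with x h1 h2 h4
    have h6 : lineDeriv ℝ (c • pd i F) x (coordVec j) = _ :=
      (HasDerivAt.const_smul c h4.hasLineDerivAt).deriv
    exact h1.trans (by rw [Pi.smul_apply, h2, h6])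

lemma zero : IsRep (0 : H2 Ω) 0 := by
  refine ⟨IsC11.zero, Lp.coeFn_zero _ _ _, fun i => ?_, fun i j => ?_⟩
  · have : pd i (0 : Plane → ℝ) = 0 := by
      funext x
      simp [pd]
    rw [this]
    exact Lp.coeFn_zero _ _ _
  · have : (fun x => lineDeriv ℝ (pd i (0 : Plane → ℝ)) x (coordVec j)) = 0 := by
      have : pd i (0 : Plane → ℝ) = 0 := by
        funext x
        simp [pd]
      funext x
      rw [this]
      simp [lineDeriv]
    rw [this]
    exact Lp.coeFn_zero _ _ _

end IsRep

namespace BoundaryMesh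

variable {Ω : Set Plane} {ι : Type*} (M : BoundaryMesh Ω ι)

lemma continuousOn_vel (e : ι) : ContinuousOn (M.vel e) (Icc 0 1) :=
  (M.smooth e).continuousOn_derivWithin (uniqueDiffOn_Icc one_pos) (by simp)

lemma norm_vel_pos (e : ι) {s : ℝ} (hs : s ∈ Icc (0 : ℝ) 1) : 0 < ‖M.vel e s‖ :=
  norm_pos_iff.2 (M.regular e s hs)

instance isFiniteMeasure_arc (e : ι) : IsFiniteMeasure (M.arc e) := by
  refine isFiniteMeasure_withDensity (ne_of_lt ?_)
  exact ((M.continuousOn_vel e).integrableOn_compact (μ := volume) isCompact_Icc).2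

/-- Outside of the parameter interval the velocity may vanish, and then so does the normal. -/
lemma norm_normal_le (e : ι) (s : ℝ) : ‖M.normal e s‖ ≤ 1 := by
  have h : ‖M.normal e s‖ = ‖M.tangent e s‖ := by
    simp only [EuclideanSpace.norm_eq, normal, rotCW, Fin.sum_univ_two]
    congr 1
    simp
    ring
  rw [h, tangent, norm_smul, norm_inv, norm_norm]
  exact inv_mul_le_one

/-- The Sobolev traces of a `C^{1,1}` function are its pointwise traces. -/
lemma hasTrace_of_isRep (hΩ : Bornology.IsBounded Ω) {v : H2 Ω} {F : Plane → ℝ} (hv : IsRep v F)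
    {w : M.L2Γ × M.L2Γ} (h1 : ∀ e, ∀ᵐ s ∂M.arc e, w.1 (M.γ e s) = F (M.γ e s))
    (h2 : ∀ e, ∀ᵐ s ∂M.arc e, w.2 (M.γ e s) = fderiv ℝ F (M.γ e s) (M.normal e s)) :
    M.HasTrace v w := by
  have := isFiniteMeasure_restrict_of_isBounded hΩ
  obtain ⟨φ, c, B, hφ, hc, hφ0, hφ1, hφb, hφ2⟩ := hv.isC11.exists_smooth_approx
  obtain ⟨C, hC⟩ := hv.isC11.lip
  refine ⟨φ, hφ, ?_, fun i => ?_, fun i j => ?_, fun e => ?_, fun e => ?_⟩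
  · refine tendsto_eLpNorm_of_ae_abs_le hc fun k => ?_
    filter_upwards [hv.ae_val] with x hx
    rw [hx]
    exact hφ0 k x
  · refine tendsto_eLpNorm_of_ae_abs_le hc fun k => ?_
    filter_upwards [hv.ae_grad i] with x hx
    rw [hx]
    exact hφ1 k i x
  · refine tendsto_eLpNorm_of_ae_tendsto_of_bounded (B := B) (fun k => ?_) (fun k => ?_) ?_
    · have hs : ContDiff ℝ ∞ (pd j (pd i (φ k))) := by
        have h : ∀ {g : Plane → ℝ} (l : Fin 2), ContDiff ℝ ∞ g → ContDiff ℝ ∞ (pd l g) :=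
          fun l hg => (hg.fderiv_right (m := ∞) (by simp)).clm_apply contDiff_const
        exact h j (h i (hφ k))
      exact hs.continuous.aestronglyMeasurable.sub (Lp.aestronglyMeasurable _)
    · filter_upwards [hv.ae_hess i j] with x hx
      rw [hx]
      exact hφb k i j x
    · filter_upwards [hv.ae_hess i j, ae_restrict_of_ae (hφ2 i j)] with x hx hx'
      rw [hx]
      simpa using hx'.sub_const (lineDeriv ℝ (pd i F) x (coordVec j))
  · refine tendsto_eLpNorm_of_ae_abs_le hc fun k => ?_
    filter_upwards [h1 e] with s hs
    rw [hs]
    exact hφ0 k _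
  · refine tendsto_eLpNorm_of_ae_abs_le (c := fun k => 2 * c k)
      (by simpa using hc.const_mul 2) fun k => ?_
    filter_upwards [h2 e] with s hs
    rw [hs, fderiv_apply_eq_sum_pd, fderiv_apply_eq_sum_pd, ← Finset.sum_sub_distrib]
    refine (Finset.abs_sum_le_sum_abs _ _).trans ?_
    have hb : ∀ i, |M.normal e s i * pd i (φ k) (M.γ e s) - M.normal e s i * pd i F (M.γ e s)| ≤
        c k := by
      intro i
      rw [← mul_sub, abs_mul]
      have hn : |M.normal e s i| ≤ 1 :=
        (PiLp.norm_apply_le (M.normal e s) i).trans (M.norm_normal_le e s)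
      have := mul_le_mul hn (hφ1 k i (M.γ e s)) (abs_nonneg _) zero_le_one
      rwa [one_mul] at this
    calc _ ≤ ∑ _i : Fin 2, c k := Finset.sum_le_sum fun i _ => hb i
      _ = 2 * c k := by simp

end BoundaryMesh

/-! ### Lipschitz charts of the boundary -/

/-- In the ball of radius `r` around `x`, the set `Ω` is the region below the graph of the
`K`-Lipschitz function `f`, in the coordinates given by the isometry `R`. -/
structure IsChart (Ω : Set Plane) (x : Plane) (R : Plane ≃ₗᵢ[ℝ] Plane) (r : ℝ) (K : NNReal)
    (f : ℝ → ℝ) : Prop where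
  pos : 0 < r
  lip : LipschitzWith K f
  mem_iff : ∀ y ∈ Metric.ball x r, y ∈ Ω ↔ (R y) 1 < f ((R y) 0)

/-- The point with coordinates `(a, b)` in the chart `R`. -/
noncomputable def chartPt (R : Plane ≃ₗᵢ[ℝ] Plane) (a b : ℝ) : Plane := R.symm !₂[a, b]

section chartPt

variable (R : Plane ≃ₗᵢ[ℝ] Plane)

@[simp] lemma chartPt_zero (a b : ℝ) : R (chartPt R a b) 0 = a := by simp [chartPt]

@[simp] lemma chartPt_one (a b : ℝ) : R (chartPt R a b) 1 = b := by simp [chartPt]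

lemma chartPt_eq (y : Plane) : chartPt R (R y 0) (R y 1) = y := by
  have : !₂[R y 0, R y 1] = R y := by
    ext i
    fin_cases i <;> rfl
  rw [chartPt, this, LinearIsometryEquiv.symm_apply_apply]

lemma chartPt_add_smul (a b t : ℝ) :
    chartPt R a b + t • R.symm (coordVec 1) = chartPt R a (b + t) := by
  rw [chartPt, chartPt, ← map_smul, ← map_add]
  congr 1
  ext i
  fin_cases i <;> simp

lemma chartPt_sub (a b a' b' : ℝ) : chartPt R a b - chartPt R a' b' =
    (a - a') • R.symm (coordVec 0) + (b - b') • R.symm (coordVec 1) := by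
  rw [chartPt, chartPt, ← map_smul, ← map_smul, ← map_sub, ← map_add]
  congr 1
  ext i
  fin_cases i <;> simp

lemma dist_chartPt_le (a b a' b' : ℝ) :
    dist (chartPt R a b) (chartPt R a' b') ≤ |a - a'| + |b - b'| := by
  rw [dist_eq_norm, chartPt_sub]
  refine (norm_add_le _ _).trans (le_of_eq ?_)
  simp [norm_smul]

lemma continuous_chartPt : Continuous fun p : ℝ × ℝ => chartPt R p.1 p.2 := by
  unfold chartPt
  refine R.symm.continuous.comp ((PiLp.continuous_toLp 2 _).comp (continuous_pi fun i => ?_))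
  fin_cases i
  · exact continuous_fst
  · exact continuous_snd

lemma measurePreserving_chartPt :
    MeasurePreserving (fun p : ℝ × ℝ => chartPt R p.1 p.2) volume volume := by
  have h1 := (volume_preserving_finTwoArrow ℝ).symm
  have h2 := PiLp.volume_preserving_toLp (Fin 2)
  have h3 := R.symm.measurePreserving
  exact h3.comp (h2.comp h1)

end chartPt

lemma abs_apply_sub_le (R : Plane ≃ₗᵢ[ℝ] Plane) (x y : Plane) (i : Fin 2) :
    |R x i - R y i| ≤ dist x y := by
  rw [← R.dist_map, dist_eq_norm]
  exact PiLp.norm_apply_le (R x - R y) i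

namespace IsChart

variable {Ω : Set Plane} {x : Plane} {R : Plane ≃ₗᵢ[ℝ] Plane} {r : ℝ} {K : NNReal} {f : ℝ → ℝ}

lemma frontier_iff (h : IsChart Ω x R r K f) (hΩ : IsOpen Ω) {y : Plane}
    (hy : y ∈ Metric.ball x r) : y ∈ frontier Ω ↔ R y 1 = f (R y 0) := by
  have hcoord : ∀ i, Continuous fun z => R z i := fun i =>
    (PiLp.continuous_apply 2 _ i).comp R.continuous
  have hball : Metric.ball x r ∈ 𝓝 y := Metric.isOpen_ball.mem_nhds hy
  rw [hΩ.frontier_eq]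
  constructor
  · rintro ⟨h1, h2⟩
    rw [h.mem_iff y hy, not_lt] at h2
    refine le_antisymm ?_ h2
    by_contra hcon
    push Not at hcon
    have : ∀ᶠ z in 𝓝 y, z ∉ Ω := by
      filter_upwards [hball,
        (h.lip.continuous.comp (hcoord 0)).continuousAt.eventually_lt (hcoord 1).continuousAt hcon]
        with z hz hz'
      rw [h.mem_iff z hz, not_lt]
      exact hz'.le
    exact (mem_closure_iff_frequently.1 h1) (this.mono fun z hz => hz)
  · intro heq
    refine ⟨?_, by rw [h.mem_iff y hy, heq]; exact lt_irrefl _⟩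
    have ht : Tendsto (fun t : ℝ => chartPt R (R y 0) (R y 1 + t)) (𝓝[<] 0) (𝓝 y) := by
      have hc : Continuous fun t : ℝ => chartPt R (R y 0) (R y 1 + t) :=
        (continuous_chartPt R).comp (by fun_prop : Continuous fun t : ℝ => (R y 0, R y 1 + t))
      have := hc.tendsto 0
      rw [add_zero, chartPt_eq] at this
      exact this.mono_left nhdsWithin_le_nhds
    refine mem_closure_of_tendsto ht ?_
    filter_upwards [ht.eventually_mem hball, self_mem_nhdsWithin] with t ht1 ht2
    rw [h.mem_iff _ ht1]
    simp only [chartPt_zero, chartPt_one, heq]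
    have : t < 0 := ht2
    linarith

/-- On the boundary, the distance of two points is controlled by the distance of their first chart
coordinates. -/
lemma dist_le (h : IsChart Ω x R r K f) (hΩ : IsOpen Ω) {y z : Plane}
    (hy : y ∈ Metric.ball x r) (hz : z ∈ Metric.ball x r) (hy' : y ∈ frontier Ω)
    (hz' : z ∈ frontier Ω) : dist y z ≤ (1 + K) * |R y 0 - R z 0| := by
  have e1 := (h.frontier_iff hΩ hy).1 hy'
  have e2 := (h.frontier_iff hΩ hz).1 hz'
  have h1 := dist_chartPt_le R (R y 0) (R y 1) (R z 0) (R z 1)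
  rw [chartPt_eq, chartPt_eq] at h1
  have h2 := h.lip.dist_le_mul (R y 0) (R z 0)
  rw [Real.dist_eq, Real.dist_eq, ← e1, ← e2] at h2
  linarith

/-- The divergence theorem below a graph, for fields in the vertical direction. -/
lemma setIntegral_fderiv_eq (h : IsChart Ω x R r K f) (hΩ : IsOpen Ω) {G : Plane → ℝ}
    (hG : ContDiff ℝ 1 G) (hs : tsupport G ⊆ Metric.ball x r) :
    ∫ y in Ω, fderiv ℝ G y (R.symm (coordVec 1)) = ∫ a, G (chartPt R a (f a)) := by
  set ν := R.symm (coordVec 1) with hν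
  have hGc : HasCompactSupport G :=
    Metric.isCompact_of_isClosed_isBounded (isClosed_tsupport G) (Metric.isBounded_ball.subset hs)
  have hDc : Continuous fun y => fderiv ℝ G y ν :=
    (hG.continuous_fderiv one_ne_zero).clm_apply continuous_const
  have hDs : HasCompactSupport fun y => fderiv ℝ G y ν := hGc.fderiv_apply ℝ _
  have hint : Integrable (Ω.indicator fun y => fderiv ℝ G y ν) volume :=
    (hDc.integrable_of_hasCompactSupport hDs).indicator hΩ.measurableSet
  have hmp := measurePreserving_chartPt R
  have hT : AEMeasurable (fun p : ℝ × ℝ => chartPt R p.1 p.2) volume :=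
    (continuous_chartPt R).aemeasurable
  rw [← integral_indicator hΩ.measurableSet, ← hmp.map_eq, integral_map hT
    (by rw [hmp.map_eq]; exact hint.aestronglyMeasurable), Measure.volume_eq_prod,
    integral_prod _ (by
      rw [← Measure.volume_eq_prod]
      exact hmp.integrable_comp_of_integrable hint)]
  refine integral_congr_ae (Eventually.of_forall fun a => ?_)
  -- on each vertical line, the fundamental theorem of calculus
  have hder : ∀ b, HasDerivAt (fun b => G (chartPt R a b)) (fderiv ℝ G (chartPt R a b) ν) b := by
    intro b
    have h1 : HasDerivAt (fun b : ℝ => chartPt R a b) ν b := by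
      have h2 : (fun b : ℝ => chartPt R a b) = fun b => chartPt R a 0 + b • ν := by
        funext b
        rw [hν, chartPt_add_smul, zero_add]
      rw [h2]
      simpa using ((hasDerivAt_id b).smul_const ν).const_add (chartPt R a 0)
    exact (hG.differentiable one_ne_zero _).hasFDerivAt.comp_hasDerivAt b h1
  have hca : Continuous fun b : ℝ => chartPt R a b :=
    (continuous_chartPt R).comp (by fun_prop : Continuous fun b : ℝ => (a, b))
  have hc1 : ContDiff ℝ 1 fun b => G (chartPt R a b) := by
    rw [contDiff_one_iff_deriv]
    refine ⟨fun b => (hder b).differentiableAt, ?_⟩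
    rw [show deriv (fun b => G (chartPt R a b)) = fun b => fderiv ℝ G (chartPt R a b) ν from
      funext fun b => (hder b).deriv]
    exact hDc.comp hca
  have hcs : HasCompactSupport fun b => G (chartPt R a b) := by
    refine HasCompactSupport.intro (isCompact_closedBall (R x 1) r) fun b hb => ?_
    refine image_eq_zero_of_notMem_tsupport fun hmem => hb ?_
    have := abs_apply_sub_le R (chartPt R a b) x 1
    rw [chartPt_one] at this
    rw [Metric.mem_closedBall, Real.dist_eq]
    exact this.trans (Metric.mem_ball.1 (hs hmem)).le
  have key := hcs.integral_Iic_deriv_eq hc1 (f a)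
  rw [integral_Iic_eq_integral_Iio, ← integral_indicator measurableSet_Iio] at key
  refine Eq.trans ?_ key
  refine integral_congr_ae (Eventually.of_forall fun b => ?_)
  simp only [indicator]
  rw [(hder b).deriv]
  by_cases hmem : chartPt R a b ∈ tsupport G
  · have := h.mem_iff _ (hs hmem)
    rw [chartPt_zero, chartPt_one] at this
    simp only [this, mem_Iio]
  -- outside of the support of `G`, the chart does not describe `Ω`, but the integrand vanishes
  · have : fderiv ℝ G (chartPt R a b) = 0 := by
      by_contra hne
      exact hmem (support_fderiv_subset ℝ hne)
    simp [this]

end IsChart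

lemma IsLipschitzSet.exists_isChart {Ω : Set Plane} (h : IsLipschitzSet Ω) {x : Plane}
    (hx : x ∈ frontier Ω) : ∃ R r K f, IsChart Ω x R r K f := by
  obtain ⟨R, r, K, f, h1, h2, h3⟩ := h x hx
  exact ⟨R, r, K, f, h1, h2, h3⟩

/-! ### The trace determines the boundary values -/

lemma contDiff_pd {q : Plane → ℝ} (hq : ContDiff ℝ ∞ q) (i : Fin 2) : ContDiff ℝ ∞ (pd i q) :=
  (hq.fderiv_right (m := ∞) (by simp)).clm_apply contDiff_const

lemma contDiff_fderiv_apply {q : Plane → ℝ} (hq : ContDiff ℝ ∞ q) (ν : Plane) :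
    ContDiff ℝ ∞ fun x => fderiv ℝ q x ν :=
  (hq.fderiv_right (m := ∞) (by simp)).clm_apply contDiff_const

lemma fderiv_fderiv_apply {q : Plane → ℝ} (hq : ContDiff ℝ ∞ q) (ν x : Plane) :
    fderiv ℝ (fun y => fderiv ℝ q y ν) x ν = ∑ ij : Fin 2 × Fin 2,
      ν ij.1 * ν ij.2 * pd ij.2 (pd ij.1 q) x := by
  have hd : ∀ i, DifferentiableAt ℝ (pd i q) x := fun i =>
    (contDiff_pd hq i).differentiable (by simp) x
  simp only [fderiv_apply_eq_sum_pd q]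
  rw [fderiv_fun_sum fun i _ => (hd i).const_mul _]
  simp only [fderiv_const_mul (hd _), Fintype.sum_prod_type, sum_apply,
    smul_apply, smul_eq_mul, fderiv_apply_eq_sum_pd, Finset.mul_sum, mul_assoc]

/-- If the trace of `v` vanishes, testing with the tensor `q ν ⊗ ν` gives a Green identity without
boundary terms. -/
lemma IsRep.integral_eq_zero {Ω : Set Plane} {v : H2 Ω} {F : Plane → ℝ}
    (hv : IsRep v F) (h0 : trGg Ω v = 0) {q : Plane → ℝ}
    (hq : ContDiff ℝ ∞ q) (hqc : HasCompactSupport q) (ν : Plane) :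
    (∫ x in Ω, fderiv ℝ (fun y => fderiv ℝ q y ν) x ν * F x) -
      ∑ ij : Fin 2 × Fin 2, ∫ x in Ω, ν ij.1 * ν ij.2 * q x *
        lineDeriv ℝ (pd ij.1 F) x (coordVec ij.2) = 0 := by
  have hT : IsTest univ q := ⟨hq, hqc, subset_univ _⟩
  set d : Plane → ℝ := fun x => fderiv ℝ (fun y => fderiv ℝ q y ν) x ν with hd
  have hdc : ContDiff ℝ ∞ d := contDiff_fderiv_apply (contDiff_fderiv_apply hq ν) ν
  have hds : HasCompactSupport d := (hqc.fderiv_apply ℝ ν).fderiv_apply ℝ ν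
  have m1 : ∀ ij : Fin 2 × Fin 2, MemLp (fun x => ν ij.1 * ν ij.2 * q x) 2 (volume.restrict Ω) :=
    fun ij => ((hq.continuous.memLp_of_hasCompactSupport hqc).restrict Ω).const_mul _
  have m2 : MemLp d 2 (volume.restrict Ω) :=
    (hdc.continuous.memLp_of_hasCompactSupport hds).restrict Ω
  have hmem : (WithLp.toLp 2 (WithLp.toLp 2 (fun ij => (m1 ij).toLp _), m2.toLp d) :
      TensorPair Ω) ∈ HdivDiv Ω := by
    refine ⟨fun i j => ?_, fun φ hφ => ?_⟩
    · change (m1 (i, j)).toLp _ = (m1 (j, i)).toLp _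
      congr 1
      funext x
      ring
    · have e2 : ∫ x in Ω, m2.toLp d x * φ x = ∫ x in Ω, d x * φ x :=
        integral_congr_ae (m2.coeFn_toLp.mono fun x hx => by simp only [hx])
      have e1 : ∀ ij : Fin 2 × Fin 2, ∫ x in Ω, (m1 ij).toLp _ x * pd ij.1 (pd ij.2 φ) x =
          ∫ x in Ω, ν ij.1 * ν ij.2 * pd ij.2 (pd ij.1 q) x * φ x := by
        intro ij
        have e3 : ∫ x in Ω, (m1 ij).toLp _ x * pd ij.1 (pd ij.2 φ) x =
            ∫ x in Ω, ν ij.1 * ν ij.2 * (q x * pd ij.1 (pd ij.2 φ) x) :=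
          integral_congr_ae ((m1 ij).coeFn_toLp.mono fun x hx => by simp only [hx]; ring)
        obtain ⟨C, hC⟩ := (hq.of_le (by simp) : ContDiff ℝ 1 q).lipschitzWith_of_hasCompactSupport
          hqc one_ne_zero
        have hT1 := hT.pd ij.1
        obtain ⟨D, hD⟩ := (hT1.smooth.of_le (by simp) :
          ContDiff ℝ 1 _).lipschitzWith_of_hasCompactSupport hT1.compact one_ne_zero
        have i1 := setIntegral_mul_pd_of_lipschitz hC (hφ.pd ij.2) ij.1
        have i2 := setIntegral_mul_pd_of_lipschitz hD hφ ij.2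
        simp only [← pd_eq_lineDeriv (hq.differentiable (by simp) _)] at i1
        simp only [← pd_eq_lineDeriv (hT1.smooth.differentiable (by simp) _)] at i2
        rw [e3, integral_const_mul, i1, i2, neg_neg, ← integral_const_mul]
        simp only [mul_assoc]
      change ∑ ij, ∫ x in Ω, (m1 ij).toLp _ x * pd ij.1 (pd ij.2 φ) x =
        ∫ x in Ω, m2.toLp d x * φ x
      rw [e2, Finset.sum_congr rfl fun ij _ => e1 ij, ← integral_finsetSum]
      · refine integral_congr_ae (Eventually.of_forall fun x => ?_)
        simp only [hd, fderiv_fderiv_apply hq, Finset.sum_mul]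
      · intro ij _
        have hT2 := (hT.pd ij.1).pd ij.2
        have : Integrable (fun x => ν ij.1 * ν ij.2 * pd ij.2 (pd ij.1 q) x * φ x) volume :=
          ((continuous_const.mul hT2.smooth.continuous).mul
            hφ.smooth.continuous).integrable_of_hasCompactSupport hφ.compact.mul_left
        exact this.restrict
  have key := trGg_apply Ω v ⟨_, hmem⟩
  rw [h0, zero_apply] at key
  have e1 : ∫ x in Ω, m2.toLp d x * v.1.1 x = ∫ x in Ω, d x * F x := by
    refine integral_congr_ae ?_
    filter_upwards [m2.coeFn_toLp, hv.ae_val] with x h1 h2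
    rw [h1, h2]
  have e2 : ∀ ij : Fin 2 × Fin 2, ∫ x in Ω, (m1 ij).toLp _ x * v.1.2.2 ij x =
      ∫ x in Ω, ν ij.1 * ν ij.2 * q x * lineDeriv ℝ (pd ij.1 F) x (coordVec ij.2) := by
    intro ij
    refine integral_congr_ae ?_
    filter_upwards [(m1 ij).coeFn_toLp, hv.ae_hess ij.1 ij.2] with x h1 h2
    rw [h1, h2]
  rw [← e1, ← Finset.sum_congr rfl fun ij _ => e2 ij]
  exact key.symm

/-- In the limit of the mollified Green identity, only boundary terms remain. -/
lemma IsRep.integral_boundary_eq_zero {Ω : Set Plane} (hΩ : IsOpen Ω)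
    (hb : Bornology.IsBounded Ω) {v : H2 Ω} {F : Plane → ℝ}
    (hv : IsRep v F) (h0 : trGg Ω v = 0) {x : Plane} {R : Plane ≃ₗᵢ[ℝ] Plane} {r : ℝ}
    {K : NNReal} {f : ℝ → ℝ} (hR : IsChart Ω x R r K f) {q : Plane → ℝ}
    (hq : ContDiff ℝ ∞ q) (hqs : tsupport q ⊆ Metric.ball x r) :
    ∫ a, (fderiv ℝ q (chartPt R a (f a)) (R.symm (coordVec 1)) * F (chartPt R a (f a)) -
      q (chartPt R a (f a)) * fderiv ℝ F (chartPt R a (f a)) (R.symm (coordVec 1))) = 0 := by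
  have := isFiniteMeasure_restrict_of_isBounded hb
  set ν := R.symm (coordVec 1) with hν
  have hqc : HasCompactSupport q :=
    Metric.isCompact_of_isClosed_isBounded (isClosed_tsupport q) (Metric.isBounded_ball.subset hqs)
  have green := hv.integral_eq_zero h0 hq hqc ν
  set dq : Plane → ℝ := fun y => fderiv ℝ q y ν with hdq
  have hdqs : ContDiff ℝ ∞ dq := contDiff_fderiv_apply hq ν
  have hdqc : HasCompactSupport dq := hqc.fderiv_apply ℝ ν
  set d : Plane → ℝ := fun x => fderiv ℝ dq x ν with hd
  have hdc : ContDiff ℝ ∞ d := contDiff_fderiv_apply hdqs ν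
  have hds : HasCompactSupport d := hdqc.fderiv_apply ℝ ν
  obtain ⟨φ, c, B, hφ, hc, hφ0, hφ1, hφb, hφ2⟩ := hv.isC11.exists_smooth_approx
  obtain ⟨C, hC⟩ := hv.isC11.lip
  obtain ⟨c₀, hc₀⟩ := hc.bddAbove_range
  have hcle : ∀ k, c k ≤ c₀ := fun k => hc₀ ⟨k, rfl⟩
  obtain ⟨Bq, hBq⟩ := hqc.exists_bound_of_continuous hq.continuous
  obtain ⟨Bd, hBd⟩ := hds.exists_bound_of_continuous hdc.continuous
  obtain ⟨Be, hBe⟩ := hdqc.exists_bound_of_continuous hdqs.continuous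
  have hB0 : 0 ≤ B := (abs_nonneg _).trans (hφb 0 0 0 0)
  -- convergence of the volume terms
  have lim1 : Tendsto (fun k => ∫ x in Ω, d x * φ k x) atTop (𝓝 (∫ x in Ω, d x * F x)) := by
    refine tendsto_integral_of_dominated_convergence (fun x => |d x * F x| + Bd * c₀) (fun k =>
      (hdc.continuous.mul (hφ k).continuous).aestronglyMeasurable) ?_ (fun k =>
      Eventually.of_forall fun x => ?_) (Eventually.of_forall fun x => ?_)
    · refine Integrable.add (Integrable.abs (Integrable.restrict ?_)) (integrable_const _)
      exact (hdc.continuous.mul hv.isC11.contDiff.continuous).integrable_of_hasCompactSupport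
        hds.mul_right
    · have e : d x * φ k x = d x * F x + d x * (φ k x - F x) := by ring
      rw [e]
      refine (norm_add_le _ _).trans (add_le_add le_rfl ?_)
      rw [norm_mul]
      exact mul_le_mul (hBd x) ((hφ0 k x).trans (hcle k)) (norm_nonneg _)
        ((norm_nonneg _).trans (hBd x))
    · refine Tendsto.const_mul _ (tendsto_iff_dist_tendsto_zero.2 ?_)
      exact squeeze_zero (fun _ => dist_nonneg) (fun k => hφ0 k x) hc
  have lim2 : ∀ ij : Fin 2 × Fin 2, Tendsto (fun k => ∫ x in Ω, ν ij.1 * ν ij.2 * q x *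
      pd ij.2 (pd ij.1 (φ k)) x) atTop (𝓝 (∫ x in Ω, ν ij.1 * ν ij.2 * q x *
        lineDeriv ℝ (pd ij.1 F) x (coordVec ij.2))) := by
    intro ij
    refine tendsto_integral_of_dominated_convergence
      (fun _ => ‖ν ij.1 * ν ij.2‖ * Bq * (B + C)) (fun k => ?_) (integrable_const _) (fun k =>
      Eventually.of_forall fun x => ?_) ?_
    · exact ((continuous_const.mul hq.continuous).mul
        (contDiff_pd (contDiff_pd (hφ k) ij.1) ij.2).continuous).aestronglyMeasurable
    · rw [norm_mul, norm_mul]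
      have h1 := norm_lineDeriv_le_of_lipschitz ℝ (v := coordVec ij.2) (x₀ := x) (hC ij.1)
      have h2 := hφb k ij.1 ij.2 x
      have h3 : ‖pd ij.2 (pd ij.1 (φ k)) x‖ ≤ B + C := by
        have h4 := norm_add_le (pd ij.2 (pd ij.1 (φ k)) x - lineDeriv ℝ (pd ij.1 F) x
          (coordVec ij.2)) (lineDeriv ℝ (pd ij.1 F) x (coordVec ij.2))
        rw [sub_add_cancel] at h4
        simp only [PiLp.norm_single, norm_one, mul_one] at h1
        rw [← Real.norm_eq_abs] at h2
        linarith
      have hq0 : 0 ≤ Bq := (norm_nonneg _).trans (hBq x)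
      gcongr
      exact hBq x
    · filter_upwards [ae_restrict_of_ae (hφ2 ij.1 ij.2)] with x hx
      exact hx.const_mul _
  have lim := lim1.sub (tendsto_finsetSum Finset.univ fun ij _ => lim2 ij)
  rw [green] at lim
  -- the volume terms of the smooth approximations are boundary integrals
  have heq : ∀ k, (∫ x in Ω, d x * φ k x) - ∑ ij : Fin 2 × Fin 2, ∫ x in Ω,
      ν ij.1 * ν ij.2 * q x * pd ij.2 (pd ij.1 (φ k)) x =
      ∫ a, (dq (chartPt R a (f a)) * φ k (chartPt R a (f a)) -
        q (chartPt R a (f a)) * fderiv ℝ (φ k) (chartPt R a (f a)) ν) := by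
    intro k
    have hdφ := contDiff_fderiv_apply (hφ k) ν
    let G : Plane → ℝ := fun y => dq y * φ k y - q y * fderiv ℝ (φ k) y ν
    have hG : ContDiff ℝ ∞ G := (hdqs.mul (hφ k)).sub (hq.mul hdφ)
    have hGs : tsupport G ⊆ Metric.ball x r := by
      refine Subset.trans (closure_minimal (fun y hy => ?_) (isClosed_tsupport q)) hqs
      by_contra hn
      have h1 : q y = 0 := image_eq_zero_of_notMem_tsupport hn
      have h2 : dq y = 0 := image_eq_zero_of_notMem_tsupport fun h =>
        hn (tsupport_fderiv_apply_subset ℝ ν h)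
      exact hy (by simp [G, h1, h2])
    have e := hR.setIntegral_fderiv_eq hΩ (hG.of_le (by simp)) hGs
    refine Eq.trans ?_ e
    rw [← integral_finsetSum, ← integral_sub]
    · refine integral_congr_ae (Eventually.of_forall fun y => ?_)
      have d1 : DifferentiableAt ℝ dq y := hdqs.differentiable (by simp) y
      have d2 : DifferentiableAt ℝ (φ k) y := (hφ k).differentiable (by simp) y
      have d3 : DifferentiableAt ℝ q y := hq.differentiable (by simp) y
      have d4 : DifferentiableAt ℝ (fun y => fderiv ℝ (φ k) y ν) y :=
        hdφ.differentiable (by simp) y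
      have e1 : ∑ ij : Fin 2 × Fin 2, ν ij.1 * ν ij.2 * q y * pd ij.2 (pd ij.1 (φ k)) y =
          q y * fderiv ℝ (fun y => fderiv ℝ (φ k) y ν) y ν := by
        rw [fderiv_fderiv_apply (hφ k), Finset.mul_sum]
        exact Finset.sum_congr rfl fun ij _ => by ring
      have e2 : fderiv ℝ G y = (dq y • fderiv ℝ (φ k) y + φ k y • fderiv ℝ dq y) -
          (q y • fderiv ℝ (fun y => fderiv ℝ (φ k) y ν) y +
            (fderiv ℝ (φ k) y ν) • fderiv ℝ q y) := by
        exact ((d1.hasFDerivAt.mul d2.hasFDerivAt).sub (d3.hasFDerivAt.mul d4.hasFDerivAt)).fderiv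
      change _ = fderiv ℝ G y ν
      simp only [e1, e2]
      simp only [sub_apply, add_apply,
        smul_apply, smul_eq_mul, hd, hdq]
      ring
    · exact ((hdc.continuous.mul (hφ k).continuous).integrable_of_hasCompactSupport
        hds.mul_right).restrict
    · refine integrable_finsetSum _ fun ij _ => Integrable.restrict ?_
      exact ((continuous_const.mul hq.continuous).mul
        (contDiff_pd (contDiff_pd (hφ k) ij.1) ij.2).continuous).integrable_of_hasCompactSupport
        (hqc.mul_left).mul_right
    · intro ij _
      exact (((continuous_const.mul hq.continuous).mul
        (contDiff_pd (contDiff_pd (hφ k) ij.1) ij.2).continuous).integrable_of_hasCompactSupport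
        (hqc.mul_left).mul_right).restrict
  simp only [heq] at lim
  refine tendsto_nhds_unique ?_ lim
  -- convergence of the boundary integrals
  have hpath : Continuous fun a => chartPt R a (f a) :=
    (continuous_chartPt R).comp (continuous_id.prodMk hR.lip.continuous)
  have hν1 : ∀ i, |ν i| ≤ 1 := fun i => by
    have := PiLp.norm_apply_le ν i
    rwa [hν, LinearIsometryEquiv.norm_map, PiLp.norm_single, norm_one] at this
  have hder : ∀ k y, |fderiv ℝ (φ k) y ν - fderiv ℝ F y ν| ≤ 2 * c k := by
    intro k y
    rw [fderiv_apply_eq_sum_pd, fderiv_apply_eq_sum_pd, ← Finset.sum_sub_distrib]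
    refine (Finset.abs_sum_le_sum_abs _ _).trans ?_
    calc _ ≤ ∑ _i : Fin 2, c k := Finset.sum_le_sum fun i _ => by
            rw [← mul_sub, abs_mul]
            have := mul_le_mul (hν1 i) (hφ1 k i y) (abs_nonneg _) zero_le_one
            rwa [one_mul] at this
      _ = 2 * c k := by simp
  have hFd : Continuous fun y => fderiv ℝ F y ν :=
    (hv.isC11.contDiff.continuous_fderiv one_ne_zero).clm_apply continuous_const
  set I : Set ℝ := Metric.closedBall (R x 0) r with hI
  have hout : ∀ a ∉ I, chartPt R a (f a) ∉ tsupport q := by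
    intro a ha hmem
    have := abs_apply_sub_le R (chartPt R a (f a)) x 0
    rw [chartPt_zero] at this
    exact ha (Metric.mem_closedBall.2 (this.trans (Metric.mem_ball.1 (hqs hmem)).le))
  have hq0 : ∀ a ∉ I, q (chartPt R a (f a)) = 0 := fun a ha =>
    image_eq_zero_of_notMem_tsupport (hout a ha)
  have hdq0 : ∀ a ∉ I, dq (chartPt R a (f a)) = 0 := fun a ha =>
    image_eq_zero_of_notMem_tsupport fun h => hout a ha (tsupport_fderiv_apply_subset ℝ ν h)
  have hset : ∀ g k : ℝ → ℝ, ∫ a, (dq (chartPt R a (f a)) * g a - q (chartPt R a (f a)) * k a) =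
      ∫ a in I, (dq (chartPt R a (f a)) * g a - q (chartPt R a (f a)) * k a) := fun g k =>
    (setIntegral_eq_integral_of_forall_compl_eq_zero fun a ha => by
      rw [hq0 a ha, hdq0 a ha]; ring).symm
  change Tendsto _ _ (𝓝 (∫ a, (dq (chartPt R a (f a)) * F (chartPt R a (f a)) -
    q (chartPt R a (f a)) * fderiv ℝ F (chartPt R a (f a)) ν)))
  simp only [hset]
  have hfin : IsFiniteMeasure (volume.restrict I) :=
    ⟨by simpa using (isCompact_closedBall (R x 0) r).measure_lt_top⟩
  have hlimc : Continuous fun a => dq (chartPt R a (f a)) * F (chartPt R a (f a)) -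
      q (chartPt R a (f a)) * fderiv ℝ F (chartPt R a (f a)) ν :=
    ((hdqs.continuous.comp hpath).mul (hv.isC11.contDiff.continuous.comp hpath)).sub
      ((hq.continuous.comp hpath).mul (hFd.comp hpath))
  refine tendsto_integral_of_dominated_convergence (fun a =>
    |dq (chartPt R a (f a)) * F (chartPt R a (f a)) -
      q (chartPt R a (f a)) * fderiv ℝ F (chartPt R a (f a)) ν| + (Be * c₀ + Bq * (2 * c₀)))
    (fun k => ?_) ?_ (fun k => Eventually.of_forall fun a => ?_) (Eventually.of_forall fun a => ?_)
  · exact (((hdqs.continuous.comp hpath).mul ((hφ k).continuous.comp hpath)).sub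
      ((hq.continuous.comp hpath).mul
        ((contDiff_fderiv_apply (hφ k) ν).continuous.comp hpath))).aestronglyMeasurable
  · refine Integrable.add (Integrable.abs ?_) (integrable_const _)
    exact hlimc.continuousOn.integrableOn_compact (isCompact_closedBall _ _)
  · set y := chartPt R a (f a)
    have e : dq y * φ k y - q y * fderiv ℝ (φ k) y ν = (dq y * F y - q y * fderiv ℝ F y ν) +
        (dq y * (φ k y - F y) - q y * (fderiv ℝ (φ k) y ν - fderiv ℝ F y ν)) := by ring
    rw [e]
    refine (norm_add_le _ _).trans (add_le_add le_rfl ((norm_sub_le _ _).trans ?_))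
    rw [norm_mul, norm_mul]
    refine add_le_add ?_ ?_
    · exact mul_le_mul (hBe y) ((hφ0 k y).trans (hcle k)) (norm_nonneg _)
        ((norm_nonneg _).trans (hBe y))
    · refine mul_le_mul (hBq y) ((hder k y).trans ?_) (norm_nonneg _)
        ((norm_nonneg _).trans (hBq y))
      linarith [hcle k]
  · refine Tendsto.sub (Tendsto.const_mul _ ?_) (Tendsto.const_mul _ ?_)
    · refine tendsto_iff_dist_tendsto_zero.2 ?_
      exact squeeze_zero (fun _ => dist_nonneg) (fun k => hφ0 k _) hc
    · refine tendsto_iff_dist_tendsto_zero.2 ?_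
      exact squeeze_zero (fun _ => dist_nonneg) (fun k => hder k _) (by simpa using hc.const_mul 2)

/-- Localization of the boundary identity: it is tested with products of a bump function in the
horizontal and a profile `ρ` in the vertical chart coordinate; the former is arbitrary, so that the
integrand vanishes pointwise. -/
lemma IsRep.boundary_value_eq_zero {Ω : Set Plane} (hΩ : IsOpen Ω)
    (hb : Bornology.IsBounded Ω) {v : H2 Ω} {F : Plane → ℝ}
    (hv : IsRep v F) (h0 : trGg Ω v = 0) {x : Plane} (hx : x ∈ frontier Ω)
    {R : Plane ≃ₗᵢ[ℝ] Plane} {r : ℝ} {K : NNReal} {f : ℝ → ℝ} (hR : IsChart Ω x R r K f)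
    {ρ : ℝ → ℝ} (hρ : ContDiff ℝ ∞ ρ) (hρs : tsupport ρ ⊆ Metric.ball (R x 1) (r / 2)) :
    deriv ρ (R x 1) * F x - ρ (R x 1) * fderiv ℝ F x (R.symm (coordVec 1)) = 0 := by
  set ν := R.symm (coordVec 1) with hν
  have hpath : Continuous fun a => chartPt R a (f a) :=
    (continuous_chartPt R).comp (continuous_id.prodMk hR.lip.continuous)
  have hFd : Continuous fun y => fderiv ℝ F y ν :=
    (hv.isC11.contDiff.continuous_fderiv one_ne_zero).clm_apply continuous_const
  let b : ℝ → ℝ := fun a => deriv ρ (f a) * F (chartPt R a (f a)) -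
    ρ (f a) * fderiv ℝ F (chartPt R a (f a)) ν
  have hbc : Continuous b :=
    (((hρ.continuous_deriv (by simp)).comp hR.lip.continuous).mul
      (hv.isC11.contDiff.continuous.comp hpath)).sub
      ((hρ.continuous.comp hR.lip.continuous).mul (hFd.comp hpath))
  have hc : ∀ i, ContDiff ℝ ∞ fun y => R y i := fun i =>
    (contDiff_euclidean.1 R.contDiff) i
  have key : ∀ η : ℝ → ℝ, ContDiff ℝ ∞ η → HasCompactSupport η →
      tsupport η ⊆ Metric.ball (R x 0) (r / 2) → ∫ a, η a • b a = 0 := by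
    intro η hη _ hηs
    let q : Plane → ℝ := fun y => η (R y 0) * ρ (R y 1)
    have hq : ContDiff ℝ ∞ q := (hη.comp (hc 0)).mul (hρ.comp (hc 1))
    have hqs : tsupport q ⊆ Metric.ball x r := by
      have hcl : IsClosed {y : Plane | R y 0 ∈ tsupport η ∧ R y 1 ∈ tsupport ρ} :=
        ((isClosed_tsupport η).preimage (hc 0).continuous).inter
          ((isClosed_tsupport ρ).preimage (hc 1).continuous)
      intro y hy
      have h1 : R y 0 ∈ tsupport η ∧ R y 1 ∈ tsupport ρ := by
        refine closure_minimal (t := {y : Plane | R y 0 ∈ tsupport η ∧ R y 1 ∈ tsupport ρ})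
          (fun z hz => ?_) hcl hy
        have hz' : η (R z 0) * ρ (R z 1) ≠ 0 := hz
        exact ⟨subset_tsupport _ (left_ne_zero_of_mul hz'),
          subset_tsupport _ (right_ne_zero_of_mul hz')⟩
      have h2 := Metric.mem_ball.1 (hηs h1.1)
      have h3 := Metric.mem_ball.1 (hρs h1.2)
      have h4 := dist_chartPt_le R (R y 0) (R y 1) (R x 0) (R x 1)
      rw [chartPt_eq, chartPt_eq] at h4
      rw [Real.dist_eq] at h2 h3
      rw [Metric.mem_ball]
      linarith
    have h1 := hv.integral_boundary_eq_zero hΩ hb h0 hR hq hqs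
    rw [← h1]
    refine integral_congr_ae (Eventually.of_forall fun a => ?_)
    have hdq : fderiv ℝ q (chartPt R a (f a)) ν = η a * deriv ρ (f a) := by
      have hline : HasDerivAt (fun t : ℝ => q (chartPt R a (f a) + t • ν)) (η a * deriv ρ (f a))
          0 := by
        have e : (fun t : ℝ => q (chartPt R a (f a) + t • ν)) = fun t => η a * ρ (f a + t) := by
          funext t
          simp only [q, hν, chartPt_add_smul, chartPt_zero, chartPt_one]
        rw [e]
        refine HasDerivAt.const_mul _ ?_
        have h3 : HasDerivAt ρ (deriv ρ (f a + 0)) (f a + 0) :=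
          (hρ.differentiable (by simp) _).hasDerivAt
        have h4 := h3.comp_const_add (f a) 0
        simpa using h4
      have h5 : lineDeriv ℝ q (chartPt R a (f a)) ν = η a * deriv ρ (f a) := hline.deriv
      rw [← h5, (hq.differentiable (by simp) _).lineDeriv_eq_fderiv]
    simp only [← hν, hdq]
    simp only [q, chartPt_zero, chartPt_one, b, smul_eq_mul]
    ring
  have hae := Metric.isOpen_ball.ae_eq_zero_of_integral_contDiff_smul_eq_zero (μ := volume)
    (U := Metric.ball (R x 0) (r / 2)) (hbc.locallyIntegrable.locallyIntegrableOn _) key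
  have heq : EqOn b 0 (Metric.ball (R x 0) (r / 2)) :=
    Measure.eqOn_open_of_ae_eq (μ := volume) ((ae_restrict_iff' measurableSet_ball).2 hae)
      Metric.isOpen_ball hbc.continuousOn continuousOn_const
  have h1 := heq (Metric.mem_ball_self (half_pos hR.pos))
  have h2 := (hR.frontier_iff hΩ (Metric.mem_ball_self hR.pos)).1 hx
  simp only [b, ← h2, chartPt_eq] at h1
  exact h1

/-- A `C^{1,1}` function with vanishing trace vanishes on the boundary, together with its
gradient. -/
theorem IsRep.vanish_on_frontier {Ω : Set Plane} (hΩ : IsOpen Ω)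
    (hb : Bornology.IsBounded Ω) (hl : IsLipschitzSet Ω) {v : H2 Ω} {F : Plane → ℝ}
    (hv : IsRep v F) (h0 : trGg Ω v = 0) {x : Plane} (hx : x ∈ frontier Ω) :
    F x = 0 ∧ fderiv ℝ F x = 0 := by
  have bump : ∀ (c r : ℝ), 0 < r → ∃ χ : ContDiffBump c, χ.rOut < r := fun c r hr =>
    ⟨⟨r / 4, r / 2, by linarith, by linarith⟩, by simp only; linarith⟩
  have hval : ∀ x ∈ frontier Ω, F x = 0 := by
    -- a profile with value `0` and derivative `1` at the height of `x`
    intro x hx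
    obtain ⟨R, r, K, f, hR⟩ := hl.exists_isChart hx
    obtain ⟨χ, hχ⟩ := bump (R x 1) (r / 2) (half_pos hR.pos)
    have hχs : tsupport χ ⊆ Metric.ball (R x 1) (r / 2) := by
      rw [χ.tsupport_eq]
      exact Metric.closedBall_subset_ball hχ
    have h := hv.boundary_value_eq_zero hΩ hb h0 hx hR (ρ := fun t => (t - R x 1) * χ t)
      ((contDiff_id.sub contDiff_const).mul χ.contDiff)
      ((tsupport_mul_subset_right (f := fun t => t - R x 1) (g := χ)).trans hχs)
    have hd : HasDerivAt (fun t => (t - R x 1) * χ t) 1 (R x 1) := by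
      have h1 : HasDerivAt (fun t => t - R x 1) 1 (R x 1) := (hasDerivAt_id _).sub_const _
      have h2 : HasDerivAt χ (deriv χ (R x 1)) (R x 1) :=
        ((χ.contDiff (n := 1)).differentiable one_ne_zero _).hasDerivAt
      have h3 := h1.mul h2
      have h4 : χ (R x 1) = 1 := χ.one_of_mem_closedBall (Metric.mem_closedBall_self χ.rIn_pos.le)
      rw [h4, sub_self, zero_mul, add_zero, one_mul] at h3
      exact h3
    rw [hd.deriv] at h
    simpa using h
  refine ⟨hval x hx, ?_⟩
  obtain ⟨R, r, K, f, hR⟩ := hl.exists_isChart hx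
  have hvert : fderiv ℝ F x (R.symm (coordVec 1)) = 0 := by
    -- a profile with value `1` at the height of `x`
    obtain ⟨χ, hχ⟩ := bump (R x 1) (r / 2) (half_pos hR.pos)
    have hχs : tsupport χ ⊆ Metric.ball (R x 1) (r / 2) := by
      rw [χ.tsupport_eq]
      exact Metric.closedBall_subset_ball hχ
    have h := hv.boundary_value_eq_zero hΩ hb h0 hx hR (ρ := χ) χ.contDiff hχs
    have h4 : χ (R x 1) = 1 := χ.one_of_mem_closedBall (Metric.mem_closedBall_self χ.rIn_pos.le)
    rw [hval x hx, h4] at h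
    simpa using h
  have hfx := (hR.frontier_iff hΩ (Metric.mem_ball_self hR.pos)).1 hx
  -- `F` vanishes along the graph, so the derivative in the horizontal direction vanishes, too
  have hhor : fderiv ℝ F x (R.symm (coordVec 0)) = 0 := by
    set l := fderiv ℝ F x (R.symm (coordVec 0)) with hl'
    set p : ℝ → Plane := fun a => chartPt R a (f a) with hp
    have hpath : Continuous p :=
      (continuous_chartPt R).comp (continuous_id.prodMk hR.lip.continuous)
    have hpx : p (R x 0) = x := by rw [hp, ← chartPt_eq R x]; simp [← hfx]
    have hpt : Tendsto p (𝓝 (R x 0)) (𝓝 x) := by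
      have := hpath.tendsto (R x 0)
      rwa [hpx] at this
    have hF := (hv.isC11.differentiable x).hasFDerivAt.isLittleO
    have hF2 := hF.comp_tendsto hpt
    have hO : (fun a => p a - x) =O[𝓝 (R x 0)] fun a => a - R x 0 := by
      refine Asymptotics.IsBigO.of_bound (1 + K) (Eventually.of_forall fun a => ?_)
      have h1 := dist_chartPt_le R a (f a) (R x 0) (f (R x 0))
      have h2 := hR.lip.dist_le_mul a (R x 0)
      rw [Real.dist_eq, Real.dist_eq] at h2
      have h3 : chartPt R (R x 0) (f (R x 0)) = x := hpx
      rw [h3, dist_eq_norm] at h1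
      rw [Real.norm_eq_abs]
      change ‖chartPt R a (f a) - x‖ ≤ _
      linarith
    have hF3 : (fun a => F (p a) - F x - fderiv ℝ F x (p a - x)) =o[𝓝 (R x 0)]
        fun a => a - R x 0 := hF2.trans_isBigO hO
    have hF4 : (fun a => l * (a - R x 0)) =o[𝓝 (R x 0)] fun a => a - R x 0 := by
      refine (hF3.neg_left).congr' ?_ EventuallyEq.rfl
      filter_upwards [hpt.eventually_mem (Metric.ball_mem_nhds x hR.pos)] with a ha
      have h1 : p a ∈ frontier Ω := by
        rw [hR.frontier_iff hΩ ha]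
        simp [hp]
      have h2 : p a - x = (a - R x 0) • R.symm (coordVec 0) +
          (f a - f (R x 0)) • R.symm (coordVec 1) := by
        conv_lhs => rw [← hpx]
        exact chartPt_sub R _ _ _ _
      rw [hval x hx, hval _ h1, h2, map_add, map_smul, map_smul, hvert, ← hl']
      simp
      ring
    by_contra hne
    have h5 : (fun a => a - R x 0) =o[𝓝 (R x 0)] fun a => a - R x 0 :=
      (Asymptotics.isLittleO_const_mul_left_iff hne).1 hF4
    have h6 : (fun t : ℝ => t) =o[𝓝 0] fun t : ℝ => t := by
      have ht : Tendsto (fun t : ℝ => t + R x 0) (𝓝 0) (𝓝 (R x 0)) := by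
        have : Continuous fun t : ℝ => t + R x 0 := by fun_prop
        simpa using this.tendsto 0
      simpa [Function.comp_def] using h5.comp_tendsto ht
    have h7 := h6.def (c := 1 / 2) (by norm_num)
    obtain ⟨ε, hε, h8⟩ := Metric.eventually_nhds_iff.1 h7
    have h9 := h8 (y := ε / 2) (by rw [dist_zero_right, Real.norm_eq_abs, abs_of_pos] <;> linarith)
    rw [Real.norm_eq_abs, abs_of_pos (by linarith)] at h9
    linarith
  ext w
  have hw : w = (R w 0) • R.symm (coordVec 0) + (R w 1) • R.symm (coordVec 1) := by
    rw [← map_smul, ← map_smul, ← map_add, LinearIsometryEquiv.eq_symm_apply]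
    ext i
    fin_cases i <;> simp
  rw [hw, map_add, map_smul, map_smul, hvert, hhor]
  simp

/-! ### Geometry of the mesh: every node has exactly two half-edges -/

namespace BoundaryMesh

variable {Ω : Set Plane} {ι : Type*} (M : BoundaryMesh Ω ι)

/-- A half-edge is an edge together with one of its end points (`false` for the initial, `true` for
the final one); `M.halfEdge h` runs through the edge, starting from that end point. -/
noncomputable def halfEdge (h : ι × Bool) (s : ℝ) : Plane :=
  M.γ h.1 (if h.2 then 1 - s else s)

lemma param_mem {b : Bool} {s : ℝ} (hs : s ∈ Icc (0 : ℝ) 1) :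
    (if b then 1 - s else s) ∈ Icc (0 : ℝ) 1 := by
  cases b <;> simp_all

lemma halfEdge_image (h : ι × Bool) : M.halfEdge h '' Icc 0 1 = M.γ h.1 '' Icc 0 1 := by
  obtain ⟨e, b⟩ := h
  apply Subset.antisymm
  · rintro _ ⟨s, hs, rfl⟩
    exact ⟨_, param_mem hs, rfl⟩
  · rintro _ ⟨s, hs, rfl⟩
    refine ⟨_, param_mem (b := b) hs, ?_⟩
    cases b <;> simp [halfEdge]

lemma continuousOn_halfEdge (h : ι × Bool) : ContinuousOn (M.halfEdge h) (Icc 0 1) := by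
  have hc : ∀ b : Bool, Continuous fun s : ℝ => if b then 1 - s else s := by
    intro b
    cases b
    · simpa using continuous_id'
    · simpa using continuous_sub_left (1 : ℝ)
  exact (M.smooth h.1).continuousOn.comp (hc h.2).continuousOn fun s hs => param_mem hs

lemma injOn_halfEdge (h : ι × Bool) : InjOn (M.halfEdge h) (Icc 0 1) := by
  intro s hs t ht hst
  have := M.inj h.1 (param_mem hs) (param_mem ht) hst
  cases hb : h.2 <;> simpa [hb] using this

lemma halfEdge_mem (h : ι × Bool) {s : ℝ} (hs : s ∈ Icc (0 : ℝ) 1) :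
    M.halfEdge h s ∈ frontier Ω :=
  M.γ_mem h.1 (param_mem hs)

lemma isCompact_edge (e : ι) : IsCompact (M.γ e '' Icc 0 1) :=
  isCompact_Icc.image_of_continuousOn (M.smooth e).continuousOn

/-- The first halves of two distinct half-edges meet at most in their starting points. -/
lemma eq_of_halfEdge_eq {h h' : ι × Bool} {s s' : ℝ} (hs : s ∈ Ioo (0 : ℝ) (1 / 2))
    (hs' : s' ∈ Ico (0 : ℝ) (1 / 2)) (heq : M.halfEdge h s = M.halfEdge h' s') : h = h' := by
  obtain ⟨e, b⟩ := h
  obtain ⟨e', b'⟩ := h'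
  have m1 : (if b then 1 - s else s) ∈ Ioo (0 : ℝ) 1 := by
    have := hs.1
    have := hs.2
    cases b <;> simp <;> constructor <;> linarith
  have m2 : (if b' then 1 - s' else s') ∈ Icc (0 : ℝ) 1 :=
    param_mem ⟨hs'.1, by linarith [hs'.2]⟩
  have he : e = e' := by
    by_contra hne
    exact disjoint_left.1 (M.disj e e' hne) ⟨_, m1, rfl⟩ ⟨_, m2, heq.symm⟩
  subst he
  have := M.inj e (Ioo_subset_Icc_self m1) m2 heq
  have h1 := hs.2
  have h2 := hs'.2
  cases b <;> cases b' <;> simp at this ⊢ <;> linarith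

/-- Near its starting point `z`, the half-edge `h` lies on the side `ε = ±1` of `z`, with respect to
the horizontal coordinate of the chart `R`. -/
def OnSide (R : Plane ≃ₗᵢ[ℝ] Plane) (z : Plane) (h : ι × Bool) (ε : ℝ) : Prop :=
  ∀ᶠ s in 𝓝[>] (0 : ℝ), 0 < ε * (R (M.halfEdge h s) 0 - R z 0)

lemma continuous_coord (R : Plane ≃ₗᵢ[ℝ] Plane) (i : Fin 2) : Continuous fun y => R y i :=
  (PiLp.continuous_apply 2 _ i).comp R.continuous

lemma exists_lt_half_of_eventually {p : ℝ → Prop} (h : ∀ᶠ s in 𝓝[>] (0 : ℝ), p s) :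
    ∃ δ ∈ Ioo (0 : ℝ) (1 / 2), ∀ s ∈ Ioc 0 δ, p s := by
  obtain ⟨u, hu, hu'⟩ := mem_nhdsGT_iff_exists_Ioo_subset.1 h
  have hu0 : (0 : ℝ) < u := hu
  refine ⟨min (u / 2) (1 / 4), ⟨by positivity, (min_le_right _ _).trans_lt (by norm_num)⟩,
    fun s hs => hu' ⟨hs.1, ?_⟩⟩
  exact (hs.2.trans (min_le_left _ _)).trans_lt (by linarith)

lemma tendsto_halfEdge (h : ι × Bool) :
    Tendsto (M.halfEdge h) (𝓝[>] 0) (𝓝 (M.halfEdge h 0)) := by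
  have := M.continuousOn_halfEdge h 0 (left_mem_Icc.2 zero_le_one)
  exact this.tendsto.mono_left (nhdsWithin_le_of_mem (Icc_mem_nhdsGT one_pos))

variable {M} {R : Plane ≃ₗᵢ[ℝ] Plane} {r : ℝ} {K : NNReal} {f : ℝ → ℝ} {z : Plane}

lemma OnSide.not_neg {h : ι × Bool} {ε : ℝ} (h1 : M.OnSide R z h ε) : ¬ M.OnSide R z h (-ε) := by
  intro h2
  obtain ⟨s, hs1, hs2⟩ := (h1.and h2).exists
  linarith

/-- Close to its starting point, the horizontal chart coordinate of a half-edge does not return to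
its initial value, since the path is injective; so it has a constant sign. -/
lemma exists_onSide (hΩ : IsOpen Ω) (hR : IsChart Ω z R r K f) {h : ι × Bool}
    (hz : M.halfEdge h 0 = z) : M.OnSide R z h 1 ∨ M.OnSide R z h (-1) := by
  have hball : ∀ᶠ s in 𝓝[>] (0 : ℝ), M.halfEdge h s ∈ Metric.ball z r :=
    (M.tendsto_halfEdge h).eventually_mem (hz ▸ Metric.ball_mem_nhds _ hR.pos)
  obtain ⟨δ, hδ, hδb⟩ := exists_lt_half_of_eventually hball
  have hmem : ∀ s ∈ Ioc (0 : ℝ) δ, s ∈ Icc (0 : ℝ) 1 := fun s hs =>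
    ⟨hs.1.le, by linarith [hs.2, hδ.2]⟩
  set c : ℝ → ℝ := fun s => R (M.halfEdge h s) 0 - R z 0 with hc
  have hcc : ContinuousOn c (Ioc 0 δ) :=
    (((continuous_coord R 0).comp_continuousOn (M.continuousOn_halfEdge h)).sub
      continuousOn_const).mono hmem
  have hzf : z ∈ frontier Ω := hz ▸ M.halfEdge_mem h (left_mem_Icc.2 zero_le_one)
  have hne : ∀ s ∈ Ioc (0 : ℝ) δ, c s ≠ 0 := by
    intro s hs h0
    have h1 := hR.dist_le hΩ (hδb s hs) (Metric.mem_ball_self hR.pos)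
      (M.halfEdge_mem h (hmem s hs)) hzf
    rw [show R (M.halfEdge h s) 0 - R z 0 = 0 from h0, abs_zero, mul_zero] at h1
    have h2 := dist_le_zero.1 h1
    have := M.injOn_halfEdge h (hmem s hs) (left_mem_Icc.2 zero_le_one) (h2.trans hz.symm)
    exact hs.1.ne' this
  have hIoc : Ioc (0 : ℝ) δ ∈ 𝓝[>] (0 : ℝ) := Ioc_mem_nhdsGT hδ.1
  by_cases hall : ∀ s ∈ Ioc (0 : ℝ) δ, 0 < c s
  · left
    filter_upwards [hIoc] with s hs
    rw [one_mul]
    exact hall s hs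
  · right
    push Not at hall
    obtain ⟨t, ht, htc⟩ := hall
    filter_upwards [hIoc] with s hs
    by_contra hcon
    have h1 : 0 ≤ c s := by simp only [hc]; linarith
    obtain ⟨u, hu, hu0⟩ := isPreconnected_Ioc.intermediate_value ht hs hcc ⟨htc, h1⟩
    exact hne u hu hu0

/-- By the intermediate value theorem, two half-edges on the same side of `z` meet. -/
lemma OnSide.eq (hΩ : IsOpen Ω) (hR : IsChart Ω z R r K f) {h h' : ι × Bool} {ε : ℝ}
    (hz : M.halfEdge h 0 = z) (hz' : M.halfEdge h' 0 = z) (h1 : M.OnSide R z h ε)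
    (h2 : M.OnSide R z h' ε) : h = h' := by
  have hball : ∀ {g : ι × Bool}, M.halfEdge g 0 = z →
      ∀ᶠ s in 𝓝[>] (0 : ℝ), M.halfEdge g s ∈ Metric.ball z r := fun {g} hg =>
    (M.tendsto_halfEdge g).eventually_mem (hg ▸ Metric.ball_mem_nhds _ hR.pos)
  obtain ⟨δ, hδ, hall⟩ := exists_lt_half_of_eventually
    ((h1.and h2).and ((hball hz).and (hball hz')))
  have key : ∀ {g g' : ι × Bool}, M.halfEdge g' 0 = z →
      (∀ s ∈ Ioc (0 : ℝ) δ, 0 < ε * (R (M.halfEdge g s) 0 - R z 0) ∧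
        M.halfEdge g s ∈ Metric.ball z r) →
      (∀ s ∈ Ioc (0 : ℝ) δ, 0 < ε * (R (M.halfEdge g' s) 0 - R z 0) ∧
        M.halfEdge g' s ∈ Metric.ball z r) →
      ε * (R (M.halfEdge g δ) 0 - R z 0) ≤ ε * (R (M.halfEdge g' δ) 0 - R z 0) → g = g' := by
    intro g g' hg' hs hs' hle
    have hδm : δ ∈ Ioc (0 : ℝ) δ := ⟨hδ.1, le_rfl⟩
    have hmem : Icc (0 : ℝ) δ ⊆ Icc 0 1 := Icc_subset_Icc_right (by linarith [hδ.2])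
    have hc : ContinuousOn (fun s => ε * (R (M.halfEdge g' s) 0 - R z 0)) (Icc 0 δ) :=
      (continuousOn_const.mul (((continuous_coord R 0).comp_continuousOn
        (M.continuousOn_halfEdge g')).sub continuousOn_const)).mono hmem
    have hpos := (hs δ hδm).1
    obtain ⟨t, ht, hte⟩ := intermediate_value_Icc hδ.1.le hc
      (show ε * (R (M.halfEdge g δ) 0 - R z 0) ∈ Icc _ _ from
        ⟨by simp only [hg', sub_self, mul_zero]; exact hpos.le, hle⟩)
    have hte' : ε * (R (M.halfEdge g' t) 0 - R z 0) = ε * (R (M.halfEdge g δ) 0 - R z 0) := hte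
    have ht0 : t ≠ 0 := by
      rintro rfl
      rw [hg', sub_self, mul_zero] at hte'
      linarith
    have htm : t ∈ Ioc (0 : ℝ) δ := ⟨lt_of_le_of_ne ht.1 (Ne.symm ht0), ht.2⟩
    have hε : ε ≠ 0 := by
      rintro rfl
      simp at hpos
    have hco : R (M.halfEdge g δ) 0 - R (M.halfEdge g' t) 0 = 0 := by
      have := mul_left_cancel₀ hε hte'
      linarith
    have hd := hR.dist_le hΩ (hs δ hδm).2 (hs' t htm).2
      (M.halfEdge_mem g (hmem (right_mem_Icc.2 hδ.1.le))) (M.halfEdge_mem g' (hmem ht))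
    rw [hco, abs_zero, mul_zero] at hd
    exact M.eq_of_halfEdge_eq ⟨hδ.1, hδ.2⟩ ⟨ht.1, ht.2.trans_lt hδ.2⟩ (dist_le_zero.1 hd)
  rcases le_total (ε * (R (M.halfEdge h δ) 0 - R z 0)) (ε * (R (M.halfEdge h' δ) 0 - R z 0))
    with hle | hle
  · exact key hz' (fun s hs => ⟨(hall s hs).1.1, (hall s hs).2.1⟩)
      (fun s hs => ⟨(hall s hs).1.2, (hall s hs).2.2⟩) hle
  · exact (key hz (fun s hs => ⟨(hall s hs).1.2, (hall s hs).2.2⟩)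
      (fun s hs => ⟨(hall s hs).1.1, (hall s hs).2.1⟩) hle).symm

/-- The side of a half-edge can be read off from the points of the edge close to `z`, whatever their
parameters are. -/
lemma OnSide.eventually {h : ι × Bool} {ε : ℝ} (hz : M.halfEdge h 0 = z)
    (h1 : M.OnSide R z h ε) :
    ∀ᶠ x in 𝓝 z, x ∈ M.γ h.1 '' Icc 0 1 → x ≠ z → 0 < ε * (R x 0 - R z 0) := by
  obtain ⟨δ, hδ, hall⟩ := exists_lt_half_of_eventually h1
  have hsub : Icc δ 1 ⊆ Icc (0 : ℝ) 1 := Icc_subset_Icc_left hδ.1.le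
  have hcl : IsClosed (M.halfEdge h '' Icc δ 1) :=
    (isCompact_Icc.image_of_continuousOn ((M.continuousOn_halfEdge h).mono hsub)).isClosed
  have hzn : z ∉ M.halfEdge h '' Icc δ 1 := by
    rintro ⟨s, hs, hsz⟩
    have := M.injOn_halfEdge h (hsub hs) (left_mem_Icc.2 zero_le_one) (hsz.trans hz.symm)
    linarith [hs.1, hδ.1]
  filter_upwards [hcl.isOpen_compl.mem_nhds hzn] with x hx hxe hxz
  rw [← M.halfEdge_image h] at hxe
  obtain ⟨s, hs, rfl⟩ := hxe
  refine hall s ⟨lt_of_le_of_ne hs.1 ?_, ?_⟩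
  · rintro rfl
    exact hxz hz
  · by_contra hcon
    exact hx ⟨s, ⟨(not_le.1 hcon).le, hs.2⟩, rfl⟩

variable (M)

lemma halfEdge_zero_mem_nodes (h : ι × Bool) : M.halfEdge h 0 ∈ M.nodes := by
  refine ⟨h.1, ?_⟩
  cases hb : h.2 <;> simp [halfEdge, hb]

lemma nodes_subset : M.nodes ⊆ frontier Ω := by
  rintro z ⟨e, rfl | rfl⟩
  · exact M.γ_mem e (left_mem_Icc.2 zero_le_one)
  · exact M.γ_mem e (right_mem_Icc.2 zero_le_one)

/-- A point of an edge which is a node or lies on another edge is the starting point of a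
half-edge. -/
lemma exists_halfEdge_of_mem {e : ι} (hz : z ∈ M.γ e '' Icc 0 1)
    (h : z ∈ M.nodes ∨ ∃ e', e ≠ e' ∧ z ∈ M.γ e' '' Icc 0 1) :
    ∃ b, M.halfEdge (e, b) 0 = z := by
  obtain ⟨s, hs, rfl⟩ := hz
  rcases eq_or_lt_of_le hs.1 with h0 | h0
  · exact ⟨false, by simp [halfEdge, ← h0]⟩
  rcases eq_or_lt_of_le hs.2 with h1 | h1
  · exact ⟨true, by simp [halfEdge, h1]⟩
  exfalso
  have hopen : M.γ e s ∈ M.γ e '' Ioo 0 1 := ⟨s, ⟨h0, h1⟩, rfl⟩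
  rcases h with ⟨e', he'⟩ | ⟨e', hne, he'⟩
  · have hm : ∃ t ∈ Icc (0 : ℝ) 1, M.γ e s = M.γ e' t ∧ (t = 0 ∨ t = 1) := by
      rcases he' with h | h
      · exact ⟨0, left_mem_Icc.2 zero_le_one, h, Or.inl rfl⟩
      · exact ⟨1, right_mem_Icc.2 zero_le_one, h, Or.inr rfl⟩
    obtain ⟨t, ht, hst, htt⟩ := hm
    rcases eq_or_ne e e' with rfl | hne
    · have := M.inj e hs ht hst
      rcases htt with rfl | rfl <;> linarith
    · exact disjoint_left.1 (M.disj e e' hne) hopen ⟨t, ht, hst.symm⟩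
  · exact disjoint_left.1 (M.disj e e' hne) hopen he'

/-- The edges cover the boundary, so some half-edge leaves a node to the side `ε`. -/
lemma exists_halfEdge_onSide [Finite ι] (hΩ : IsOpen Ω) (hR : IsChart Ω z R r K f)
    (hz : z ∈ M.nodes) {ε : ℝ} (hε : ε = 1 ∨ ε = -1) :
    ∃ h, M.halfEdge h 0 = z ∧ M.OnSide R z h ε := by
  by_contra hcon
  push Not at hcon
  have hzf := M.nodes_subset hz
  have hfz := (hR.frontier_iff hΩ (Metric.mem_ball_self hR.pos)).1 hzf
  -- the points of the graph on the side `ε` of `z`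
  set p : ℝ → Plane := fun t => chartPt R (R z 0 + ε * t) (f (R z 0 + ε * t)) with hp
  have hpc : Continuous p := by
    have h1 : Continuous fun t : ℝ => R z 0 + ε * t := by fun_prop
    exact (continuous_chartPt R).comp (h1.prodMk (hR.lip.continuous.comp h1))
  have hp0 : p 0 = z := by
    simp only [hp, mul_zero, add_zero]
    rw [← hfz, chartPt_eq]
  have hpt : Tendsto p (𝓝[>] 0) (𝓝 z) := by
    have := hpc.tendsto 0
    rw [hp0] at this
    exact this.mono_left nhdsWithin_le_nhds
  -- close to `z`, no edge contains them
  have hedge : ∀ e, ∀ᶠ t in 𝓝[>] (0 : ℝ), p t ∉ M.γ e '' Icc 0 1 := by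
    intro e
    by_cases hze : z ∈ M.γ e '' Icc 0 1
    · obtain ⟨b, hb⟩ := M.exists_halfEdge_of_mem hze (Or.inl hz)
      have hside : M.OnSide R z (e, b) (-ε) := by
        have h1 := exists_onSide hΩ hR hb
        have h2 := hcon _ hb
        rcases hε with rfl | rfl
        · tauto
        · rw [neg_neg]; tauto
      filter_upwards [hpt.eventually (hside.eventually hb), self_mem_nhdsWithin] with t ht ht0 hmem
      have ht0' : 0 < t := ht0
      have hcoord : R (p t) 0 = R z 0 + ε * t := by simp [hp]
      have hne : p t ≠ z := by
        intro h
        rw [h] at hcoord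
        rcases hε with rfl | rfl <;> linarith
      have := ht hmem hne
      rw [hcoord] at this
      rcases hε with rfl | rfl <;> linarith
    · exact hpt.eventually_mem ((M.isCompact_edge e).isClosed.isOpen_compl.mem_nhds hze)
  obtain ⟨t, ht1, ht2⟩ := ((eventually_all.2 hedge).and
    (hpt.eventually_mem (Metric.ball_mem_nhds z hR.pos))).exists
  have : p t ∈ frontier Ω := by
    rw [hR.frontier_iff hΩ ht2]
    simp [hp]
  rw [← M.cover] at this
  obtain ⟨e, he⟩ := mem_iUnion.1 this
  exact ht1 e he

lemma finite_nodes [Finite ι] : M.nodes.Finite := by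
  refine (Set.finite_range fun h : ι × Bool => M.halfEdge h 0).subset ?_
  rintro z ⟨e, rfl | rfl⟩
  · exact ⟨(e, false), by simp [halfEdge]⟩
  · exact ⟨(e, true), by simp [halfEdge]⟩

/-- There are as many nodes as edges, since there is exactly one half-edge on either side of each
node. -/
theorem card_nodes [Finite ι] (hΩ : IsOpen Ω) (hl : IsLipschitzSet Ω) :
    Nat.card M.nodes = Nat.card ι := by
  have hch : ∀ z : M.nodes, ∃ R r K f, IsChart Ω z R r K f := fun z =>
    hl.exists_isChart (M.nodes_subset z.2)
  choose R r K f hR using hch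
  let sgn : Bool → ℝ := fun b => if b then 1 else -1
  have hsgn : ∀ b, sgn b = 1 ∨ sgn b = -1 := by
    intro b
    cases b <;> simp [sgn]
  have hex : ∀ zb : M.nodes × Bool, ∃ h, M.halfEdge h 0 = zb.1 ∧
      M.OnSide (R zb.1) zb.1 h (sgn zb.2) := fun zb =>
    M.exists_halfEdge_onSide hΩ (hR zb.1) zb.1.2 (hsgn zb.2)
  -- half-edges correspond to pairs of a node and a side
  choose H hH1 hH2 using hex
  have hbij : Function.Bijective H := by
    constructor
    · rintro ⟨z, b⟩ ⟨z', b'⟩ heq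
      have hz : z = z' := by
        apply Subtype.ext
        rw [← hH1 (z, b), ← hH1 (z', b'), heq]
      subst hz
      have h1 := hH2 (z, b)
      have h2 := hH2 (z, b')
      rw [heq] at h1
      cases b <;> cases b' <;> simp only [sgn] at h1 h2 ⊢
      · exact absurd h1 (by simpa using h2.not_neg)
      · exact absurd h2 (by simpa using h1.not_neg)
    · intro h
      let z : M.nodes := ⟨M.halfEdge h 0, M.halfEdge_zero_mem_nodes h⟩
      have hside : ∃ b, M.OnSide (R z) z h (sgn b) := by
        rcases exists_onSide hΩ (hR z) (h := h) rfl with h1 | h1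
        · exact ⟨true, by simpa [sgn] using h1⟩
        · exact ⟨false, by simpa [sgn] using h1⟩
      obtain ⟨b, hb⟩ := hside
      exact ⟨(z, b), (hH2 (z, b)).eq hΩ (hR z) (hH1 (z, b)) rfl hb⟩
  have := Nat.card_eq_of_bijective H hbij
  rw [Nat.card_prod, Nat.card_prod] at this
  have h2 : Nat.card Bool = 2 := by simp
  rw [h2] at this
  omega

end BoundaryMesh

/-! ### Whitney's conditions on the boundary -/

section WhitneyPair

variable {E : Type*} [NormedAddCommGroup E] [InnerProductSpace ℝ E] {f : E → ℝ} {G : E → E}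

lemma WhitneyPair.mono {C C' : ℝ} {x y : E} (h : WhitneyPair f G C x y) (hC : C ≤ C') :
    WhitneyPair f G C' x y :=
  ⟨h.1.trans (by gcongr), h.2.trans (by gcongr)⟩

/-- Bounded jets satisfy Whitney's conditions for points that keep a distance. -/
lemma whitneyPair_of_le_norm {B d : ℝ} {x y : E} (hd : 0 < d) (h1 : |f x| ≤ B) (h2 : |f y| ≤ B)
    (h3 : ‖G x‖ ≤ B) (h4 : ‖G y‖ ≤ B) (hxy : d ≤ ‖y - x‖) :
    WhitneyPair f G (2 * B / d + 2 * B / d ^ 2) x y := by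
  have hB : 0 ≤ B := (abs_nonneg _).trans h1
  set D := ‖y - x‖ with hD
  have hq : 1 ≤ D / d := (one_le_div hd).2 hxy
  have e1 : 2 * B ≤ 2 * B / d * D := by
    have := mul_le_mul_of_nonneg_left hq (by positivity : 0 ≤ 2 * B)
    rw [mul_one] at this
    exact this.trans (le_of_eq (by ring))
  have e2 : 2 * B ≤ 2 * B / d ^ 2 * D ^ 2 := by
    have := mul_le_mul_of_nonneg_left (one_le_pow₀ hq (n := 2)) (by positivity : 0 ≤ 2 * B)
    rw [mul_one, div_pow] at this
    exact this.trans (le_of_eq (by ring))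
  have hD0 : 0 ≤ D := norm_nonneg _
  refine ⟨?_, ?_⟩
  · have h5 := norm_sub_le (G y) (G x)
    have h6 : 0 ≤ 2 * B / d ^ 2 * D := by positivity
    rw [add_mul]
    linarith
  · have h5 := abs_real_inner_le_norm (G x) (y - x)
    have h6 : ‖G x‖ * ‖y - x‖ ≤ B * D := by gcongr
    have h7 := mul_le_mul_of_nonneg_right e1 hD0
    have h8 := abs_sub (f y - f x) (inner ℝ (G x) (y - x))
    have h9 := abs_sub (f y) (f x)
    have h10 : 0 ≤ B * D := by positivity
    have h11 : (2 * B / d + 2 * B / d ^ 2) * D ^ 2 =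
        2 * B / d * D * D + 2 * B / d ^ 2 * D ^ 2 := by ring
    rw [h11]
    linarith

/-- Whitney's conditions for `x, y` follow from those for `x, z` and `z, y` if `z` lies almost
between `x` and `y`. -/
lemma WhitneyPair.trans {C L : ℝ} {x y z : E} (hC : 0 ≤ C) (h1 : WhitneyPair f G C x z)
    (h2 : WhitneyPair f G C z y) (hL : ‖z - x‖ + ‖y - z‖ ≤ L * ‖y - x‖) :
    WhitneyPair f G (C * L + C * L ^ 2) x y := by
  set a := ‖z - x‖
  set b := ‖y - z‖
  set D := ‖y - x‖
  have ha : 0 ≤ a := norm_nonneg _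
  have hb : 0 ≤ b := norm_nonneg _
  have hLD : (a + b) ^ 2 ≤ (L * D) ^ 2 := by gcongr
  have hL1 : C * (a + b) ≤ C * (L * D) := by gcongr
  have hL2 : C * (a + b) ^ 2 ≤ C * (L * D) ^ 2 := by gcongr
  have hab : 0 ≤ C * (L * D) := le_trans (by positivity) hL1
  have hD0 : 0 ≤ D := norm_nonneg _
  refine ⟨?_, ?_⟩
  · have := norm_add_le (G y - G z) (G z - G x)
    rw [sub_add_sub_cancel] at this
    have h5 : 0 ≤ C * L ^ 2 * D := by positivity
    nlinarith [h1.1, h2.1]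
  · have e : f y - f x - inner ℝ (G x) (y - x) = (f y - f z - inner ℝ (G z) (y - z)) +
        (f z - f x - inner ℝ (G x) (z - x)) + inner ℝ (G z - G x) (y - z) := by
      rw [inner_sub_left, show y - x = (y - z) + (z - x) by abel, inner_add_right]
      ring
    rw [e]
    have h3 := abs_real_inner_le_norm (G z - G x) (y - z)
    have h4 : ‖G z - G x‖ * ‖y - z‖ ≤ C * a * b := by
      have := h1.1
      gcongr
    have h5 := abs_add_le ((f y - f z - inner ℝ (G z) (y - z)) +
        (f z - f x - inner ℝ (G x) (z - x))) (inner ℝ (G z - G x) (y - z))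
    have h6 := abs_add_le (f y - f z - inner ℝ (G z) (y - z))
        (f z - f x - inner ℝ (G x) (z - x))
    have h7 := h1.2
    have h8 := h2.2
    have h9 : 0 ≤ C * a * b := by positivity
    have h10 : 0 ≤ C * (L * D) * D := by positivity
    nlinarith

end WhitneyPair

/-- A monotone family of conditions that holds locally with some constant holds on a compact set with
a single constant. -/
lemma IsCompact.exists_forall_of_eventually {X : Type*} [TopologicalSpace X] {K : Set X}
    (hK : IsCompact K) {Q : ℝ → X → Prop} (hmono : ∀ C C' x, C ≤ C' → Q C x → Q C' x)
    (h : ∀ x ∈ K, ∃ C, ∀ᶠ y in 𝓝[K] x, Q C y) : ∃ C, ∀ y ∈ K, Q C y := by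
  refine hK.induction_on (p := fun s => ∃ C, ∀ y ∈ s, Q C y) ⟨0, by simp⟩ ?_ ?_ ?_
  · rintro s t hst ⟨C, hC⟩
    exact ⟨C, fun y hy => hC y (hst hy)⟩
  · rintro s t ⟨C, hC⟩ ⟨D, hD⟩
    refine ⟨max C D, ?_⟩
    rintro y (hy | hy)
    · exact hmono _ _ _ (le_max_left _ _) (hC y hy)
    · exact hmono _ _ _ (le_max_right _ _) (hD y hy)
  · intro x hx
    obtain ⟨C, hC⟩ := h x hx
    exact ⟨_, hC, C, fun y hy => hy⟩

namespace BoundaryMesh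

variable {Ω : Set Plane} {ι : Type*} (M : BoundaryMesh Ω ι)

lemma hasDerivWithinAt_γ (e : ι) {s : ℝ} (hs : s ∈ Icc (0 : ℝ) 1) :
    HasDerivWithinAt (M.γ e) (M.vel e s) (Icc 0 1) s :=
  ((M.smooth e).differentiableOn (by simp) s hs).hasDerivWithinAt

/-- The inverse of a regular injective path is Lipschitz: close to the diagonal by regularity, and
away from it by injectivity. -/
lemma exists_abs_sub_le (e : ι) : ∃ C, 0 ≤ C ∧ ∀ s ∈ Icc (0 : ℝ) 1, ∀ t ∈ Icc (0 : ℝ) 1,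
    |t - s| ≤ C * ‖M.γ e t - M.γ e s‖ := by
  have hγc := (M.smooth e).continuousOn
  suffices hloc : ∀ p ∈ Icc (0 : ℝ) 1 ×ˢ Icc (0 : ℝ) 1, ∃ C : ℝ,
      ∀ᶠ q in 𝓝[Icc 0 1 ×ˢ Icc 0 1] p, |q.2 - q.1| ≤ C * ‖M.γ e q.2 - M.γ e q.1‖ by
    obtain ⟨C, hC⟩ := (isCompact_Icc.prod isCompact_Icc).exists_forall_of_eventually
      (Q := fun C q => |q.2 - q.1| ≤ C * ‖M.γ e q.2 - M.γ e q.1‖)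
      (fun C C' p hCC' h => h.trans (by gcongr)) hloc
    refine ⟨max C 0, le_max_right _ _, fun s hs t ht => (hC (s, t) ⟨hs, ht⟩).trans ?_⟩
    gcongr
    exact le_max_left _ _
  rintro ⟨s₀, t₀⟩ ⟨hs₀, ht₀⟩
  simp only at hs₀ ht₀
  by_cases hst : s₀ = t₀
  · subst hst
    set m := ‖M.vel e s₀‖ with hm
    have hm0 : 0 < m := M.norm_vel_pos e hs₀
    refine ⟨2 / m, ?_⟩
    have hnear : ∀ᶠ u in 𝓝[Icc 0 1] s₀, ‖M.vel e u - M.vel e s₀‖ ≤ m / 2 := by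
      have h1 : Tendsto (fun u => ‖M.vel e u - M.vel e s₀‖) (𝓝[Icc 0 1] s₀) (𝓝 0) := by
        have := ((M.continuousOn_vel e) s₀ hs₀).tendsto.sub_const (M.vel e s₀)
        rw [sub_self] at this
        simpa using this.norm
      exact (h1.eventually_lt_const (by positivity : (0 : ℝ) < m / 2)).mono fun u hu => hu.le
    obtain ⟨η, hη, hball⟩ := Metric.mem_nhdsWithin_iff.1 hnear
    have hnb : (Metric.ball s₀ η ∩ Icc 0 1) ×ˢ (Metric.ball s₀ η ∩ Icc 0 1) ∈
        𝓝[Icc 0 1 ×ˢ Icc 0 1] (s₀, s₀) := by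
      rw [nhdsWithin_prod_eq]
      have h1 : Metric.ball s₀ η ∩ Icc 0 1 ∈ 𝓝[Icc 0 1] s₀ :=
        inter_mem (mem_nhdsWithin_of_mem_nhds (Metric.ball_mem_nhds s₀ hη)) self_mem_nhdsWithin
      exact prod_mem_prod h1 h1
    filter_upwards [hnb] with p hp
    obtain ⟨hp1, hp2⟩ := hp
    have hconv : Convex ℝ (Metric.ball s₀ η ∩ Icc 0 1) :=
      (convex_ball _ _).inter (convex_Icc _ _)
    have hmv := hconv.norm_image_sub_le_of_norm_hasDerivWithin_le
      (f := fun u => M.γ e u - u • M.vel e s₀) (f' := fun u => M.vel e u - M.vel e s₀)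
      (C := m / 2) (fun u hu => by
        have h1 := (M.hasDerivWithinAt_γ e hu.2).mono (inter_subset_right (s := Metric.ball s₀ η))
        have h2 := (hasDerivWithinAt_id u (Metric.ball s₀ η ∩ Icc 0 1)).smul_const (M.vel e s₀)
        rw [one_smul] at h2
        exact h1.sub h2) (fun u hu => hball hu) hp1 hp2
    have e1 : M.γ e p.2 - p.2 • M.vel e s₀ - (M.γ e p.1 - p.1 • M.vel e s₀) =
        (M.γ e p.2 - M.γ e p.1) - (p.2 - p.1) • M.vel e s₀ := by
      rw [sub_smul]; abel
    rw [e1] at hmv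
    have h3 := norm_sub_norm_le ((p.2 - p.1) • M.vel e s₀) (M.γ e p.2 - M.γ e p.1)
    rw [norm_smul, norm_sub_rev ((p.2 - p.1) • M.vel e s₀), ← hm] at h3
    rw [Real.norm_eq_abs] at h3 hmv
    rw [div_mul_eq_mul_div, le_div_iff₀ hm0]
    nlinarith
  · have hne : M.γ e t₀ - M.γ e s₀ ≠ 0 := fun h =>
      hst ((M.inj e) hs₀ ht₀ (sub_eq_zero.1 h).symm)
    set d := ‖M.γ e t₀ - M.γ e s₀‖ with hd
    have hd0 : 0 < d := norm_pos_iff.2 hne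
    refine ⟨2 / d, ?_⟩
    have hct : ContinuousOn (fun p : ℝ × ℝ => ‖M.γ e p.2 - M.γ e p.1‖)
        (Icc 0 1 ×ˢ Icc 0 1) :=
      ((hγc.comp continuousOn_snd fun p hp => hp.2).sub
        (hγc.comp continuousOn_fst fun p hp => hp.1)).norm
    have h1 := (hct (s₀, t₀) ⟨hs₀, ht₀⟩).tendsto.eventually_const_lt
      (show d / 2 < ‖M.γ e t₀ - M.γ e s₀‖ by linarith)
    filter_upwards [h1, self_mem_nhdsWithin] with p hp hpm
    have h2 : |p.2 - p.1| ≤ 1 := by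
      rw [abs_le]
      constructor <;> linarith [hpm.1.1, hpm.1.2, hpm.2.1, hpm.2.2]
    refine h2.trans ?_
    rw [div_mul_eq_mul_div, le_div_iff₀ hd0]
    linarith

/-- On a single edge, a jet with Lipschitz gradient that is compatible with the tangential derivative
satisfies Whitney's conditions. -/
lemma exists_whitneyPair_edge (e : ι) {φ : Plane → ℝ} {G : Plane → Plane} {L : NNReal}
    (hG : LipschitzOnWith L (fun s => G (M.γ e s)) (Icc 0 1))
    (hφ : ∀ s ∈ Icc (0 : ℝ) 1, HasDerivWithinAt (fun s => φ (M.γ e s))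
      (inner ℝ (G (M.γ e s)) (M.vel e s)) (Icc 0 1) s) :
    ∃ C, ∀ x ∈ M.γ e '' Icc 0 1, ∀ y ∈ M.γ e '' Icc 0 1, WhitneyPair φ G C x y := by
  obtain ⟨C, hC0, hC⟩ := M.exists_abs_sub_le e
  obtain ⟨V, hV⟩ := isCompact_Icc.exists_bound_of_continuousOn (M.continuousOn_vel e)
  have hV0 : 0 ≤ V := (norm_nonneg _).trans (hV 0 (left_mem_Icc.2 zero_le_one))
  refine ⟨L * C + L * V * C ^ 2, ?_⟩
  rintro _ ⟨s, hs, rfl⟩ _ ⟨t, ht, rfl⟩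
  set D := ‖M.γ e t - M.γ e s‖ with hD
  have hD0 : 0 ≤ D := norm_nonneg _
  have hts := hC s hs t ht
  have hLip : ∀ u ∈ Icc (0 : ℝ) 1, ‖G (M.γ e u) - G (M.γ e s)‖ ≤ L * |u - s| := fun u hu => by
    have := hG.dist_le_mul u hu s hs
    rwa [dist_eq_norm, Real.dist_eq] at this
  constructor
  · have h1 : L * |t - s| ≤ L * (C * D) := by gcongr
    have h2 : 0 ≤ L * V * C ^ 2 * D := by positivity
    nlinarith [hLip t ht]
  · have hsub : uIcc s t ⊆ Icc (0 : ℝ) 1 := uIcc_subset_Icc hs ht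
    -- the mean value inequality for the remainder of the first order expansion at `γ s`
    have hmv := (convex_uIcc s t).norm_image_sub_le_of_norm_hasDerivWithin_le
      (f := fun u => φ (M.γ e u) - inner ℝ (G (M.γ e s)) (M.γ e u))
      (f' := fun u => inner ℝ (G (M.γ e u)) (M.vel e u) - inner ℝ (G (M.γ e s)) (M.vel e u))
      (C := L * |t - s| * V) (fun u hu => by
        have h1 := (hφ u (hsub hu)).mono hsub
        have h2 := ((innerSL ℝ (G (M.γ e s))).hasFDerivAt.comp_hasDerivWithinAt u
          ((M.hasDerivWithinAt_γ e (hsub hu)).mono hsub))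
        exact h1.sub h2) (fun u hu => by
        rw [← inner_sub_left]
        refine (norm_inner_le_norm _ _).trans ?_
        have h1 := hLip u (hsub hu)
        have h2 : |u - s| ≤ |t - s| := abs_sub_left_of_mem_uIcc hu
        have h3 := hV u (hsub hu)
        gcongr
        exact h1.trans (by gcongr)) left_mem_uIcc right_mem_uIcc
    have e1 : φ (M.γ e t) - φ (M.γ e s) - inner ℝ (G (M.γ e s)) (M.γ e t - M.γ e s) =
        φ (M.γ e t) - inner ℝ (G (M.γ e s)) (M.γ e t) -
          (φ (M.γ e s) - inner ℝ (G (M.γ e s)) (M.γ e s)) := by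
      rw [inner_sub_right]; ring
    rw [e1]
    refine hmv.trans ?_
    rw [Real.norm_eq_abs]
    have h1 : |t - s| ^ 2 ≤ (C * D) ^ 2 := by gcongr
    have h2 : L * V * |t - s| ^ 2 ≤ L * V * (C * D) ^ 2 := by gcongr
    have h3 : 0 ≤ L * C * D ^ 2 := by positivity
    nlinarith

/-- Edge-wise Whitney conditions imply global ones, since the boundary has no cusps: two edges that
meet in a node lie on opposite sides of it. -/
lemma exists_whitneyPair_frontier [Finite ι] (hΩ : IsOpen Ω) (hl : IsLipschitzSet Ω)
    {φ : Plane → ℝ} {G : Plane → Plane} {B : ℝ} (hφB : ∀ x ∈ frontier Ω, |φ x| ≤ B)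
    (hGB : ∀ x ∈ frontier Ω, ‖G x‖ ≤ B)
    (hedge : ∀ e, ∃ C, ∀ x ∈ M.γ e '' Icc 0 1, ∀ y ∈ M.γ e '' Icc 0 1, WhitneyPair φ G C x y) :
    ∃ C, ∀ x ∈ frontier Ω, ∀ y ∈ frontier Ω, WhitneyPair φ G C x y := by
  have hfr : ∀ {e x}, x ∈ M.γ e '' Icc 0 1 → x ∈ frontier Ω := by
    intro e x hx
    rw [← M.cover]
    exact mem_iUnion.2 ⟨e, hx⟩
  have hpair : ∀ ee : ι × ι, ∃ C, ∀ x ∈ M.γ ee.1 '' Icc 0 1, ∀ y ∈ M.γ ee.2 '' Icc 0 1,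
      WhitneyPair φ G C x y := by
    rintro ⟨e, e'⟩
    by_cases hee : e = e'
    · subst hee
      exact hedge e
    suffices hloc : ∀ p ∈ (M.γ e '' Icc 0 1) ×ˢ (M.γ e' '' Icc 0 1), ∃ C : ℝ,
        ∀ᶠ q in 𝓝[(M.γ e '' Icc 0 1) ×ˢ (M.γ e' '' Icc 0 1)] p, WhitneyPair φ G C q.1 q.2 by
      obtain ⟨C, hC⟩ := ((M.isCompact_edge e).prod
        (M.isCompact_edge e')).exists_forall_of_eventually
        (Q := fun C q => WhitneyPair φ G C q.1 q.2) (fun C C' p hCC' h => h.mono hCC') hloc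
      exact ⟨C, fun x hx y hy => hC (x, y) ⟨hx, hy⟩⟩
    rintro ⟨x₀, y₀⟩ ⟨hx₀, hy₀⟩
    simp only at hx₀ hy₀
    by_cases hxy : x₀ = y₀
    -- the two edges meet in `x₀`, which lies almost between points on either edge
    · subst hxy
      obtain ⟨b, hb⟩ := M.exists_halfEdge_of_mem hx₀ (Or.inr ⟨e', hee, hy₀⟩)
      obtain ⟨b', hb'⟩ := M.exists_halfEdge_of_mem hy₀ (Or.inr ⟨e, Ne.symm hee, hx₀⟩)
      obtain ⟨R, r, K, f, hR⟩ := hl.exists_isChart (hfr hx₀)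
      have hopp : ∃ ε : ℝ, M.OnSide R x₀ (e, b) ε ∧ M.OnSide R x₀ (e', b') (-ε) ∧
          (ε = 1 ∨ ε = -1) := by
        have hne : ∀ ε, M.OnSide R x₀ (e, b) ε → ¬ M.OnSide R x₀ (e', b') ε := fun ε h1 h2 =>
          hee (congrArg Prod.fst (h1.eq hΩ hR hb hb' h2))
        rcases exists_onSide hΩ hR hb with h1 | h1
        · refine ⟨1, h1, ?_, Or.inl rfl⟩
          exact (exists_onSide hΩ hR hb').resolve_left (hne 1 h1)
        · refine ⟨-1, h1, ?_, Or.inr rfl⟩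
          rw [neg_neg]
          exact (exists_onSide hΩ hR hb').resolve_right (hne (-1) h1)
      obtain ⟨ε, h1, h2, hε⟩ := hopp
      obtain ⟨C₁, hC₁⟩ := hedge e
      obtain ⟨C₂, hC₂⟩ := hedge e'
      set C := max (max C₁ C₂) 0 with hC
      have hC1 : C₁ ≤ C := (le_max_left _ _).trans (le_max_left _ _)
      have hC2 : C₂ ≤ C := (le_max_right _ _).trans (le_max_left _ _)
      refine ⟨C * (1 + K) + C * (1 + K) ^ 2, ?_⟩
      have hball := Metric.ball_mem_nhds x₀ hR.pos
      have hev1 : ∀ᶠ x in 𝓝[M.γ e '' Icc 0 1] x₀,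
          x ∈ Metric.ball x₀ r ∧ 0 ≤ ε * (R x 0 - R x₀ 0) := by
        filter_upwards [nhdsWithin_le_nhds (h1.eventually hb), nhdsWithin_le_nhds hball,
          self_mem_nhdsWithin] with x hx hxb hxm
        refine ⟨hxb, ?_⟩
        rcases eq_or_ne x x₀ with rfl | hne
        · simp
        · exact (hx hxm hne).le
      have hev2 : ∀ᶠ x in 𝓝[M.γ e' '' Icc 0 1] x₀,
          x ∈ Metric.ball x₀ r ∧ 0 ≤ -ε * (R x 0 - R x₀ 0) := by
        filter_upwards [nhdsWithin_le_nhds (h2.eventually hb'), nhdsWithin_le_nhds hball,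
          self_mem_nhdsWithin] with x hx hxb hxm
        refine ⟨hxb, ?_⟩
        rcases eq_or_ne x x₀ with rfl | hne
        · simp
        · exact (hx hxm hne).le
      rw [nhdsWithin_prod_eq]
      filter_upwards [(hev1.and self_mem_nhdsWithin).prod_mk (hev2.and self_mem_nhdsWithin)]
        with p hp
      obtain ⟨⟨⟨hpb, hpε⟩, hpm⟩, ⟨⟨hqb, hqε⟩, hqm⟩⟩ := hp
      refine WhitneyPair.trans (z := x₀) (le_max_right _ _) ((hC₁ _ hpm _ hx₀).mono hC1)
        ((hC₂ _ hy₀ _ hqm).mono hC2) ?_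
      have d1 := hR.dist_le hΩ (Metric.mem_ball_self hR.pos) hpb (hfr hx₀) (hfr hpm)
      have d2 := hR.dist_le hΩ hqb (Metric.mem_ball_self hR.pos) (hfr hqm) (hfr hx₀)
      have d3 := abs_apply_sub_le R p.2 p.1 0
      rw [dist_eq_norm] at d1 d2 d3
      have habs : |R x₀ 0 - R p.1 0| + |R p.2 0 - R x₀ 0| = |R p.2 0 - R p.1 0| := by
        rcases hε with rfl | rfl
        · rw [abs_of_nonpos (by linarith), abs_of_nonpos (by linarith),
            abs_of_nonpos (by linarith)]
          ring
        · rw [abs_of_nonneg (by linarith), abs_of_nonneg (by linarith),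
            abs_of_nonneg (by linarith)]
          ring
      have hK : (0 : ℝ) ≤ 1 + K := by positivity
      calc ‖x₀ - p.1‖ + ‖p.2 - x₀‖
          ≤ (1 + K) * (|R x₀ 0 - R p.1 0| + |R p.2 0 - R x₀ 0|) := by linarith
        _ ≤ (1 + K) * ‖p.2 - p.1‖ := by
          rw [habs]
          gcongr
    -- the points keep a distance
    · have hd0 : 0 < ‖y₀ - x₀‖ := norm_pos_iff.2 (sub_ne_zero.2 (Ne.symm hxy))
      have hev : ∀ᶠ p : Plane × Plane in 𝓝 (x₀, y₀), ‖y₀ - x₀‖ / 2 < ‖p.2 - p.1‖ := by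
        have hc : Continuous fun p : Plane × Plane => ‖p.2 - p.1‖ := by fun_prop
        exact (hc.tendsto (x₀, y₀)).eventually_const_lt (by simp only; linarith)
      refine ⟨2 * B / (‖y₀ - x₀‖ / 2) + 2 * B / (‖y₀ - x₀‖ / 2) ^ 2, ?_⟩
      filter_upwards [nhdsWithin_le_nhds hev, self_mem_nhdsWithin] with p hp hpm
      exact whitneyPair_of_le_norm (half_pos hd0) (hφB _ (hfr hpm.1)) (hφB _ (hfr hpm.2))
        (hGB _ (hfr hpm.1)) (hGB _ (hfr hpm.2)) hp.le
  choose C hC using hpair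
  obtain ⟨C₀, hC₀⟩ := (Set.finite_range C).bddAbove
  refine ⟨C₀, fun x hx y hy => ?_⟩
  rw [← M.cover] at hx hy
  obtain ⟨e, he⟩ := mem_iUnion.1 hx
  obtain ⟨e', he'⟩ := mem_iUnion.1 hy
  exact (hC (e, e') x he y he').mono (hC₀ ⟨_, rfl⟩)

end BoundaryMesh

/-- A jet on a compact set that satisfies Whitney's conditions is the jet of a compactly supported
`C^{1,1}` function. The support is made compact by prescribing the zero jet far away. -/
lemma exists_isC11_extension {S : Set Plane} (hS : S.Nonempty) (hb : Bornology.IsBounded S)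
    {φ : Plane → ℝ} {G : Plane → Plane} {B C : ℝ} (hφB : ∀ x ∈ S, |φ x| ≤ B)
    (hGB : ∀ x ∈ S, ‖G x‖ ≤ B) (h : ∀ x ∈ S, ∀ y ∈ S, WhitneyPair φ G C x y) :
    ∃ F, IsC11 F ∧ ∀ x ∈ S, F x = φ x ∧ ∀ v, fderiv ℝ F x v = inner ℝ (G x) v := by
  classical
  obtain ⟨r, hr⟩ := hb.subset_closedBall (0 : Plane)
  have hSr : ∀ x ∈ S, ‖x‖ ≤ r := fun x hx => by simpa using hr hx
  obtain ⟨x₁, hx₁⟩ := hS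
  have hB : 0 ≤ B := (abs_nonneg _).trans (hφB x₁ hx₁)
  let T : Set Plane := {x | r + 1 ≤ ‖x‖}
  let φ' := S.indicator φ
  let G' := S.indicator G
  have hTS : ∀ x ∈ T, x ∉ S := fun x hx hxS => by
    have h1 : r + 1 ≤ ‖x‖ := hx
    linarith [hSr x hxS]
  have hφ'B : ∀ x, |φ' x| ≤ B := by
    intro x
    by_cases hx : x ∈ S
    · simpa [φ', hx] using hφB x hx
    · simpa [φ', hx] using hB
  have hG'B : ∀ x, ‖G' x‖ ≤ B := by
    intro x
    by_cases hx : x ∈ S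
    · simpa [G', hx] using hGB x hx
    · simpa [G', hx] using hB
  have hfar : ∀ x y, 1 ≤ ‖y - x‖ → WhitneyPair φ' G' (2 * B / 1 + 2 * B / 1 ^ 2) x y :=
    fun x y hxy => whitneyPair_of_le_norm one_pos (hφ'B x) (hφ'B y) (hG'B x) (hG'B y) hxy
  set C' := max (max C 0) (2 * B / 1 + 2 * B / 1 ^ 2) with hC'
  have hw : ∀ x ∈ S ∪ T, ∀ y ∈ S ∪ T, WhitneyPair φ' G' C' x y := by
    rintro x (hx | hx) y (hy | hy)
    · have := (h x hx y hy).mono ((le_max_left C 0).trans (le_max_left _ _) : C ≤ C')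
      simpa only [WhitneyPair, φ', G', indicator_of_mem hx, indicator_of_mem hy] using this
    · refine (hfar x y ?_).mono (le_max_right _ _)
      have h1 : r + 1 ≤ ‖y‖ := hy
      linarith [hSr x hx, norm_sub_norm_le y x]
    · refine (hfar x y ?_).mono (le_max_right _ _)
      have h1 : r + 1 ≤ ‖x‖ := hx
      rw [norm_sub_rev]
      linarith [hSr y hy, norm_sub_norm_le x y]
    · have hC0 : 0 ≤ C' := (le_max_right C 0).trans (le_max_left _ _)
      simp only [WhitneyPair, φ', G', indicator_of_notMem (hTS x hx),
        indicator_of_notMem (hTS y hy), sub_self, norm_zero, inner_zero_left, abs_zero]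
      constructor <;> positivity
  obtain ⟨F, P, Q, hF, hFS⟩ := exists_extension_of_whitneyPair ⟨x₁, Or.inl hx₁⟩ hw
  have hFc : HasCompactSupport F := by
    refine HasCompactSupport.intro (isCompact_closedBall 0 (r + 1)) fun x hx => ?_
    have hxT : x ∈ T := by
      rw [Metric.mem_closedBall, dist_zero_right, not_le] at hx
      exact hx.le
    rw [(hFS x (Or.inr hxT)).1]
    exact indicator_of_notMem (hTS x hxT) _
  obtain ⟨hF1, hF2⟩ := isC11_of_quadratic_expansion hF hFc
  refine ⟨F, hF1, fun x hx => ⟨?_, fun v => ?_⟩⟩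
  · rw [(hFS x (Or.inl hx)).1]
    exact indicator_of_mem hx _
  · rw [hF2, (hFS x (Or.inl hx)).2]
    simp only [G', indicator_of_mem hx]

/-! ### Unisolvence on a single edge -/

namespace BoundaryMesh

variable {Ω : Set Plane} {ι : Type*} (M : BoundaryMesh Ω ι)

lemma eqOn_of_ae_arc_eq {e : ι} {f g : ℝ → ℝ} (hf : ContinuousOn f (Icc 0 1))
    (hg : ContinuousOn g (Icc 0 1)) (h : ∀ᵐ s ∂M.arc e, f s = g s) : EqOn f g (Icc 0 1) :=
  Measure.eqOn_Icc_of_ae_eq volume zero_ne_one (M.ae_volume_of_ae_arc h) hf hg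

lemma poly_eq_zero_of_ae {e : ι} {q : ℝ[X]} (h : ∀ᵐ s ∂M.arc e, q.eval s = 0) : q = 0 := by
  have h1 := M.eqOn_of_ae_arc_eq (e := e) q.continuous.continuousOn
    (continuousOn_const (c := (0 : ℝ))) h
  exact Polynomial.eq_zero_of_infinite_isRoot q ((Icc_infinite one_pos).mono fun s hs => h1 hs)

lemma integrable_arc {e : ι} {f : ℝ → ℝ} (hf : Continuous f) : Integrable f (M.arc e) := by
  obtain ⟨B, hB⟩ := isCompact_Icc.exists_bound_of_continuousOn (hf.continuousOn (s := Icc 0 1))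
  exact Integrable.of_bound hf.aestronglyMeasurable B
    ((M.ae_arc_mem e).mono fun s hs => hB s hs)

/-- The moments of a polynomial on the edge `e` against the polynomials of degree less than `n`. -/
noncomputable def moment (e : ι) (n : ℕ) :
    ℝ[X] →ₗ[ℝ] Module.Dual ℝ (Polynomial.degreeLT ℝ n) :=
  LinearMap.mk₂ ℝ (fun q μ => ∫ s, q.eval s * μ.1.eval s ∂M.arc e)
    (fun q r μ => by
      simp only [Polynomial.eval_add, add_mul]
      exact integral_add (M.integrable_arc (q.continuous.mul μ.1.continuous))
        (M.integrable_arc (r.continuous.mul μ.1.continuous)))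
    (fun c q μ => by
      simp only [Polynomial.eval_smul, smul_eq_mul, mul_assoc]
      exact integral_const_mul _ _)
    (fun q μ ν => by
      simp only [Submodule.coe_add, Polynomial.eval_add, mul_add]
      exact integral_add (M.integrable_arc (q.continuous.mul μ.1.continuous))
        (M.integrable_arc (q.continuous.mul ν.1.continuous)))
    (fun c q μ => by
      simp only [Submodule.coe_smul, Polynomial.eval_smul, smul_eq_mul, mul_left_comm _ c]
      exact integral_const_mul _ _)

lemma moment_apply (e : ι) (n : ℕ) (q : ℝ[X]) (μ : Polynomial.degreeLT ℝ n) :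
    M.moment e n q μ = ∫ s, q.eval s * μ.1.eval s ∂M.arc e := rfl

/-- A polynomial that is divisible by a nonnegative bubble function `b` and has vanishing moments of
the complementary degree is zero: test with the quotient. -/
lemma eq_zero_of_moment_eq_zero {e : ι} {n d : ℕ} {b r : ℝ[X]} (hb : b.natDegree = d) (hb0 : b ≠ 0)
    (hpos : ∀ s ∈ Icc (0 : ℝ) 1, 0 ≤ b.eval s)
    (hdeg : b * r ∈ Polynomial.degreeLT ℝ (n + d)) (hm : M.moment e n (b * r) = 0) :
    b * r = 0 := by
  rcases eq_or_ne r 0 with rfl | hr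
  · simp
  have hrn : r ∈ Polynomial.degreeLT ℝ n := by
    rw [Polynomial.mem_degreeLT, Polynomial.degree_eq_natDegree (mul_ne_zero hb0 hr),
      Polynomial.natDegree_mul hb0 hr] at hdeg
    rw [Polynomial.mem_degreeLT, Polynomial.degree_eq_natDegree hr]
    have : b.natDegree + r.natDegree < n + d := by exact_mod_cast hdeg
    exact_mod_cast (by omega : r.natDegree < n)
  have h1 := M.moment_apply e n (b * r) ⟨r, hrn⟩
  rw [hm, LinearMap.zero_apply] at h1
  have hc : Continuous fun s => (b * r).eval s * r.eval s :=
    (b * r).continuous.mul r.continuous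
  have hnn : 0 ≤ᵐ[M.arc e] fun s => (b * r).eval s * r.eval s := by
    filter_upwards [M.ae_arc_mem e] with s hs
    rw [Pi.zero_apply, Polynomial.eval_mul, mul_assoc]
    exact mul_nonneg (hpos s hs) (mul_self_nonneg _)
  have h2 := (integral_eq_zero_iff_of_nonneg_ae hnn (M.integrable_arc hc)).1 h1.symm
  have h3 : b * r * r = 0 := M.poly_eq_zero_of_ae (e := e) (by
    filter_upwards [h2] with s hs
    rw [Polynomial.eval_mul]
    exact hs)
  exact (mul_eq_zero.1 h3).resolve_right hr

lemma finrank_degreeLT (n : ℕ) : Module.finrank ℝ (Polynomial.degreeLT ℝ n) = n := by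
  rw [(Polynomial.degreeLTEquiv ℝ n).finrank_eq, Module.finrank_fin_fun]

instance finiteDimensional_degreeLT (n : ℕ) : FiniteDimensional ℝ (Polynomial.degreeLT ℝ n) :=
  LinearEquiv.finiteDimensional (Polynomial.degreeLTEquiv ℝ n).symm

lemma finrank_dual_degreeLT (n : ℕ) :
    Module.finrank ℝ (Module.Dual ℝ (Polynomial.degreeLT ℝ n)) = n := by
  rw [Subspace.dual_finrank_eq, finrank_degreeLT]

/-- The degrees of freedom of the normal component on an edge. -/
noncomputable def normalDof (e : ι) (n : ℕ) :
    ℝ[X] →ₗ[ℝ] ℝ × ℝ × Module.Dual ℝ (Polynomial.degreeLT ℝ n) :=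
  (Polynomial.leval 0).prod ((Polynomial.leval 1).prod (M.moment e n))

/-- The degrees of freedom of the function itself on an edge. -/
noncomputable def valueDof (e : ι) (n : ℕ) :
    ℝ[X] →ₗ[ℝ] (ℝ × ℝ) × (ℝ × ℝ) × Module.Dual ℝ (Polynomial.degreeLT ℝ n) :=
  ((Polynomial.leval 0).prod ((Polynomial.leval 0).comp Polynomial.derivative)).prod
    (((Polynomial.leval 1).prod ((Polynomial.leval 1).comp Polynomial.derivative)).prod
      (M.moment e n))

lemma eq_zero_of_normalDof {e : ι} {n : ℕ} {q : ℝ[X]} (hq : q ∈ Polynomial.degreeLT ℝ (n + 2))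
    (h : M.normalDof e n q = 0) : q = 0 := by
  have h0 : q.eval 0 = 0 := congrArg Prod.fst h
  have h1 : q.eval 1 = 0 := congrArg (fun x => x.2.1) h
  have hm : M.moment e n q = 0 := congrArg (fun x => x.2.2) h
  have hcop : IsCoprime (Polynomial.X - Polynomial.C (0 : ℝ)) (Polynomial.X - Polynomial.C 1) :=
    Polynomial.isCoprime_X_sub_C_of_isUnit_sub (by norm_num)
  obtain ⟨r, hr⟩ := hcop.mul_dvd (Polynomial.dvd_iff_isRoot.2 h0) (Polynomial.dvd_iff_isRoot.2 h1)
  have hb : q = -((Polynomial.X - Polynomial.C 0) * (Polynomial.X - Polynomial.C 1)) * -r := by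
    rw [hr]; ring
  have hmon : ((Polynomial.X - Polynomial.C (0 : ℝ)) * (Polynomial.X - Polynomial.C 1)).Monic :=
    (Polynomial.monic_X_sub_C _).mul (Polynomial.monic_X_sub_C _)
  rw [hb] at hq hm ⊢
  refine M.eq_zero_of_moment_eq_zero (e := e) (d := 2) ?_ (neg_ne_zero.2 hmon.ne_zero)
    (fun s hs => ?_) hq hm
  · rw [Polynomial.natDegree_neg,
      (Polynomial.monic_X_sub_C _).natDegree_mul (Polynomial.monic_X_sub_C _),
      Polynomial.natDegree_X_sub_C, Polynomial.natDegree_X_sub_C]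
  · simp only [Polynomial.eval_neg, Polynomial.eval_mul, Polynomial.eval_sub, Polynomial.eval_X,
      Polynomial.eval_C]
    nlinarith [hs.1, hs.2]

lemma eq_zero_of_valueDof {e : ι} {n : ℕ} {q : ℝ[X]} (hq : q ∈ Polynomial.degreeLT ℝ (n + 4))
    (h : M.valueDof e n q = 0) : q = 0 := by
  rcases eq_or_ne q 0 with rfl | hq0
  · rfl
  have h0 : q.eval 0 = 0 := congrArg (fun x => x.1.1) h
  have h0' : q.derivative.eval 0 = 0 := congrArg (fun x => x.1.2) h
  have h1 : q.eval 1 = 0 := congrArg (fun x => x.2.1.1) h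
  have h1' : q.derivative.eval 1 = 0 := congrArg (fun x => x.2.1.2) h
  have hm : M.moment e n q = 0 := congrArg (fun x => x.2.2) h
  have hcop : IsCoprime ((Polynomial.X - Polynomial.C (0 : ℝ)) ^ 2)
      ((Polynomial.X - Polynomial.C 1) ^ 2) :=
    (Polynomial.isCoprime_X_sub_C_of_isUnit_sub (by norm_num)).pow
  have hd : ∀ a : ℝ, q.eval a = 0 → q.derivative.eval a = 0 →
      (Polynomial.X - Polynomial.C a) ^ 2 ∣ q := fun a ha ha' =>
    (Polynomial.le_rootMultiplicity_iff hq0).1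
      ((Polynomial.one_lt_rootMultiplicity_iff_isRoot hq0).2 ⟨ha, ha'⟩)
  obtain ⟨r, hr⟩ := hcop.mul_dvd (hd 0 h0 h0') (hd 1 h1 h1')
  have hmon : ∀ a : ℝ, ((Polynomial.X - Polynomial.C a) ^ 2).Monic := fun a =>
    (Polynomial.monic_X_sub_C a).pow 2
  rw [hr] at hq hm ⊢
  refine M.eq_zero_of_moment_eq_zero (e := e) (d := 4) ?_ ((hmon 0).mul (hmon 1)).ne_zero
    (fun s hs => ?_) hq hm
  · rw [(hmon 0).natDegree_mul (hmon 1), (Polynomial.monic_X_sub_C _).natDegree_pow,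
      (Polynomial.monic_X_sub_C _).natDegree_pow, Polynomial.natDegree_X_sub_C,
      Polynomial.natDegree_X_sub_C]
  · simp only [Polynomial.eval_mul, Polynomial.eval_pow]
    positivity

lemma exists_normalDof_eq (e : ι) (n : ℕ)
    (x : ℝ × ℝ × Module.Dual ℝ (Polynomial.degreeLT ℝ n)) :
    ∃ q ∈ Polynomial.degreeLT ℝ (n + 2), M.normalDof e n q = x := by
  let T := (M.normalDof e n).comp (Polynomial.degreeLT ℝ (n + 2)).subtype
  have hinj : Function.Injective T := by
    rw [← LinearMap.ker_eq_bot, LinearMap.ker_eq_bot']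
    exact fun q hq => Subtype.ext (M.eq_zero_of_normalDof q.2 hq)
  have hsurj := (LinearMap.injective_iff_surjective_of_finrank_eq_finrank (f := T) (by
    simp only [Module.finrank_prod, finrank_dual_degreeLT, finrank_degreeLT, Module.finrank_self]
    omega)).1 hinj
  obtain ⟨q, hq⟩ := hsurj x
  exact ⟨q, q.2, hq⟩

lemma exists_valueDof_eq (e : ι) (n : ℕ)
    (x : (ℝ × ℝ) × (ℝ × ℝ) × Module.Dual ℝ (Polynomial.degreeLT ℝ n)) :
    ∃ q ∈ Polynomial.degreeLT ℝ (n + 4), M.valueDof e n q = x := by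
  let T := (M.valueDof e n).comp (Polynomial.degreeLT ℝ (n + 4)).subtype
  have hinj : Function.Injective T := by
    rw [← LinearMap.ker_eq_bot, LinearMap.ker_eq_bot']
    exact fun q hq => Subtype.ext (M.eq_zero_of_valueDof q.2 hq)
  have hsurj := (LinearMap.injective_iff_surjective_of_finrank_eq_finrank (f := T) (by
    simp only [Module.finrank_prod, finrank_dual_degreeLT, finrank_degreeLT, Module.finrank_self]
    omega)).1 hinj
  obtain ⟨q, hq⟩ := hsurj x
  exact ⟨q, q.2, hq⟩

end BoundaryMesh

/-! ### Functions on the boundary, edge by edge -/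

namespace BoundaryMesh

variable {Ω : Set Plane} {ι : Type*} (M : BoundaryMesh Ω ι)

/-- Functions on the closed edges that agree at common points are glued to a continuous function on
the boundary. -/
lemma exists_glue [Finite ι] {X : Type*} [TopologicalSpace X] [Inhabited X] {h : ι → ℝ → X}
    (hc : ∀ e, ContinuousOn (h e) (Icc 0 1))
    (hcomp : ∀ e e', ∀ s ∈ Icc (0 : ℝ) 1, ∀ s' ∈ Icc (0 : ℝ) 1, M.γ e s = M.γ e' s' →
      h e s = h e' s') :
    ∃ H : Plane → X, ContinuousOn H (frontier Ω) ∧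
      ∀ e, ∀ s ∈ Icc (0 : ℝ) 1, H (M.γ e s) = h e s := by
  classical
  let H : Plane → X := fun x =>
    if hx : ∃ es : ι × ℝ, es.2 ∈ Icc (0 : ℝ) 1 ∧ M.γ es.1 es.2 = x then
      h hx.choose.1 hx.choose.2 else default
  have hH : ∀ e, ∀ s ∈ Icc (0 : ℝ) 1, H (M.γ e s) = h e s := by
    intro e s hs
    have hx : ∃ es : ι × ℝ, es.2 ∈ Icc (0 : ℝ) 1 ∧ M.γ es.1 es.2 = M.γ e s := ⟨(e, s), hs, rfl⟩
    simp only [H, dif_pos hx]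
    exact hcomp _ _ _ hx.choose_spec.1 _ hs hx.choose_spec.2
  refine ⟨H, continuousOn_iff_isClosed.2 fun t ht => ?_, hH⟩
  refine ⟨⋃ e, M.γ e '' (Icc 0 1 ∩ h e ⁻¹' t), isClosed_iUnion_of_finite fun e => ?_, ?_⟩
  · have h1 : IsCompact (Icc 0 1 ∩ h e ⁻¹' t) :=
      isCompact_Icc.of_isClosed_subset ((hc e).preimage_isClosed_of_isClosed isClosed_Icc ht)
        inter_subset_left
    exact (h1.image_of_continuousOn
      ((M.smooth e).continuousOn.mono inter_subset_left)).isClosed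
  · ext x
    constructor
    · rintro ⟨hxt, hxf⟩
      refine ⟨?_, hxf⟩
      rw [← M.cover] at hxf
      obtain ⟨e, s, hs, rfl⟩ := mem_iUnion.1 hxf
      exact mem_iUnion.2 ⟨e, s, ⟨hs, by rw [mem_preimage, ← hH e s hs]; exact hxt⟩, rfl⟩
    · rintro ⟨hxt, hxf⟩
      refine ⟨?_, hxf⟩
      obtain ⟨e, s, ⟨hs, hst⟩, rfl⟩ := mem_iUnion.1 hxt
      rw [mem_preimage, hH e s hs]
      exact hst

/-- Edge functions with prescribed nodal values agree at common points. -/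
lemma compatible_of_nodal {X : Type*} {h : ι → ℝ → X} {d : Plane → X}
    (h0 : ∀ e, h e 0 = d (M.γ e 0)) (h1 : ∀ e, h e 1 = d (M.γ e 1)) (e e' : ι) {s s' : ℝ}
    (hs : s ∈ Icc (0 : ℝ) 1) (hs' : s' ∈ Icc (0 : ℝ) 1) (heq : M.γ e s = M.γ e' s') :
    h e s = h e' s' := by
  rcases eq_or_ne e e' with rfl | hne
  · rw [M.inj e hs hs' heq]
  have key : ∀ {e e' : ι} {s s' : ℝ}, s ∈ Icc (0 : ℝ) 1 → s' ∈ Icc (0 : ℝ) 1 → e ≠ e' →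
      M.γ e s = M.γ e' s' → h e s = d (M.γ e s) := by
    intro e e' s s' hs hs' hne heq
    obtain ⟨b, hb⟩ := M.exists_halfEdge_of_mem ⟨s, hs, rfl⟩ (Or.inr ⟨e', hne, s', hs', heq.symm⟩)
    have := M.inj e (param_mem (left_mem_Icc.2 zero_le_one)) hs hb
    cases b
    · have : s = 0 := by simpa using this.symm
      rw [this, h0]
    · have : s = 1 := by simpa using this.symm
      rw [this, h1]
  rw [key hs hs' hne heq, key hs' hs hne.symm heq.symm, heq]

lemma ae_arc_mem_Ioo (e : ι) : ∀ᵐ s ∂M.arc e, s ∈ Ioo (0 : ℝ) 1 := by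
  refine (withDensity_absolutelyContinuous _ _).ae_le ?_
  rw [← restrict_Ioo_eq_restrict_Icc]
  exact ae_restrict_mem measurableSet_Ioo

/-- Continuous functions on the closed edges define an element of `L₂(Γ)`. -/
lemma exists_L2Γ [Fintype ι] {h : ι → ℝ → ℝ} (hc : ∀ e, ContinuousOn (h e) (Icc 0 1)) :
    ∃ L : M.L2Γ, ∀ e, ∀ᵐ s ∂M.arc e, L (M.γ e s) = h e s := by
  classical
  have hfin : IsFiniteMeasure M.surf := by
    unfold surf
    infer_instance
  -- the transport of `h e` to the closed edge
  have hex : ∀ e, ∃ H : Plane → ℝ, ContinuousOn H (M.γ e '' Icc 0 1) ∧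
      ∀ s ∈ Icc (0 : ℝ) 1, H (M.γ e s) = h e s := by
    intro e
    refine ⟨fun x => h e (Function.invFunOn (M.γ e) (Icc 0 1) x), ?_, fun s hs => ?_⟩
    · rw [continuousOn_iff_isClosed]
      intro t ht
      refine ⟨M.γ e '' (Icc 0 1 ∩ h e ⁻¹' t), ?_, ?_⟩
      · have h1 : IsCompact (Icc 0 1 ∩ h e ⁻¹' t) :=
          isCompact_Icc.of_isClosed_subset
            ((hc e).preimage_isClosed_of_isClosed isClosed_Icc ht) inter_subset_left
        exact (h1.image_of_continuousOn
          ((M.smooth e).continuousOn.mono inter_subset_left)).isClosed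
      · ext x
        constructor
        · rintro ⟨hxt, s, hs, rfl⟩
          refine ⟨⟨s, ⟨hs, ?_⟩, rfl⟩, s, hs, rfl⟩
          rw [mem_preimage, (M.inj e).leftInvOn_invFunOn hs] at hxt
          exact hxt
        · rintro ⟨⟨s, ⟨hs, hst⟩, rfl⟩, hx⟩
          refine ⟨?_, hx⟩
          rw [mem_preimage, (M.inj e).leftInvOn_invFunOn hs]
          exact hst
    · simp only [(M.inj e).leftInvOn_invFunOn hs]
  choose H hHc hH using hex
  let ψ : Plane → ℝ := fun x => ∑ e, (M.γ e '' Icc 0 1).indicator (H e) x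
  have hψ : MemLp ψ 2 M.surf := by
    refine memLp_finsetSum _ fun e _ => ?_
    obtain ⟨B, hB⟩ := (M.isCompact_edge e).exists_bound_of_continuousOn (hHc e)
    have hm : Measurable ((M.γ e '' Icc 0 1).indicator (H e)) := by
      rw [← piecewise_eq_indicator]
      exact (hHc e).measurable_piecewise continuousOn_const (M.isCompact_edge e).measurableSet
    refine MemLp.of_bound hm.aestronglyMeasurable (max B 0) (Eventually.of_forall fun x => ?_)
    by_cases hx : x ∈ M.γ e '' Icc 0 1
    · rw [indicator_of_mem hx]
      exact (hB x hx).trans (le_max_left _ _)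
    · rw [indicator_of_notMem hx, norm_zero]
      exact le_max_right _ _
  refine ⟨hψ.toLp ψ, fun e => ?_⟩
  filter_upwards [M.ae_edge hψ.coeFn_toLp e, M.ae_arc_mem_Ioo e] with s h1 hs
  rw [h1]
  have hs' := Ioo_subset_Icc_self hs
  change ∑ e', (M.γ e' '' Icc 0 1).indicator (H e') (M.γ e s) = h e s
  rw [Finset.sum_eq_single e, indicator_of_mem (mem_image_of_mem _ hs'), hH e s hs']
  · intro e' _ hne
    refine indicator_of_notMem (fun hmem => ?_) _
    exact disjoint_left.1 (M.disj e e' hne.symm) ⟨s, hs, rfl⟩ hmem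
  · simp

lemma ae_surf_of_forall [Finite ι] {P : Plane → Prop} (hP : MeasurableSet {x | P x})
    (h : ∀ e, ∀ᵐ s ∂M.arc e, P (M.γ e s)) : ∀ᵐ x ∂M.surf, P x := by
  rw [surf, Measure.ae_sum_iff]
  exact fun e => (ae_map_iff (M.aemeasurable_γ e) hP).2 (h e)

/-- Elements of `L₂(Γ)` are determined by their values on the edges. -/
lemma L2Γ_ext [Finite ι] {L L' : M.L2Γ}
    (h : ∀ e, ∀ᵐ s ∂M.arc e, L (M.γ e s) = L' (M.γ e s)) : L = L' :=
  Lp.ext (M.ae_surf_of_forall (measurableSet_eq_fun (Lp.stronglyMeasurable L).measurable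
    (Lp.stronglyMeasurable L').measurable) h)

lemma ae_eq_of_forall [Finite ι] {L : M.L2Γ} {φ : Plane → ℝ} (hφ : ContinuousOn φ (frontier Ω))
    (h : ∀ e, ∀ᵐ s ∂M.arc e, L (M.γ e s) = φ (M.γ e s)) : L =ᵐ[M.surf] φ := by
  classical
  have hfr : MeasurableSet (frontier Ω) := isClosed_frontier.measurableSet
  have hm : Measurable ((frontier Ω).indicator φ) := by
    rw [← piecewise_eq_indicator]
    exact hφ.measurable_piecewise continuousOn_const hfr
  have h1 : ∀ᵐ x ∂M.surf, x ∈ frontier Ω := M.ae_surf_of_forall hfr fun e =>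
    (M.ae_arc_mem e).mono fun s hs => M.γ_mem e hs
  have h2 : ∀ᵐ x ∂M.surf, L x = (frontier Ω).indicator φ x :=
    M.ae_surf_of_forall (measurableSet_eq_fun (Lp.stronglyMeasurable L).measurable hm) fun e => by
      filter_upwards [h e, M.ae_arc_mem e] with s hs hs'
      rw [hs, indicator_of_mem (M.γ_mem e hs')]
  filter_upwards [h1, h2] with x hx1 hx2
  rw [hx2, indicator_of_mem hx1]

/-! ### Gradients on the boundary -/

/-- The vector with tangential component `a` and normal component `b` at the point `γ_E(s)`. -/
noncomputable def jet (e : ι) (a b s : ℝ) : Fin 2 → ℝ :=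
  Matrix.vecMul ![a, b] (M.frame e s)

lemma jet_zero (e : ι) (a b s : ℝ) :
    M.jet e a b s 0 = a * M.tangent e s 0 + b * M.tangent e s 1 := by
  simp [jet, frame, normal, rotCW, Matrix.vecMul, dotProduct, Fin.sum_univ_two]

lemma jet_one (e : ι) (a b s : ℝ) :
    M.jet e a b s 1 = a * M.tangent e s 1 - b * M.tangent e s 0 := by
  simp [jet, frame, normal, rotCW, Matrix.vecMul, dotProduct, Fin.sum_univ_two]
  ring

lemma tangent_sq (e : ι) {s : ℝ} (hs : s ∈ Icc (0 : ℝ) 1) :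
    M.tangent e s 0 ^ 2 + M.tangent e s 1 ^ 2 = 1 := by
  have h1 : ‖M.tangent e s‖ = 1 := by
    rw [tangent, norm_smul, norm_inv, norm_norm, inv_mul_cancel₀ (M.norm_vel_pos e hs).ne']
  have h2 := EuclideanSpace.norm_sq_eq (M.tangent e s)
  rw [h1, Fin.sum_univ_two] at h2
  simpa using h2.symm

lemma vel_eq (e : ι) {s : ℝ} (hs : s ∈ Icc (0 : ℝ) 1) :
    M.vel e s = ‖M.vel e s‖ • M.tangent e s := by
  rw [tangent, smul_smul, mul_inv_cancel₀ (M.norm_vel_pos e hs).ne', one_smul]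

lemma jet_injective (e : ι) {a b s : ℝ} (hs : s ∈ Icc (0 : ℝ) 1) (h : M.jet e a b s = 0) :
    a = 0 ∧ b = 0 := by
  have h0 := congrFun h 0
  have h1 := congrFun h 1
  rw [jet_zero, Pi.zero_apply] at h0
  rw [jet_one, Pi.zero_apply] at h1
  have ht := M.tangent_sq e hs
  set t := M.tangent e s
  constructor
  · calc a = a * (t 0 ^ 2 + t 1 ^ 2) := by rw [ht, mul_one]
      _ = (a * t 0 + b * t 1) * t 0 + (a * t 1 - b * t 0) * t 1 := by ring
      _ = 0 := by rw [h0, h1]; ring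
  · calc b = b * (t 0 ^ 2 + t 1 ^ 2) := by rw [ht, mul_one]
      _ = (a * t 0 + b * t 1) * t 1 - (a * t 1 - b * t 0) * t 0 := by ring
      _ = 0 := by rw [h0, h1]; ring

lemma exists_jet_eq (e : ι) {s : ℝ} (hs : s ∈ Icc (0 : ℝ) 1) (w : Fin 2 → ℝ) :
    ∃ a b, M.jet e a b s = w := by
  have ht := M.tangent_sq e hs
  refine ⟨w 0 * M.tangent e s 0 + w 1 * M.tangent e s 1,
    w 0 * M.tangent e s 1 - w 1 * M.tangent e s 0, ?_⟩
  funext i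
  fin_cases i
  · change M.jet e _ _ s 0 = w 0
    rw [jet_zero]
    linear_combination w 0 * ht
  · change M.jet e _ _ s 1 = w 1
    rw [jet_one]
    linear_combination w 1 * ht

lemma inner_jet_vel (e : ι) {a b s : ℝ} (hs : s ∈ Icc (0 : ℝ) 1) :
    inner ℝ (WithLp.toLp 2 (M.jet e a b s) : Plane) (M.vel e s) = a * ‖M.vel e s‖ := by
  have ht := M.tangent_sq e hs
  rw [M.vel_eq e hs, inner_smul_right, norm_smul, norm_norm]
  have h1 : ‖M.tangent e s‖ = 1 := by
    rw [tangent, norm_smul, norm_inv, norm_norm, inv_mul_cancel₀ (M.norm_vel_pos e hs).ne']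
  rw [h1, PiLp.inner_apply, Fin.sum_univ_two]
  simp only [jet_zero, jet_one, RCLike.inner_apply, conj_trivial]
  linear_combination ‖M.vel e s‖ * a * ht

lemma inner_jet_normal (e : ι) {a b s : ℝ} (hs : s ∈ Icc (0 : ℝ) 1) :
    inner ℝ (WithLp.toLp 2 (M.jet e a b s) : Plane) (M.normal e s) = b := by
  have ht := M.tangent_sq e hs
  rw [PiLp.inner_apply, Fin.sum_univ_two]
  simp only [jet_zero, jet_one, RCLike.inner_apply, conj_trivial, normal, rotCW]
  simp
  linear_combination b * ht

lemma contDiffOn_vel (e : ι) : ContDiffOn ℝ ∞ (M.vel e) (Icc 0 1) :=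
  (M.smooth e).derivWithin (uniqueDiffOn_Icc one_pos) (by simp)

lemma contDiffOn_norm_vel (e : ι) : ContDiffOn ℝ ∞ (fun s => ‖M.vel e s‖) (Icc 0 1) :=
  (M.contDiffOn_vel e).norm ℝ fun s hs => M.regular e s hs

lemma contDiffOn_tangent (e : ι) : ContDiffOn ℝ ∞ (M.tangent e) (Icc 0 1) :=
  ((M.contDiffOn_norm_vel e).inv fun _ hs => (M.norm_vel_pos e hs).ne').smul (M.contDiffOn_vel e)

/-- The gradient along the edge `e` of a function with boundary values `q₀` and normal derivative
`qₙ` (in the parameter of the edge) is smooth. -/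
lemma contDiffOn_jet (e : ι) (q₀ qₙ : ℝ[X]) :
    ContDiffOn ℝ ∞ (fun s => M.jet e (q₀.derivative.eval s / ‖M.vel e s‖) (qₙ.eval s) s)
      (Icc 0 1) := by
  have ht := contDiffOn_euclidean.1 (M.contDiffOn_tangent e)
  have hp : ∀ q : ℝ[X], ContDiffOn ℝ ∞ (fun s => q.eval s) (Icc 0 1) := fun q => by
    simpa using (q.contDiff_aeval (R := ℝ) (𝕜 := ℝ) ∞).contDiffOn (s := Icc 0 1)
  have ha : ContDiffOn ℝ ∞ (fun s => q₀.derivative.eval s / ‖M.vel e s‖) (Icc 0 1) :=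
    (hp q₀.derivative).div (M.contDiffOn_norm_vel e)
      fun _ hs => (M.norm_vel_pos e hs).ne'
  rw [contDiffOn_pi]
  intro i
  fin_cases i
  · simp only [Fin.zero_eta, jet_zero]
    exact (ha.mul (ht 0)).add ((hp qₙ).mul (ht 1))
  · simp only [Fin.mk_one, jet_one]
    exact (ha.mul (ht 1)).sub ((hp qₙ).mul (ht 0))

/-! ### The space `Y_h` in terms of polynomials on the edges -/

/-- The pair `v` has the continuous representatives `φ` and `g`, and it is given by the polynomials
`q₀ e` and `qₙ e` on the edge `e`. -/
structure IsPolyRep (v : M.L2Γ × M.L2Γ) (φ : Plane → ℝ) (g : Plane → Fin 2 → ℝ)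
    (q₀ qₙ : ι → ℝ[X]) : Prop where
  cont_fst : ContinuousOn φ (frontier Ω)
  cont_snd : ContinuousOn g (frontier Ω)
  eq_fst : ∀ e, ∀ s ∈ Icc (0 : ℝ) 1, φ (M.γ e s) = (q₀ e).eval s
  eq_snd : ∀ e, ∀ s ∈ Icc (0 : ℝ) 1, g (M.γ e s) =
    M.jet e ((q₀ e).derivative.eval s / ‖M.vel e s‖) ((qₙ e).eval s) s
  ae_fst : ∀ e, ∀ᵐ s ∂M.arc e, v.1 (M.γ e s) = (q₀ e).eval s
  ae_snd : ∀ e, ∀ᵐ s ∂M.arc e, v.2 (M.γ e s) = (qₙ e).eval s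

variable {M}

lemma dt_eq {φ : Plane → ℝ} {e : ι} {q : ℝ[X]}
    (h : ∀ s ∈ Icc (0 : ℝ) 1, φ (M.γ e s) = q.eval s) {s : ℝ} (hs : s ∈ Icc (0 : ℝ) 1) :
    M.dt e φ s = q.derivative.eval s / ‖M.vel e s‖ := by
  rw [dt, derivWithin_congr h (h s hs),
    (q.hasDerivAt s).hasDerivWithinAt.derivWithin (uniqueDiffOn_Icc one_pos s hs)]

/-- The almost everywhere identities for the continuous representatives hold at every point of the
closed edges, by continuity. -/
lemma IsContRep.exists_isPolyRep {v : M.L2Γ × M.L2Γ} {φ : Plane → ℝ} {g : Plane → Fin 2 → ℝ}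
    (h : M.IsContRep v φ g) {k m : ℕ} (hk : M.IsPiecewisePoly k v.1)
    (hm : M.IsPiecewisePoly m v.2) :
    ∃ q₀ qₙ : ι → ℝ[X], M.IsPolyRep v φ g q₀ qₙ ∧ (∀ e, (q₀ e).natDegree ≤ k) ∧
      ∀ e, (qₙ e).natDegree ≤ m := by
  choose q₀ hq₀ hq₀' using hk
  choose qₙ hqₙ hqₙ' using hm
  have h1 : ∀ e, ∀ s ∈ Icc (0 : ℝ) 1, φ (M.γ e s) = (q₀ e).eval s := fun e =>
    M.eqOn_of_ae_arc_eq (e := e) (M.continuousOn_comp h.cont_fst e) (q₀ e).continuous.continuousOn (by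
      filter_upwards [M.ae_edge h.ae_fst e, hq₀' e] with s hs hs'
      rw [← hs, hs'])
  refine ⟨q₀, qₙ, ⟨h.cont_fst, h.cont_snd, h1, fun e s hs => ?_, hq₀', hqₙ'⟩, hq₀, hqₙ⟩
  have hgc : ContinuousOn (fun s => g (M.γ e s)) (Icc 0 1) :=
    h.cont_snd.comp (M.smooth e).continuousOn fun _ hs => M.γ_mem e hs
  have hjc := (M.contDiffOn_jet e (q₀ e) (qₙ e)).continuousOn
  funext i
  refine M.eqOn_of_ae_arc_eq (e := e) (continuousOn_pi.1 hgc i) (continuousOn_pi.1 hjc i) ?_ hs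
  filter_upwards [h.ae_snd e, hqₙ' e, M.ae_arc_mem e] with s h2 h3 h4
  rw [← h2, h3, dt_eq (h1 e) h4]
  rfl

lemma IsPolyRep.isContRep [Finite ι] {v : M.L2Γ × M.L2Γ} {φ : Plane → ℝ} {g : Plane → Fin 2 → ℝ}
    {q₀ qₙ : ι → ℝ[X]} (h : M.IsPolyRep v φ g q₀ qₙ) : M.IsContRep v φ g := by
  refine ⟨h.cont_fst, M.ae_eq_of_forall h.cont_fst fun e => ?_, h.cont_snd, fun e => ?_⟩
  · filter_upwards [h.ae_fst e, M.ae_arc_mem e] with s h1 h2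
    rw [h1, h.eq_fst e s h2]
  · filter_upwards [h.ae_snd e, M.ae_arc_mem e] with s h1 h2
    rw [h1, h.eq_snd e s h2, dt_eq (h.eq_fst e) h2]
    rfl

/-- The Whitney extension of the boundary data: elements of `Y_h` are traces of `C^{1,1}`
functions. -/
lemma IsPolyRep.exists_isC11 [Finite ι] (hΩ : IsOpen Ω) (hl : IsLipschitzSet Ω)
    (hb : Bornology.IsBounded Ω) (hne : (frontier Ω).Nonempty) {v : M.L2Γ × M.L2Γ}
    {φ : Plane → ℝ} {g : Plane → Fin 2 → ℝ} {q₀ qₙ : ι → ℝ[X]}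
    (h : M.IsPolyRep v φ g q₀ qₙ) :
    ∃ F, IsC11 F ∧ (∀ e, ∀ᵐ s ∂M.arc e, v.1 (M.γ e s) = F (M.γ e s)) ∧
      ∀ e, ∀ᵐ s ∂M.arc e, v.2 (M.γ e s) = fderiv ℝ F (M.γ e s) (M.normal e s) := by
  have hbf : Bornology.IsBounded (frontier Ω) := hb.closure.subset frontier_subset_closure
  have hcf : IsCompact (frontier Ω) :=
    Metric.isCompact_of_isClosed_isBounded isClosed_frontier hbf
  let G : Plane → Plane := fun x => WithLp.toLp 2 (g x)
  have hGc : ContinuousOn G (frontier Ω) :=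
    (PiLp.continuous_toLp 2 _).comp_continuousOn h.cont_snd
  obtain ⟨B₁, hB₁⟩ := hcf.exists_bound_of_continuousOn h.cont_fst
  obtain ⟨B₂, hB₂⟩ := hcf.exists_bound_of_continuousOn hGc
  have hφB : ∀ x ∈ frontier Ω, |φ x| ≤ max B₁ B₂ := fun x hx =>
    (hB₁ x hx).trans (le_max_left _ _)
  have hGB : ∀ x ∈ frontier Ω, ‖G x‖ ≤ max B₁ B₂ := fun x hx =>
    (hB₂ x hx).trans (le_max_right _ _)
  have hedge : ∀ e, ∃ C, ∀ x ∈ M.γ e '' Icc 0 1, ∀ y ∈ M.γ e '' Icc 0 1,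
      WhitneyPair φ G C x y := by
    intro e
    have hsm : ContDiffOn ℝ 1 (fun s => G (M.γ e s)) (Icc 0 1) := by
      have h1 := (M.contDiffOn_jet e (q₀ e) (qₙ e)).of_le (m := 1) (by simp)
      rw [contDiffOn_euclidean]
      intro i
      refine (contDiffOn_pi.1 h1 i).congr fun s hs => ?_
      simp only [G, h.eq_snd e s hs]
    obtain ⟨L, hL⟩ := (hsm.locallyLipschitzOn
      (convex_Icc _ _)).exists_lipschitzOnWith_of_compact isCompact_Icc
    refine M.exists_whitneyPair_edge e hL fun s hs => ?_
    have h2 : inner ℝ (G (M.γ e s)) (M.vel e s) = (q₀ e).derivative.eval s := by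
      simp only [G, h.eq_snd e s hs]
      rw [M.inner_jet_vel e hs, div_mul_cancel₀ _ (M.norm_vel_pos e hs).ne']
    rw [h2]
    exact ((q₀ e).hasDerivAt s).hasDerivWithinAt.congr (h.eq_fst e) (h.eq_fst e s hs)
  obtain ⟨C, hC⟩ := M.exists_whitneyPair_frontier hΩ hl hφB hGB hedge
  obtain ⟨F, hF, hF'⟩ := exists_isC11_extension hne hbf hφB hGB hC
  refine ⟨F, hF, fun e => ?_, fun e => ?_⟩
  · filter_upwards [h.ae_fst e, M.ae_arc_mem e] with s h1 hs
    rw [h1, (hF' _ (M.γ_mem e hs)).1, h.eq_fst e s hs]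
  · filter_upwards [h.ae_snd e, M.ae_arc_mem e] with s h1 hs
    rw [h1, (hF' _ (M.γ_mem e hs)).2]
    simp only [G, h.eq_snd e s hs]
    rw [M.inner_jet_normal e hs]

end BoundaryMesh

/-! ### The embedding into the trace space -/

namespace BoundaryMesh

variable {Ω : Set Plane} {ι : Type*} {M : BoundaryMesh Ω ι}

/-- The pair `w` consists of the restriction and of the normal derivative of `F` on `Γ`. -/
structure IsClassicalTrace (w : M.L2Γ × M.L2Γ) (F : Plane → ℝ) : Prop where
  value : ∀ e, ∀ᵐ s ∂M.arc e, w.1 (M.γ e s) = F (M.γ e s)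
  normal : ∀ e, ∀ᵐ s ∂M.arc e, w.2 (M.γ e s) = fderiv ℝ F (M.γ e s) (M.normal e s)

lemma IsClassicalTrace.add {w w' : M.L2Γ × M.L2Γ} {F F' : Plane → ℝ}
    (h : IsClassicalTrace w F) (h' : IsClassicalTrace w' F') (hF : Differentiable ℝ F)
    (hF' : Differentiable ℝ F') : IsClassicalTrace (w + w') (F + F') := by
  refine ⟨fun e => ?_, fun e => ?_⟩
  · filter_upwards [M.ae_edge (Lp.coeFn_add w.1 w'.1) e, h.value e, h'.value e] with s h1 h2 h3
    rw [Prod.fst_add, h1, Pi.add_apply, Pi.add_apply, h2, h3]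
  · filter_upwards [M.ae_edge (Lp.coeFn_add w.2 w'.2) e, h.normal e, h'.normal e] with s h1 h2 h3
    rw [Prod.snd_add, h1, Pi.add_apply, fderiv_add (hF _) (hF' _), h2, h3]
    rfl

lemma IsClassicalTrace.smul {w : M.L2Γ × M.L2Γ} {F : Plane → ℝ} (c : ℝ)
    (h : IsClassicalTrace w F) (hF : Differentiable ℝ F) : IsClassicalTrace (c • w) (c • F) := by
  refine ⟨fun e => ?_, fun e => ?_⟩
  · filter_upwards [M.ae_edge (Lp.coeFn_smul c w.1) e, h.value e] with s h1 h2
    rw [Prod.smul_fst, h1, Pi.smul_apply, Pi.smul_apply, h2]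
  · filter_upwards [M.ae_edge (Lp.coeFn_smul c w.2) e, h.normal e] with s h1 h2
    rw [Prod.smul_snd, h1, Pi.smul_apply, fderiv_const_smul (hF _), h2]
    rfl

lemma IsClassicalTrace.zero : IsClassicalTrace (0 : M.L2Γ × M.L2Γ) 0 := by
  refine ⟨fun e => ?_, fun e => ?_⟩
  · exact M.ae_edge (Lp.coeFn_zero ℝ 2 M.surf) e
  · filter_upwards [M.ae_edge (Lp.coeFn_zero ℝ 2 M.surf) e] with s hs
    rw [Prod.snd_zero, hs, Pi.zero_apply, fderiv_zero, Pi.zero_apply, zero_apply]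

/-- The pairs `(v, y)` such that `v ∈ H²(Ω)` has a `C^{1,1}` representative with the boundary
data `y ∈ Y_h`. -/
noncomputable def liftGraph (M : BoundaryMesh Ω ι) (p : ℕ) : Submodule ℝ (H2 Ω × M.Yh p) where
  carrier := {vy | ∃ F, IsRep vy.1 F ∧ IsClassicalTrace (vy.2 : M.L2Γ × M.L2Γ) F}
  add_mem' := by
    rintro a b ⟨F, hF, hF'⟩ ⟨G, hG, hG'⟩
    exact ⟨F + G, hF.add hG, hF'.add hG' hF.isC11.differentiable hG.isC11.differentiable⟩
  zero_mem' := ⟨0, IsRep.zero, IsClassicalTrace.zero⟩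
  smul_mem' := by
    rintro c a ⟨F, hF, hF'⟩
    exact ⟨c • F, hF.smul c, hF'.smul c hF.isC11.differentiable⟩

lemma exists_mem_liftGraph [Finite ι] (hΩ : IsOpen Ω) (hne : Ω.Nonempty)
    (hb : Bornology.IsBounded Ω) (hl : IsLipschitzSet Ω) {p : ℕ} (y : M.Yh p) :
    ∃ v : H2 Ω, (v, y) ∈ M.liftGraph p := by
  have hfr : (frontier Ω).Nonempty := by
    refine nonempty_frontier_iff.2 ⟨hne, fun h => ?_⟩
    rw [h] at hb
    exact NormedSpace.unbounded_univ ℝ Plane hb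
  obtain ⟨h1, h2, φ, g, h⟩ := y.2
  obtain ⟨q₀, qₙ, hq, -, -⟩ := h.exists_isPolyRep h1 h2
  obtain ⟨F, hF, hF1, hF2⟩ := hq.exists_isC11 hΩ hl hb hfr
  obtain ⟨v, hv⟩ := hF.exists_isRep hb
  exact ⟨v, F, hv, hF1, hF2⟩

/-- A linear choice of `H²` extensions embeds `Y_h` in the trace space: if the trace functional of
the extension vanishes, then so do its boundary values and its gradient on `Γ`. -/
theorem exists_embedding [Finite ι] (hΩ : IsOpen Ω) (hne : Ω.Nonempty)
    (hb : Bornology.IsBounded Ω) (hl : IsLipschitzSet Ω) (p : ℕ) :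
    ∃ J : M.Yh p →ₗ[ℝ] H32 Ω, Function.Injective J ∧
      ∀ y : M.Yh p, ∃ v : H2 Ω, (J y : HdivDiv Ω →L[ℝ] ℝ) = trGg Ω v ∧ M.HasTrace v y := by
  let π : M.liftGraph p →ₗ[ℝ] M.Yh p := (LinearMap.snd ℝ _ _).comp (M.liftGraph p).subtype
  have hπ : LinearMap.range π = ⊤ := by
    rw [LinearMap.range_eq_top]
    intro y
    obtain ⟨v, hv⟩ := exists_mem_liftGraph hΩ hne hb hl y
    exact ⟨⟨(v, y), hv⟩, rfl⟩
  -- a linear choice of extensions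
  obtain ⟨σ, hσ⟩ := π.exists_rightInverse_of_surjective hπ
  have hσ' : ∀ y, (σ y).1.2 = y := fun y => LinearMap.congr_fun hσ y
  let V : M.Yh p →ₗ[ℝ] H2 Ω := (LinearMap.fst ℝ _ _).comp ((M.liftGraph p).subtype.comp σ)
  have hV : ∀ y : M.Yh p, ∃ F, IsRep (V y) F ∧ IsClassicalTrace (y : M.L2Γ × M.L2Γ) F := by
    intro y
    obtain ⟨F, h1, h2⟩ := (σ y).2
    rw [hσ' y] at h2
    exact ⟨F, h1, h2⟩
  refine ⟨(trGg Ω).rangeRestrict.comp V, ?_, fun y => ?_⟩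
  · refine (injective_iff_map_eq_zero _).2 fun y hy => ?_
    obtain ⟨F, h1, h2⟩ := hV y
    have h0 : trGg Ω (V y) = 0 := congrArg Subtype.val hy
    have h3 : ∀ x ∈ frontier Ω, F x = 0 ∧ fderiv ℝ F x = 0 := fun x hx =>
      h1.vanish_on_frontier hΩ hb hl h0 hx
    refine Subtype.ext (Prod.ext (M.L2Γ_ext fun e => ?_) (M.L2Γ_ext fun e => ?_))
    · filter_upwards [h2.value e, M.ae_arc_mem e, M.ae_edge (Lp.coeFn_zero ℝ 2 M.surf) e]
        with s h4 h5 h6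
      rw [h4, (h3 _ (M.γ_mem e h5)).1]
      exact h6.symm
    · filter_upwards [h2.normal e, M.ae_arc_mem e, M.ae_edge (Lp.coeFn_zero ℝ 2 M.surf) e]
        with s h4 h5 h6
      rw [h4, (h3 _ (M.γ_mem e h5)).2]
      exact h6.symm
  · obtain ⟨F, h1, h2⟩ := hV y
    exact ⟨V y, rfl, M.hasTrace_of_isRep hb h1 h2.value h2.normal⟩

/-! ### Degrees of freedom -/

lemma jet_add (e : ι) (a a' b b' s : ℝ) :
    M.jet e (a + a') (b + b') s = M.jet e a b s + M.jet e a' b' s := by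
  rw [jet, jet, jet, ← Matrix.add_vecMul]
  simp

lemma jet_smul (e : ι) (c a b s : ℝ) : M.jet e (c * a) (c * b) s = c • M.jet e a b s := by
  rw [jet, jet, ← Matrix.smul_vecMul]
  simp

lemma IsPolyRep.add {v w : M.L2Γ × M.L2Γ} {φ ψ : Plane → ℝ} {g k : Plane → Fin 2 → ℝ}
    {q₀ qₙ r₀ rₙ : ι → ℝ[X]} (h : M.IsPolyRep v φ g q₀ qₙ) (h' : M.IsPolyRep w ψ k r₀ rₙ) :
    M.IsPolyRep (v + w) (φ + ψ) (g + k) (q₀ + r₀) (qₙ + rₙ) := by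
  refine ⟨h.cont_fst.add h'.cont_fst, h.cont_snd.add h'.cont_snd, fun e s hs => ?_,
    fun e s hs => ?_, fun e => ?_, fun e => ?_⟩
  · simp [h.eq_fst e s hs, h'.eq_fst e s hs]
  · rw [Pi.add_apply, h.eq_snd e s hs, h'.eq_snd e s hs, ← jet_add, ← add_div]
    simp
  · filter_upwards [M.ae_edge (Lp.coeFn_add v.1 w.1) e, h.ae_fst e, h'.ae_fst e] with s h1 h2 h3
    rw [Prod.fst_add, h1, Pi.add_apply, Pi.add_apply, h2, h3, Polynomial.eval_add]
  · filter_upwards [M.ae_edge (Lp.coeFn_add v.2 w.2) e, h.ae_snd e, h'.ae_snd e] with s h1 h2 h3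
    rw [Prod.snd_add, h1, Pi.add_apply, Pi.add_apply, h2, h3, Polynomial.eval_add]

lemma IsPolyRep.smul {v : M.L2Γ × M.L2Γ} {φ : Plane → ℝ} {g : Plane → Fin 2 → ℝ}
    {q₀ qₙ : ι → ℝ[X]} (c : ℝ) (h : M.IsPolyRep v φ g q₀ qₙ) :
    M.IsPolyRep (c • v) (c • φ) (c • g) (c • q₀) (c • qₙ) := by
  refine ⟨h.cont_fst.const_smul c, h.cont_snd.const_smul c, fun e s hs => ?_,
    fun e s hs => ?_, fun e => ?_, fun e => ?_⟩
  · simp [h.eq_fst e s hs]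
  · rw [Pi.smul_apply, h.eq_snd e s hs, ← jet_smul]
    simp [mul_div_assoc]
  · filter_upwards [M.ae_edge (Lp.coeFn_smul c v.1) e, h.ae_fst e] with s h1 h2
    rw [Prod.smul_fst, h1, Pi.smul_apply, Pi.smul_apply, h2, Polynomial.eval_smul]
  · filter_upwards [M.ae_edge (Lp.coeFn_smul c v.2) e, h.ae_snd e] with s h1 h2
    rw [Prod.smul_snd, h1, Pi.smul_apply, Pi.smul_apply, h2, Polynomial.eval_smul]

lemma IsPolyRep.zero : M.IsPolyRep 0 0 0 0 0 := by
  refine ⟨continuousOn_const, continuousOn_const, fun e s _ => by simp, fun e s _ => ?_,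
    fun e => ?_, fun e => ?_⟩
  · have := M.jet_smul e 0 0 0 s
    simpa using this.symm
  · filter_upwards [M.ae_edge (Lp.coeFn_zero ℝ 2 M.surf) e] with s hs
    simpa using hs
  · filter_upwards [M.ae_edge (Lp.coeFn_zero ℝ 2 M.surf) e] with s hs
    simpa using hs

lemma IsPolyRep.eq_zero {φ : Plane → ℝ} {g : Plane → Fin 2 → ℝ} {q₀ qₙ : ι → ℝ[X]}
    (h : M.IsPolyRep 0 φ g q₀ qₙ) : q₀ = 0 ∧ qₙ = 0 ∧ ∀ x ∈ frontier Ω, φ x = 0 ∧ g x = 0 := by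
  have h0 : q₀ = 0 := funext fun e => M.poly_eq_zero_of_ae (e := e) (by
    filter_upwards [M.ae_edge (Lp.coeFn_zero ℝ 2 M.surf) e, h.ae_fst e] with s h1 h2
    rw [← h2]
    exact h1)
  have hn : qₙ = 0 := funext fun e => M.poly_eq_zero_of_ae (e := e) (by
    filter_upwards [M.ae_edge (Lp.coeFn_zero ℝ 2 M.surf) e, h.ae_snd e] with s h1 h2
    rw [← h2]
    exact h1)
  subst h0 hn
  refine ⟨rfl, rfl, fun x hx => ?_⟩
  rw [← M.cover] at hx
  obtain ⟨e, s, hs, rfl⟩ := mem_iUnion.1 hx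
  rw [h.eq_fst e s hs, h.eq_snd e s hs]
  have := M.jet_smul e 0 0 0 s
  simpa using this

/-- The values `d` of the degrees of freedom of `v`, expressed by the polynomials that represent
`v` on the edges. Their degrees are at most `p + 2 + δ_{p0}`, which is `(p - 1) + 3` in truncated
subtraction, and `p + 1`. -/
def IsDof {p : ℕ} (v : M.L2Γ × M.L2Γ) (d : M.DofSpace p) : Prop :=
  ∃ φ g q₀ qₙ, M.IsPolyRep v φ g q₀ qₙ ∧
    (∀ e, q₀ e ∈ Polynomial.degreeLT ℝ (p - 1 + 4)) ∧
    (∀ e, qₙ e ∈ Polynomial.degreeLT ℝ (p + 2)) ∧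
    (∀ z : M.nodes, d.1 z = φ z) ∧ (∀ z : M.nodes, d.2.1 z = g z) ∧
    (∀ e, d.2.2.1 e = M.moment e p (qₙ e)) ∧ ∀ e, d.2.2.2 e = M.moment e (p - 1) (q₀ e)

/-- The graph of the map that takes the degrees of freedom. -/
noncomputable def dofGraph (M : BoundaryMesh Ω ι) (p : ℕ) :
    Submodule ℝ (M.Yh p × M.DofSpace p) where
  carrier := {yd | IsDof (yd.1 : M.L2Γ × M.L2Γ) yd.2}
  add_mem' := by
    rintro a b ⟨φ, g, q₀, qₙ, h, k1, k2, k3, k4, k5, k6⟩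
      ⟨ψ, k, r₀, rₙ, h', l1, l2, l3, l4, l5, l6⟩
    refine ⟨φ + ψ, g + k, q₀ + r₀, qₙ + rₙ, h.add h', fun e => add_mem (k1 e) (l1 e),
      fun e => add_mem (k2 e) (l2 e), fun z => ?_, fun z => ?_, fun e => ?_, fun e => ?_⟩
    · simp [k3, l3]
    · simp [k4, l4]
    · simp [k5, l5]
    · simp [k6, l6]
  zero_mem' := ⟨0, 0, 0, 0, IsPolyRep.zero, fun _ => zero_mem _, fun _ => zero_mem _,
    fun _ => rfl, fun _ => rfl, fun e => by simp, fun e => by simp⟩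
  smul_mem' := by
    rintro c a ⟨φ, g, q₀, qₙ, h, k1, k2, k3, k4, k5, k6⟩
    refine ⟨c • φ, c • g, c • q₀, c • qₙ, h.smul c, fun e => Submodule.smul_mem _ c (k1 e),
      fun e => Submodule.smul_mem _ c (k2 e), fun z => ?_, fun z => ?_, fun e => ?_, fun e => ?_⟩
    · simp [k3]
    · simp [k4]
    · simp [k5]
    · simp [k6]

lemma mem_degreeLT_of_natDegree_lt {q : ℝ[X]} {n : ℕ} (h : q.natDegree < n) :
    q ∈ Polynomial.degreeLT ℝ n :=
  Polynomial.mem_degreeLT.2 (Polynomial.degree_le_natDegree.trans_lt (by exact_mod_cast h))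

lemma natDegree_lt_of_mem_degreeLT {q : ℝ[X]} {n : ℕ} (h : q ∈ Polynomial.degreeLT ℝ n)
    (hn : 0 < n) : q.natDegree < n := by
  rcases eq_or_ne q 0 with rfl | hq
  · simpa using hn
  · exact (Polynomial.natDegree_lt_iff_degree_lt hq).2 (Polynomial.mem_degreeLT.1 h)

/-- The degrees of freedom, computed from the continuous representatives and by integration. -/
lemma IsContRep.exists_mem_dofGraph {p : ℕ} {y : M.Yh p} {φ : Plane → ℝ} {g : Plane → Fin 2 → ℝ}
    (h : M.IsContRep y φ g) : ∃ d, (y, d) ∈ M.dofGraph p ∧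
      (∀ z : M.nodes, d.1 z = φ z) ∧ (∀ z : M.nodes, d.2.1 z = g z) ∧
      (∀ e (μ : Polynomial.degreeLT ℝ p),
        d.2.2.1 e μ = ∫ s, (y : M.L2Γ × M.L2Γ).2 (M.γ e s) * μ.1.eval s ∂M.arc e) ∧
      (∀ e (μ : Polynomial.degreeLT ℝ (p - 1)),
        d.2.2.2 e μ = ∫ s, (y : M.L2Γ × M.L2Γ).1 (M.γ e s) * μ.1.eval s ∂M.arc e) := by
  obtain ⟨q₀, qₙ, hq, hd, hd'⟩ := h.exists_isPolyRep y.2.1 y.2.2.1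
  refine ⟨(fun z => φ z, fun z => g z, fun e => M.moment e p (qₙ e),
    fun e => M.moment e (p - 1) (q₀ e)),
    ⟨φ, g, q₀, qₙ, hq, fun e => mem_degreeLT_of_natDegree_lt ?_,
      fun e => mem_degreeLT_of_natDegree_lt (Nat.lt_succ_of_le (hd' e)), fun _ => rfl,
      fun _ => rfl, fun _ => rfl, fun _ => rfl⟩, fun _ => rfl, fun _ => rfl, fun e μ => ?_,
    fun e μ => ?_⟩
  · have := hd e
    split_ifs at this <;> omega
  · refine integral_congr_ae ?_
    filter_upwards [hq.ae_snd e] with s hs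
    rw [hs]
  · refine integral_congr_ae ?_
    filter_upwards [hq.ae_fst e] with s hs
    rw [hs]

lemma eq_zero_of_mem_dofGraph_left {p : ℕ} {d : M.DofSpace p}
    (h : ((0 : M.Yh p), d) ∈ M.dofGraph p) : d = 0 := by
  obtain ⟨φ, g, q₀, qₙ, h, -, -, k3, k4, k5, k6⟩ := h
  obtain ⟨rfl, rfl, hz⟩ := IsPolyRep.eq_zero h
  refine Prod.ext (funext fun z => ?_) (Prod.ext (funext fun z => ?_)
    (Prod.ext (funext fun e => ?_) (funext fun e => ?_)))
  · rw [k3, (hz z (M.nodes_subset z.2)).1]; rfl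
  · rw [k4, (hz z (M.nodes_subset z.2)).2]; rfl
  · rw [k5]; simp
  · rw [k6]; simp

/-- Injectivity of the degrees of freedom: vanishing nodal gradients give vanishing tangential and
normal derivatives at the end points of each edge, and the edge polynomials vanish by unisolvence on
each edge. -/
lemma eq_zero_of_mem_dofGraph_right [Finite ι] {p : ℕ} {y : M.Yh p}
    (h : (y, (0 : M.DofSpace p)) ∈ M.dofGraph p) : y = 0 := by
  obtain ⟨φ, g, q₀, qₙ, h, k1, k2, k3, k4, k5, k6⟩ := h
  have h01 : (0 : ℝ) ∈ Icc (0 : ℝ) 1 := left_mem_Icc.2 zero_le_one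
  have h11 : (1 : ℝ) ∈ Icc (0 : ℝ) 1 := right_mem_Icc.2 zero_le_one
  have hend : ∀ e, ∀ s ∈ Icc (0 : ℝ) 1, M.γ e s ∈ M.nodes →
      (q₀ e).eval s = 0 ∧ (q₀ e).derivative.eval s = 0 ∧ (qₙ e).eval s = 0 := by
    intro e s hs hz
    have h1 : φ (M.γ e s) = 0 := (k3 ⟨_, hz⟩).symm
    have h2 : g (M.γ e s) = 0 := (k4 ⟨_, hz⟩).symm
    rw [h.eq_fst e s hs] at h1
    rw [h.eq_snd e s hs] at h2
    obtain ⟨ha, hb⟩ := M.jet_injective e hs h2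
    exact ⟨h1, (div_eq_zero_iff.1 ha).resolve_right (M.norm_vel_pos e hs).ne', hb⟩
  have hq₀ : ∀ e, q₀ e = 0 := fun e => by
    obtain ⟨a1, a2, -⟩ := hend e 0 h01 ⟨e, Or.inl rfl⟩
    obtain ⟨b1, b2, -⟩ := hend e 1 h11 ⟨e, Or.inr rfl⟩
    refine M.eq_zero_of_valueDof (e := e) (k1 e) ?_
    exact Prod.ext (Prod.ext a1 a2) (Prod.ext (Prod.ext b1 b2) (k6 e).symm)
  have hqₙ : ∀ e, qₙ e = 0 := fun e => by
    obtain ⟨-, -, a⟩ := hend e 0 h01 ⟨e, Or.inl rfl⟩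
    obtain ⟨-, -, b⟩ := hend e 1 h11 ⟨e, Or.inr rfl⟩
    exact M.eq_zero_of_normalDof (e := e) (k2 e) (Prod.ext a (Prod.ext b (k5 e).symm))
  refine Subtype.ext (Prod.ext (M.L2Γ_ext fun e => ?_) (M.L2Γ_ext fun e => ?_))
  · filter_upwards [h.ae_fst e, M.ae_edge (Lp.coeFn_zero ℝ 2 M.surf) e] with s h4 h5
    refine h4.trans (Eq.trans ?_ h5.symm)
    rw [hq₀ e, Polynomial.eval_zero, Pi.zero_apply]
  · filter_upwards [h.ae_snd e, M.ae_edge (Lp.coeFn_zero ℝ 2 M.surf) e] with s h4 h5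
    refine h4.trans (Eq.trans ?_ h5.symm)
    rw [hqₙ e, Polynomial.eval_zero, Pi.zero_apply]

/-- Surjectivity of the degrees of freedom: the nodal gradients are split in the frame of each
adjacent edge, the edge polynomials are found by unisolvence on each edge, and the resulting
functions match at the nodes. -/
lemma exists_mem_dofGraph [Fintype ι] {p : ℕ} (d : M.DofSpace p) :
    ∃ y : M.Yh p, (y, d) ∈ M.dofGraph p := by
  classical
  have h01 : (0 : ℝ) ∈ Icc (0 : ℝ) 1 := left_mem_Icc.2 zero_le_one
  have h11 : (1 : ℝ) ∈ Icc (0 : ℝ) 1 := right_mem_Icc.2 zero_le_one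
  let u : Plane → ℝ := fun z => if hz : z ∈ M.nodes then d.1 ⟨z, hz⟩ else 0
  let w : Plane → Fin 2 → ℝ := fun z => if hz : z ∈ M.nodes then d.2.1 ⟨z, hz⟩ else 0
  choose a₀ b₀ h₀ using fun e => M.exists_jet_eq e h01 (w (M.γ e 0))
  choose a₁ b₁ h₁ using fun e => M.exists_jet_eq e h11 (w (M.γ e 1))
  choose q₀ hd₀ hq₀ using fun e => M.exists_valueDof_eq e (p - 1)
    ((u (M.γ e 0), a₀ e * ‖M.vel e 0‖), (u (M.γ e 1), a₁ e * ‖M.vel e 1‖), d.2.2.2 e)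
  choose qₙ hdₙ hqₙ using fun e => M.exists_normalDof_eq e p (b₀ e, b₁ e, d.2.2.1 e)
  have e0 : ∀ e, (q₀ e).eval 0 = u (M.γ e 0) := fun e => congrArg (fun x => x.1.1) (hq₀ e)
  have e0' : ∀ e, (q₀ e).derivative.eval 0 = a₀ e * ‖M.vel e 0‖ := fun e =>
    congrArg (fun x => x.1.2) (hq₀ e)
  have e1 : ∀ e, (q₀ e).eval 1 = u (M.γ e 1) := fun e => congrArg (fun x => x.2.1.1) (hq₀ e)
  have e1' : ∀ e, (q₀ e).derivative.eval 1 = a₁ e * ‖M.vel e 1‖ := fun e =>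
    congrArg (fun x => x.2.1.2) (hq₀ e)
  have n0 : ∀ e, (qₙ e).eval 0 = b₀ e := fun e => congrArg Prod.fst (hqₙ e)
  have n1 : ∀ e, (qₙ e).eval 1 = b₁ e := fun e => congrArg (fun x => x.2.1) (hqₙ e)
  obtain ⟨φ, hφc, hφ⟩ := M.exists_glue (h := fun e s => (q₀ e).eval s)
    (fun e => (q₀ e).continuous.continuousOn)
    fun e e' s hs s' hs' heq =>
      M.compatible_of_nodal (d := u) (h := fun e s => (q₀ e).eval s) e0 e1 e e' hs hs' heq
  obtain ⟨g, hgc, hg⟩ := M.exists_glue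
    (h := fun e s => M.jet e ((q₀ e).derivative.eval s / ‖M.vel e s‖) ((qₙ e).eval s) s)
    (fun e => (M.contDiffOn_jet e (q₀ e) (qₙ e)).continuousOn)
    fun e e' s hs s' hs' heq => M.compatible_of_nodal (d := w)
      (h := fun e s => M.jet e ((q₀ e).derivative.eval s / ‖M.vel e s‖) ((qₙ e).eval s) s)
      (fun e => by
        rw [e0', n0, mul_div_cancel_right₀ _ (M.norm_vel_pos e h01).ne', h₀])
      (fun e => by
        rw [e1', n1, mul_div_cancel_right₀ _ (M.norm_vel_pos e h11).ne', h₁]) e e' hs hs' heq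
  obtain ⟨L₀, hL₀⟩ := M.exists_L2Γ fun e => (q₀ e).continuous.continuousOn
  obtain ⟨Lₙ, hLₙ⟩ := M.exists_L2Γ fun e => (qₙ e).continuous.continuousOn
  have hrep : M.IsPolyRep (L₀, Lₙ) φ g q₀ qₙ := ⟨hφc, hgc, hφ, hg, hL₀, hLₙ⟩
  have hmem : (L₀, Lₙ) ∈ M.Yh p := by
    refine ⟨fun e => ⟨q₀ e, ?_, hL₀ e⟩, fun e => ⟨qₙ e, ?_, hLₙ e⟩, φ, g, hrep.isContRep⟩
    · have := natDegree_lt_of_mem_degreeLT (hd₀ e) (by omega)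
      split_ifs <;> omega
    · have := natDegree_lt_of_mem_degreeLT (hdₙ e) (by omega)
      omega
  refine ⟨⟨_, hmem⟩, φ, g, q₀, qₙ, hrep, hd₀, hdₙ, ?_, ?_,
    fun e => (congrArg (fun x => x.2.2) (hqₙ e)).symm,
    fun e => (congrArg (fun x => x.2.2) (hq₀ e)).symm⟩
  · rintro ⟨z, hz⟩
    have hu : d.1 ⟨z, hz⟩ = u z := by simp only [u, dif_pos hz]
    rw [hu]
    obtain ⟨e, rfl | rfl⟩ := hz
    · rw [hφ e 0 h01, e0]
    · rw [hφ e 1 h11, e1]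
  · rintro ⟨z, hz⟩
    have hw : d.2.1 ⟨z, hz⟩ = w z := by simp only [w, dif_pos hz]
    rw [hw]
    obtain ⟨e, rfl | rfl⟩ := hz
    · rw [hg e 0 h01, e0', n0, mul_div_cancel_right₀ _ (M.norm_vel_pos e h01).ne', h₀]
    · rw [hg e 1 h11, e1', n1, mul_div_cancel_right₀ _ (M.norm_vel_pos e h11).ne', h₁]

/-- A linear relation that is total and injective in both directions is the graph of a linear
equivalence. -/
lemma exists_linearEquiv_of_graph {R V W : Type*} [Ring R] [AddCommGroup V] [AddCommGroup W]
    [Module R V] [Module R W] (S : Submodule R (V × W)) (hl : ∀ w, (0, w) ∈ S → w = 0)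
    (hr : ∀ v, (v, 0) ∈ S → v = 0) (htl : ∀ v, ∃ w, (v, w) ∈ S) (htr : ∀ w, ∃ v, (v, w) ∈ S) :
    ∃ D : V ≃ₗ[R] W, ∀ v w, (v, w) ∈ S → D v = w := by
  let π₁ : S →ₗ[R] V := (LinearMap.fst R V W).comp S.subtype
  let π₂ : S →ₗ[R] W := (LinearMap.snd R V W).comp S.subtype
  have b₁ : Function.Bijective π₁ := by
    refine ⟨(injective_iff_map_eq_zero π₁).2 ?_, fun v => ?_⟩
    · rintro ⟨⟨v, w⟩, h⟩ (rfl : v = 0)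
      exact Subtype.ext (Prod.ext rfl (hl w h))
    · obtain ⟨w, hw⟩ := htl v
      exact ⟨⟨(v, w), hw⟩, rfl⟩
  have b₂ : Function.Bijective π₂ := by
    refine ⟨(injective_iff_map_eq_zero π₂).2 ?_, fun w => ?_⟩
    · rintro ⟨⟨v, w⟩, h⟩ (rfl : w = 0)
      exact Subtype.ext (Prod.ext (hr v h) rfl)
    · obtain ⟨v, hv⟩ := htr w
      exact ⟨⟨(v, w), hv⟩, rfl⟩
  refine ⟨(LinearEquiv.ofBijective π₁ b₁).symm.trans (LinearEquiv.ofBijective π₂ b₂),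
    fun v w h => ?_⟩
  have h1 : (LinearEquiv.ofBijective π₁ b₁).symm v = ⟨(v, w), h⟩ :=
    (LinearEquiv.symm_apply_eq _).2 rfl
  rw [LinearEquiv.trans_apply, h1]
  rfl

/-- Unisolvence of the degrees of freedom on `Y_h`. -/
theorem exists_dof_equiv [Fintype ι] (M : BoundaryMesh Ω ι) (p : ℕ) :
    ∃ D : M.Yh p ≃ₗ[ℝ] M.DofSpace p,
      ∀ (y : M.Yh p) (φ : Plane → ℝ) (g : Plane → Fin 2 → ℝ), M.IsContRep y φ g →
        (∀ z : M.nodes, (D y).1 z = φ z) ∧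
        (∀ z : M.nodes, (D y).2.1 z = g z) ∧
        (∀ e (μ : Polynomial.degreeLT ℝ p),
          (D y).2.2.1 e μ = ∫ s, (y : M.L2Γ × M.L2Γ).2 (M.γ e s) * μ.1.eval s ∂M.arc e) ∧
        (∀ e (μ : Polynomial.degreeLT ℝ (p - 1)),
          (D y).2.2.2 e μ = ∫ s, (y : M.L2Γ × M.L2Γ).1 (M.γ e s) * μ.1.eval s ∂M.arc e) := by
  obtain ⟨D, hD⟩ := exists_linearEquiv_of_graph (M.dofGraph p)
    (fun _ => eq_zero_of_mem_dofGraph_left) (fun _ => eq_zero_of_mem_dofGraph_right)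
    (fun y => by
      obtain ⟨-, -, φ, g, h⟩ := y.2
      obtain ⟨d, hd, -⟩ := h.exists_mem_dofGraph
      exact ⟨d, hd⟩)
    exists_mem_dofGraph
  refine ⟨D, fun y φ g h => ?_⟩
  obtain ⟨d, hd, hd'⟩ := h.exists_mem_dofGraph
  rw [hD y d hd]
  exact hd'

instance finiteDimensional_dofSpace [Finite ι] (p : ℕ) : FiniteDimensional ℝ (M.DofSpace p) := by
  have := M.finite_nodes.to_subtype
  infer_instance

/-- There are as many nodes as edges, since each node is an end point of exactly two edges. -/
lemma finrank_dofSpace [Fintype ι] (hΩ : IsOpen Ω) (hl : IsLipschitzSet Ω) (p : ℕ) :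
    Module.finrank ℝ (M.DofSpace p) =
      (2 * p + 2 + if p = 0 then 1 else 0) * Fintype.card ι := by
  have := M.finite_nodes.to_subtype
  have : Fintype M.nodes := Fintype.ofFinite _
  have hN : Fintype.card M.nodes = Fintype.card ι := by
    rw [← Nat.card_eq_fintype_card, ← Nat.card_eq_fintype_card, M.card_nodes hΩ hl]
  simp only [Module.finrank_prod, Module.finrank_pi_fintype,
    finrank_dual_degreeLT, Finset.sum_const, Finset.card_univ, hN, smul_eq_mul, Fintype.card_fin]
  rcases p with _ | p
  · simp; ring
  · simp; ring

end BoundaryMesh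

theorem mainTheorem9 {ι : Type*} [Fintype ι] (Ω : Set Plane) (hopen : IsOpen Ω)
    (hconn : IsConnected Ω) (hbdd : Bornology.IsBounded Ω) (hlip : IsLipschitzSet Ω)
    (M : BoundaryMesh Ω ι) (p : ℕ) :
    (∃ J : M.Yh p →ₗ[ℝ] H32 Ω, Function.Injective J ∧
      ∀ y : M.Yh p, ∃ v : H2 Ω, (J y : HdivDiv Ω →L[ℝ] ℝ) = trGg Ω v ∧ M.HasTrace v y) ∧
    FiniteDimensional ℝ (M.Yh p) ∧
    Module.finrank ℝ (M.Yh p) = (2 * p + 2 + if p = 0 then 1 else 0) * Fintype.card ι ∧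
    ∃ D : M.Yh p ≃ₗ[ℝ] M.DofSpace p,
      ∀ (y : M.Yh p) (φ : Plane → ℝ) (g : Plane → Fin 2 → ℝ), M.IsContRep y φ g →
        (∀ z : M.nodes, (D y).1 z = φ z) ∧
        (∀ z : M.nodes, (D y).2.1 z = g z) ∧
        (∀ e (μ : Polynomial.degreeLT ℝ p),
          (D y).2.2.1 e μ = ∫ s, (y : M.L2Γ × M.L2Γ).2 (M.γ e s) * μ.1.eval s ∂M.arc e) ∧
        (∀ e (μ : Polynomial.degreeLT ℝ (p - 1)),
          (D y).2.2.2 e μ = ∫ s, (y : M.L2Γ × M.L2Γ).1 (M.γ e s) * μ.1.eval s ∂M.arc e) := by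
  obtain ⟨D, hD⟩ := M.exists_dof_equiv p
  refine ⟨BoundaryMesh.exists_embedding hopen hconn.nonempty hbdd hlip p,
    LinearEquiv.finiteDimensional D.symm, ?_, D, hD⟩
  rw [D.finrank_eq, BoundaryMesh.finrank_dofSpace hopen hlip]
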